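/- **Theorem 2.** *Model.* For $K\ge 1$ consider $K$ source devices ($k=1,\dots,K$), $K$ destination devices ($k+K$, $k=1,\dots,K$) and a decode-and-forward relay with $M=M_K>K$ antennas; the bandwidth is $B>0$, the coherence interval is $T=T_K>0$. All devices are independent and uniformly distributed in the planar annulus $0<R_{\min}\le l\le R_{\max}$ ($R_{\min}<R_{\max}$) centred at the relay, so that the distance $l_i$ of device $i$ has density $f(l)=2l/(R_{\max}^2-R_{\min}^2)$ on $[R_{\min},R_{\max}]$. The large-scale fading is $\beta_i=c\,l_i^{-\alpha}$ with $c,\alpha>0$. Let $\rho>0$ be the pilot-to-noise power ratio, and, with pilots of length $2K$, put $\beta_i'=\frac{2K\rho\beta_i^2}{1+2K\rho\beta_i}$, $\tilde\beta_i=\beta_i-\beta_i'$. The channels are $G_S=H_SD_S^{1/2}\in\mathbb C^{M\times K}$ and $G_D=D_D^{1/2}H_D\in\mathbb C^{K\times M}$, with i.i.d. $\mathcal{CN}(0,1)$ entries in $H_S,H_D$, $D_S=\mathrm{diag}(\beta_1,\dots,\beta_K)$ and $D_D=\mathrm{diag}(\beta_{K+1},\dots,\beta_{2K})$. Each coefficient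 $g$ of device $i$ is estimated by MMSE from $\sqrt{2K\rho}\,g+n$, $n\sim\mathcal{CN}(0,1)$ independent noise, i.e. $\hat g=\frac{\sqrt{2K\rho}\,\beta_i}{1+2K\rho\beta_i}(\sqrt{2K\rho}\,g+n)$. The relay uses the zero-forcing matrices $F_1=(\hat G_S^H\hat G_S)^{-1}\hat G_S^H$ and $F_2=\hat G_D^H(\hat G_D\hat G_D^H)^{-1}$. With expectations and variances over the small-scale fading and pilot noise for given locations, $U=F_1G_S$, $V=G_DF_2$, noise variances $\sigma_R^2,\sigma_D^2>0$ and device power $P_d>0$, $$\gamma^{(1)}_k=\frac{P_d|\mathbb E U_{kk}|^2}{P_d\mathrm{Var}(U_{kk})+P_d\sum_{j\ne k}\mathbb E|U_{kj}|^2+\sigma_R^2\,\mathbb E\sum_m|(F_1)_{km}|^2},\qquad \gamma^{(2)}_k=\frac{p_k|\mathbb E V_{kk}|^2}{p_k\mathrm{Var}(V_{kk})+\sum_{j\ne k}p_j\mathbb E|V_{kj}|^2+\sigma_D^2},$$ with the equal power allocation $p_k=(M-K)P_R/\sum_{j=1}^K(\beta'_{j+K})^{-1}$, $P_R>0$. Let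 $R_k^{(i)}=\log_2(1+\gamma_k^{(i)})$ and $$\eta_K=\frac{(1-\frac{2K}{T})\frac B2\sum_{k=1}^K\min\{R_k^{(1)},R_k^{(2)}\}}{P_{\rm tot}(Q)},\qquad Q=\mathbb E\,\mathrm{tr}\big(F_2\,\mathrm{diag}(p_1,\dots,p_K)F_2^H\big),$$ where, for a relay transmit power $Q$, $$P_{\rm tot}(Q)=\tfrac{1}{2\eta_d}(1-\tfrac{2K}{T})KP_d+\tfrac{4K^2}{\eta_dT}\rho\sigma_R^2+\tfrac1{2\eta_R}(1-\tfrac{2K}T)Q+P_{\rm FIX}+MP_{\rm ant}+2KP_{\rm dev}+P_{\rm SYN}+\tfrac BT\tfrac{8MK^2}{L_R}+B(1-\tfrac{2K}T)\tfrac{4MK}{L_R}+\tfrac BT\tfrac{K^3+9MK^2+3MK}{3L_R},$$ with $\eta_d,\eta_R\in(0,1)$, $L_R>0$ and nonnegative circuit powers $P_{\rm FIX},P_{\rm ant},P_{\rm dev},P_{\rm SYN}$. All parameters except $M_K,T_K$ are fixed as $K\to\infty$; all locations are drawn once from two infinite independent sequences, the system with $K$ pairs using the first $K$ terms of each. *Deterministic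 expressions.* With $\beta(l)=cl^{-\alpha}$ and $\beta'(l),\tilde\beta(l)$ formed from it as above, let $$\tilde A_1=\frac{K}{2K\rho(R_{\max}^2-R_{\min}^2)}\Big\{R_{\max}^2\,{}_2F_1\big(1,\tfrac2\alpha;\tfrac{\alpha+2}\alpha;-\tfrac{R_{\max}^\alpha}{2Kc\rho}\big)-R_{\min}^2\,{}_2F_1\big(1,\tfrac2\alpha;\tfrac{\alpha+2}\alpha;-\tfrac{R_{\min}^\alpha}{2Kc\rho}\big)\Big\},$$ $$\tilde A_2=\frac{K}{c(R_{\max}^2-R_{\min}^2)}\Big\{\frac1{2K\rho}\,\frac{R_{\max}^{2(\alpha+1)}-R_{\min}^{2(\alpha+1)}}{c(\alpha+1)}+\frac{2(R_{\max}^{\alpha+2}-R_{\min}^{\alpha+2})}{\alpha+2}\Big\},$$ $$\tilde R^{(1)}=\int_{R_{\min}}^{R_{\max}}\log_2\Big(1+\frac{(M-K)P_d\,\beta'(l)}{P_d\tilde A_1+\sigma_R^2}\Big)f(l)\,dl,\qquad \tilde R^{(2)}=\int_{R_{\min}}^{R_{\max}}\log_2\Big(1+\frac{(M-K)P_R}{(P_R\tilde\beta(l)+\sigma_D^2)\tilde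 A_2}\Big)f(l)\,dl,$$ $$\tilde\eta_K=\frac{(1-\frac{2K}T)\frac B2\,K\min\{\tilde R^{(1)},\tilde R^{(2)}\}}{P_{\rm tot}(P_R)}.$$ *Claim.* As $K\to\infty$: (a) almost surely $\eta_K\sim\tilde\eta_K$ (that is, $\eta_K-\tilde\eta_K=o(\tilde\eta_K)$) and $\eta_K-\tilde\eta_K\to0$; the equivalence $\sim\tilde\eta_K$ also holds for the quantity obtained from $\eta_K$ by replacing $Q$ with $P_R$ and $\min\{R_k^{(1)},R_k^{(2)}\}$ with $\min\{\mathbb E R_k^{(1)},\mathbb E R_k^{(2)}\}$, the expectation being over the locations; (b) for $i=1,2$, almost surely $\frac1K\sum_{k=1}^KR_k^{(i)}-\tilde R^{(i)}\to0$; moreover, for all large $K$ every $R^{(i)}_k$ with $k\le K$ is integrable over the locations, and $\max_{k\le K}|\mathbb E R_k^{(i)}-\tilde R^{(i)}|\to0$. (c) For every $K\ge1$, $\tilde A_1=K\int_{R_{\min}}^{R_{\max}}\tilde\beta(l)f(l)\,dl$ and $\tilde A_2=K\int_{R_{\min}}^{R_{\max}}\beta'(l)^{-1}f(l)\,dl$.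 Here ${}_2F_1$ on $(-\infty,0]$ is the Gauss hypergeometric function, analytically continued beyond the unit disc. -/

import Mathlib

open MeasureTheory ProbabilityTheory Filter Topology Asymptotics
open scoped Matrix

namespace RelayIoT

/-- The fixed parameters of the relay network. -/
structure Params where
  /-- bandwidth (Hz) -/
  B : ℝ
  /-- path loss constant and path loss exponent: `β = c * l ^ (-α)` -/
  c : ℝ
  α : ℝ
  /-- inner and outer radius of the coverage area -/
  Rmin : ℝ
  Rmax : ℝ
  /-- ratio of the transmit power of a pilot symbol to the noise power at the relay -/
  ρ : ℝ
  /-- average transmit power of each source device -/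
  Pd : ℝ
  /-- average total transmit power of the relay -/
  PR : ℝ
  /-- noise variances at the relay and at the destinations -/
  σR2 : ℝ
  σD2 : ℝ
  /-- power amplifier efficiencies at the devices and at the relay -/
  ηd : ℝ
  ηR : ℝ
  /-- fixed power consumption -/
  Pfix : ℝ
  /-- circuit power per relay antenna, per device, and of the oscillator -/
  Pant : ℝ
  Pdev : ℝ
  Psyn : ℝ
  /-- computational efficiency at the relay (operations per Joule) -/
  LR : ℝ
  B_pos : 0 < B
  c_pos : 0 < c
  α_pos : 0 < α
  Rmin_pos : 0 < Rmin
  Rmin_lt : Rmin < Rmax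
  ρ_pos : 0 < ρ
  Pd_pos : 0 < Pd
  PR_pos : 0 < PR
  σR2_pos : 0 < σR2
  σD2_pos : 0 < σD2
  ηd_mem : ηd ∈ Set.Ioo (0 : ℝ) 1
  ηR_mem : ηR ∈ Set.Ioo (0 : ℝ) 1
  Pfix_nonneg : 0 ≤ Pfix
  Pant_nonneg : 0 ≤ Pant
  Pdev_nonneg : 0 ≤ Pdev
  Psyn_nonneg : 0 ≤ Psyn
  LR_pos : 0 < LR

/-! ### Small-scale fading -/

/-- The circularly symmetric complex normal law `CN(0,1)`. -/
noncomputable def stdCN : Measure ℂ :=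
  ((gaussianReal 0 (1 / 2)).prod (gaussianReal 0 (1 / 2))).map
    (fun q : ℝ × ℝ => (⟨q.1, q.2⟩ : ℂ))

/-- Law of an `m × n` array with i.i.d. `CN(0,1)` entries. -/
noncomputable def gaussianArray (m n : ℕ) : Measure (Fin m → Fin n → ℂ) :=
  Measure.pi fun _ => Measure.pi fun _ => stdCN

/-- Joint law of (small-scale fading matrix, pilot noise), which are independent. -/
noncomputable def fading (m n : ℕ) :
    Measure ((Fin m → Fin n → ℂ) × (Fin m → Fin n → ℂ)) :=
  (gaussianArray m n).prod (gaussianArray m n)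

/-- Pilot energy-to-noise ratio `τ ρ` with the pilot length `τ = 2K`. -/
noncomputable def pilotSNR (p : Params) (K : ℕ) : ℝ := 2 * K * p.ρ

/-- `β'`, the variance of the entries of the channel estimate. -/
noncomputable def estVar (p : Params) (K : ℕ) (β : ℝ) : ℝ :=
  pilotSNR p K * β ^ 2 / (1 + pilotSNR p K * β)

/-- `β - β'`, the variance of the entries of the channel estimation error. -/
noncomputable def errVar (p : Params) (K : ℕ) (β : ℝ) : ℝ := β - estVar p K β

/-- MMSE estimate of a channel coefficient `g` with law `CN(0, β)` from the despread pilot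
observation `√(τρ) g + n`, where `n` has law `CN(0,1)`. -/
noncomputable def mmse (p : Params) (K : ℕ) (β : ℝ) (g n : ℂ) : ℂ :=
  ((√(pilotSNR p K) * β / (1 + pilotSNR p K * β) : ℝ) : ℂ) *
    (((√(pilotSNR p K) : ℝ) : ℂ) * g + n)

/-- Variance of a complex random variable. -/
noncomputable def cvar {S : Type*} [MeasurableSpace S] (μ : Measure S) (Z : S → ℂ) : ℝ :=
  ∫ s, ‖Z s - ∫ t, Z t ∂μ‖ ^ 2 ∂μ

section Sources

variable (p : Params) {K M : ℕ} (β : Fin K → ℝ)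

/-- Channel matrix from the sources to the relay, `G = H D^{1/2}`. -/
noncomputable def chanS (H : Fin M → Fin K → ℂ) : Matrix (Fin M) (Fin K) ℂ :=
  Matrix.of fun m k => ((√(β k) : ℝ) : ℂ) * H m k

/-- MMSE estimate of the source channel matrix. -/
noncomputable def estS (s : (Fin M → Fin K → ℂ) × (Fin M → Fin K → ℂ)) :
    Matrix (Fin M) (Fin K) ℂ :=
  Matrix.of fun m k => mmse p K (β k) (chanS β s.1 m k) (s.2 m k)

/-- Zero-forcing receive filter `(Ĝᴴ Ĝ)⁻¹ Ĝᴴ`. -/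
noncomputable def zfS (s : (Fin M → Fin K → ℂ) × (Fin M → Fin K → ℂ)) :
    Matrix (Fin K) (Fin M) ℂ :=
  ((estS p β s)ᴴ * estS p β s)⁻¹ * (estS p β s)ᴴ

/-- Effective channel after zero-forcing detection. -/
noncomputable def effS (s : (Fin M → Fin K → ℂ) × (Fin M → Fin K → ℂ)) :
    Matrix (Fin K) (Fin K) ℂ :=
  zfS p β s * chanS β s.1

variable (M) in
/-- SINR of the `k`-th stream in the source-to-relay phase, with large-scale fading `β`. -/
noncomputable def sinr1 (k : Fin K) : ℝ :=
  p.Pd * ‖∫ s, effS p β s k k ∂fading M K‖ ^ 2 /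
    (p.Pd * cvar (fading M K) (fun s => effS p β s k k)
      + p.Pd * ∑ j ∈ Finset.univ.erase k, ∫ s, ‖effS p β s k j‖ ^ 2 ∂fading M K
      + p.σR2 * ∫ s, ∑ m, ‖zfS p β s k m‖ ^ 2 ∂fading M K)

end Sources

section Destinations

variable (p : Params) {K M : ℕ} (β : Fin K → ℝ)

/-- Channel matrix from the relay to the destinations, `G = D^{1/2} H`. -/
noncomputable def chanD (H : Fin K → Fin M → ℂ) : Matrix (Fin K) (Fin M) ℂ :=
  Matrix.of fun k m => ((√(β k) : ℝ) : ℂ) * H k m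

/-- MMSE estimate of the destination channel matrix. -/
noncomputable def estD (s : (Fin K → Fin M → ℂ) × (Fin K → Fin M → ℂ)) :
    Matrix (Fin K) (Fin M) ℂ :=
  Matrix.of fun k m => mmse p K (β k) (chanD β s.1 k m) (s.2 k m)

/-- Zero-forcing precoder `Ĝᴴ (Ĝ Ĝᴴ)⁻¹`. -/
noncomputable def zfD (s : (Fin K → Fin M → ℂ) × (Fin K → Fin M → ℂ)) :
    Matrix (Fin M) (Fin K) ℂ :=
  (estD p β s)ᴴ * (estD p β s * (estD p β s)ᴴ)⁻¹

/-- Effective channel after zero-forcing precoding. -/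
noncomputable def effD (s : (Fin K → Fin M → ℂ) × (Fin K → Fin M → ℂ)) :
    Matrix (Fin K) (Fin K) ℂ :=
  chanD β s.1 * zfD p β s

variable (M) in
/-- SINR of the `k`-th stream in the relay-to-destination phase under the relay power
coefficients `w`, with large-scale fading `β`. -/
noncomputable def sinr2 (w : Fin K → ℝ) (k : Fin K) : ℝ :=
  w k * ‖∫ s, effD p β s k k ∂fading K M‖ ^ 2 /
    (w k * cvar (fading K M) (fun s => effD p β s k k)
      + ∑ j ∈ Finset.univ.erase k, w j * ∫ s, ‖effD p β s k j‖ ^ 2 ∂fading K M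
      + p.σD2)

variable (M) in
/-- Average total transmit power `E tr(x xᴴ)` of the relay signal `x = F P ŝ`, where
`P = diag(√w)` and the symbol vector `ŝ` has identity covariance. -/
noncomputable def relayPower (w : Fin K → ℝ) : ℝ :=
  ∫ s, (Matrix.trace (zfD p β s *
    Matrix.diagonal (fun k => ((w k : ℝ) : ℂ)) * (zfD p β s)ᴴ)).re ∂fading K M

variable (M) in
/-- Equal power allocation at the relay. -/
noncomputable def equalPower : Fin K → ℝ := fun _ =>
  ((M : ℝ) - K) * p.PR / ∑ j, (estVar p K (β j))⁻¹

end Destinations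

/-! ### Rates, power consumption and energy efficiency -/

/-- Large-scale fading coefficient of a device at distance `l`. -/
noncomputable def pathLoss (p : Params) (l : ℝ) : ℝ := p.c * l ^ (-p.α)

/-- Source-to-relay rate of pair `k`, the sources being at the distances `dS`. -/
noncomputable def rate1 (p : Params) {K : ℕ} (M : ℕ) (dS : Fin K → ℝ) (k : Fin K) : ℝ :=
  Real.logb 2 (1 + sinr1 p M (fun j => pathLoss p (dS j)) k)

/-- Relay-to-destination rate of pair `k` with equal power allocation at the relay, the
destinations being at the distances `dD`. -/
noncomputable def rate2 (p : Params) {K : ℕ} (M : ℕ) (dD : Fin K → ℝ) (k : Fin K) : ℝ :=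
  Real.logb 2 (1 + sinr2 p M (fun j => pathLoss p (dD j))
    (equalPower p M (fun j => pathLoss p (dD j))) k)

/-- Total power consumption with `K` pairs, `M` relay antennas, coherence interval `T` and
average relay transmit power `Q`: power amplifiers plus circuits (fixed part, transceiver
chains, signal processing). -/
noncomputable def totalPower (p : Params) (K M : ℕ) (T Q : ℝ) : ℝ :=
  (p.ηd⁻¹ / 2 * (1 - 2 * K / T) * K * p.Pd
      + p.ηd⁻¹ * (4 * (K : ℝ) ^ 2) / T * (p.ρ * p.σR2)
      + p.ηR⁻¹ / 2 * (1 - 2 * K / T) * Q)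
    + (p.Pfix
      + (M * p.Pant + 2 * K * p.Pdev + p.Psyn)
      + (p.B / T * (8 * M * (K : ℝ) ^ 2 / p.LR)
        + p.B * (1 - 2 * K / T) * (4 * M * K / p.LR)
        + p.B / T * (1 / (3 * p.LR)) * ((K : ℝ) ^ 3 + 9 * M * (K : ℝ) ^ 2 + 3 * M * K)))

/-- Energy efficiency for a given sum `S` of the rates of the pairs. -/
noncomputable def effOfRate (p : Params) (K M : ℕ) (T Q S : ℝ) : ℝ :=
  (1 - 2 * K / T) * (p.B / 2) * S / totalPower p K M T Q

/-- Energy efficiency of the system with equal power allocation, the devices being at the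
distances `dS` (sources) and `dD` (destinations). -/
noncomputable def energyEff (p : Params) {K : ℕ} (M : ℕ) (T : ℝ) (dS dD : Fin K → ℝ) : ℝ :=
  effOfRate p K M T
    (relayPower p M (fun j => pathLoss p (dD j)) (equalPower p M (fun j => pathLoss p (dD j))))
    (∑ k, min (rate1 p M dS k) (rate2 p M dD k))

/-! ### Deterministic expressions -/

/-- The coverage area, in the complex plane with the relay at the origin. -/
def coverage (p : Params) : Set ℂ := {z | p.Rmin ≤ ‖z‖ ∧ ‖z‖ ≤ p.Rmax}

/-- Density of the distance between a device and the relay. -/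
noncomputable def distDensity (p : Params) (l : ℝ) : ℝ := 2 * l / (p.Rmax ^ 2 - p.Rmin ^ 2)

/-- The real Gauss hypergeometric function `₂F₁(a, b; c; z)` for `0 < b < c` and `z < 1`:
the Gauss series where it converges, and its analytic continuation to `z ≤ -1` given by
Euler's integral. -/
noncomputable def hyp2F1 (a b c z : ℝ) : ℝ :=
  open Classical in
  if |z| < 1 then ₂F₁ a b c z
  else Real.Gamma c / (Real.Gamma b * Real.Gamma (c - b)) *
    ∫ t in (0 : ℝ)..1, t ^ (b - 1) * (1 - t) ^ (c - b - 1) * (1 - z * t) ^ (-a)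

/-- The constant `Ã₁`. -/
noncomputable def A1 (p : Params) (K : ℕ) : ℝ :=
  K / (2 * K * p.ρ * (p.Rmax ^ 2 - p.Rmin ^ 2)) *
    (p.Rmax ^ 2 * hyp2F1 1 (2 / p.α) ((p.α + 2) / p.α) (-(p.Rmax ^ p.α / (2 * K * p.c * p.ρ)))
      - p.Rmin ^ 2 *
        hyp2F1 1 (2 / p.α) ((p.α + 2) / p.α) (-(p.Rmin ^ p.α / (2 * K * p.c * p.ρ))))

/-- The constant `Ã₂`. -/
noncomputable def A2 (p : Params) (K : ℕ) : ℝ :=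
  K / (p.c * (p.Rmax ^ 2 - p.Rmin ^ 2)) *
    (1 / (2 * K * p.ρ) *
        ((p.Rmax ^ (2 * (p.α + 1)) - p.Rmin ^ (2 * (p.α + 1))) / (p.c * (p.α + 1)))
      + 2 * (p.Rmax ^ (p.α + 2) - p.Rmin ^ (p.α + 2)) / (p.α + 2))

/-- Integral expression for the source-to-relay rate. -/
noncomputable def limRate1 (p : Params) (K M : ℕ) : ℝ :=
  ∫ l in p.Rmin..p.Rmax,
    Real.logb 2 (1 + ((M : ℝ) - K) * p.Pd * estVar p K (pathLoss p l) /
      (p.Pd * A1 p K + p.σR2)) * distDensity p l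

/-- Integral expression for the relay-to-destination rate. -/
noncomputable def limRate2 (p : Params) (K M : ℕ) : ℝ :=
  ∫ l in p.Rmin..p.Rmax,
    Real.logb 2 (1 + ((M : ℝ) - K) * p.PR /
      ((p.PR * errVar p K (pathLoss p l) + p.σD2) * A2 p K)) * distDensity p l

/-- Deterministic expression for the energy efficiency. -/
noncomputable def limEff (p : Params) (K M : ℕ) (T : ℝ) : ℝ :=
  effOfRate p K M T p.PR (K * min (limRate1 p K M) (limRate2 p K M))

end RelayIoT

namespace RelayIoT

/-! ### The complex normal law -/

/-! The argument has an exact part for fixed locations and an asymptotic part over the locations.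

Exact part. For a coefficient of variance β, the pair (fading, pilot noise) consists of two
independent CN(0,1) variables. A planar rotation of this pair (`exists_angle`) gives new variables
u, v for which the estimate is √β' u and the channel is √β' u - √β̃ v. The Gaussian law is rotation
invariant, so u and v are again independent arrays. With U⁺ the pseudo-inverse of U, the effective
channel is the identity minus the matrix with entries √(β̃_k/β'_j) Σ_m v_km U⁺_mj
(`exists_rotation`). Its mean is the identity, and the second moment of each deviation is β̃_k/β'_j
times the mean power of a column of U⁺. The squared norm of column j is the inverse squared distance
from row j of U to the span of the other K-1 rows, that is 1/‖g‖² for a standard Gaussian g in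
dimension n = M-K+1. Since E e^{-t‖g‖²} = (1+t)^{-n}, integrating over t gives 1/(n-1) = 1/(M-K)
(`lintegral_sum_enorm_sq_rightInv`). This yields closed SINR formulas (`sinr1_eq`,
`sinr2_equalPower`), and the mean relay power is exactly P_R (`relayPower_equalPower`). The source
hop reduces to the destination hop by transposition.

Asymptotic part. The pilots have length 2K, so β'/β → 1 and Kβ̃ → 1/(2ρ), uniformly over the
annulus. Up to factors tending to 1, the first SINR is therefore (M-K) times a constant times β(l).
By the law of large numbers for Σ 1/β, the second is (M-K)P_R/(σ_D² K E[1/β]), free of the location.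
A factor θ ≥ 1 in x moves log₂(1+x) by at most 2(θ-1), and by at most the fraction θ-1 of itself,
whatever M is. This gives the rate statements. For the first hop the average of log₂(1+tx) with t =
M-K is handled by subtracting log₂ t and applying a law of large numbers uniform in 1/t
(`strong_law_uniform`).

The second SINR is smaller than the first by a factor of order K, so for large K every minimum is
the second-hop rate (`eventually_snr2_le_snr1`). Prefactor and consumed power are common to both
efficiencies, so the relative error of the sum rate is that of the efficiency. The difference tends
to 0 because the deterministic efficiency is bounded: its sum rate is O(M), while signal processing
costs at least a constant times MK(1+2K/T) (`limEff_bounded`). The closed forms of Ã₁ and Ã₂ are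
Euler's integral for ₂F₁ and integrals of powers. -/

lemma stdCN_eq_map : stdCN = ((gaussianReal 0 (1 / 2)).prod (gaussianReal 0 (1 / 2))).map
    (Complex.equivRealProdCLM.symm : (ℝ × ℝ) →L[ℝ] ℂ) := rfl

instance : IsGaussian stdCN := by
  rw [stdCN_eq_map]; infer_instance

lemma integral_stdCN {E : Type*} [NormedAddCommGroup E] [NormedSpace ℝ E] {f : ℂ → E}
    (hf : AEStronglyMeasurable f stdCN) :
    ∫ z, f z ∂stdCN = ∫ q : ℝ × ℝ, f ⟨q.1, q.2⟩
      ∂(gaussianReal 0 (1 / 2)).prod (gaussianReal 0 (1 / 2)) := by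
  rw [stdCN] at hf ⊢
  rw [integral_map _ hf]
  exact (Complex.equivRealProdCLM.symm.continuous.measurable).aemeasurable

/-- Each real coordinate has variance 1/2, whence the 4. That only ‖z‖ enters is what later makes
projections of Gaussian vectors Gaussian. -/
lemma charFun_stdCN (z : ℂ) : charFun stdCN z = Complex.exp (-‖z‖ ^ 2 / 4) := by
  rw [charFun_apply, integral_stdCN (by fun_prop)]
  have h : ∀ q : ℝ × ℝ, Complex.exp ((inner ℝ (⟨q.1, q.2⟩ : ℂ) z : ℝ) * Complex.I) =
      Complex.exp ((inner ℝ q.1 z.re : ℝ) * Complex.I) *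
        Complex.exp ((inner ℝ q.2 z.im : ℝ) * Complex.I) := fun q => by
    rw [← Complex.exp_add, Complex.inner]
    congr 1
    simp
    ring
  simp_rw [h]
  rw [integral_prod_mul (fun x : ℝ => Complex.exp ((inner ℝ x z.re : ℝ) * Complex.I))
    (fun x : ℝ => Complex.exp ((inner ℝ x z.im : ℝ) * Complex.I)), ← charFun_apply,
    ← charFun_apply, charFun_gaussianReal, charFun_gaussianReal, ← Complex.exp_add]
  congr 1
  have : ‖z‖ ^ 2 = z.re ^ 2 + z.im ^ 2 := by
    rw [← Complex.normSq_eq_norm_sq, Complex.normSq_apply]; ring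
  rw [← Complex.ofReal_pow ‖z‖, this]
  have h2 : ((1 / 2 : NNReal) : ℝ) = 1 / 2 := by simp
  rw [h2]
  push_cast
  ring

lemma integral_id_stdCN : ∫ z, z ∂stdCN = 0 := by
  have hi : Integrable (fun z : ℂ => z) stdCN := IsGaussian.integrable_fun_id
  have hr : Integrable (fun x : ℝ => x) (gaussianReal 0 (1 / 2)) := IsGaussian.integrable_fun_id
  have h0 : ∫ x, x ∂gaussianReal 0 (1 / 2) = 0 := by simp
  apply Complex.ext
  · have := Complex.reCLM.integral_comp_comm hi
    simp only [Complex.reCLM_apply] at this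
    rw [← this, integral_stdCN (by fun_prop)]
    have h := integral_prod_mul (μ := gaussianReal 0 (1 / 2)) (ν := gaussianReal 0 (1 / 2))
      (fun x : ℝ => x) (fun _ => (1 : ℝ))
    simpa using h
  · have := Complex.imCLM.integral_comp_comm hi
    simp only [Complex.imCLM_apply] at this
    rw [← this, integral_stdCN (by fun_prop)]
    have h := integral_prod_mul (μ := gaussianReal 0 (1 / 2)) (ν := gaussianReal 0 (1 / 2))
      (fun _ => (1 : ℝ)) (fun x : ℝ => x)
    simpa using h

lemma memLp_stdCN : MemLp (fun z : ℂ => z) 2 stdCN := IsGaussian.memLp_two_id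

lemma integral_norm_sq_stdCN : ∫ z, ‖z‖ ^ 2 ∂stdCN = 1 := by
  rw [integral_stdCN (by fun_prop)]
  have h : ∀ q : ℝ × ℝ, ‖(⟨q.1, q.2⟩ : ℂ)‖ ^ 2 = q.1 ^ 2 * 1 + 1 * q.2 ^ 2 := fun q => by
    rw [← Complex.normSq_eq_norm_sq, Complex.normSq_apply]; ring
  simp_rw [h]
  have hm : MemLp (fun x : ℝ => x) 2 (gaussianReal 0 (1 / 2)) := IsGaussian.memLp_two_id
  have hs : ∫ x, x ^ 2 ∂gaussianReal 0 (1 / 2) = 1 / 2 := by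
    have := variance_of_integral_eq_zero (X := fun x : ℝ => x) (μ := gaussianReal 0 (1 / 2))
      (by fun_prop) (by simp)
    rw [← this, variance_fun_id_gaussianReal]
    simp
  rw [integral_add (hm.integrable_sq.mul_prod (integrable_const 1))
    ((integrable_const 1).mul_prod hm.integrable_sq),
    integral_prod_mul (fun x : ℝ => x ^ 2) (fun _ => (1 : ℝ)),
    integral_prod_mul (fun _ => (1 : ℝ)) (fun x : ℝ => x ^ 2), hs]
  simp
  norm_num

lemma integral_exp_neg_mul_sq_gaussianReal {t : ℝ} (ht : 0 ≤ t) :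
    ∫ x, Real.exp (-t * x ^ 2) ∂gaussianReal 0 (1 / 2) = (√(1 + t))⁻¹ := by
  rw [integral_gaussianReal_eq_integral_smul (by norm_num)]
  have h : ∀ x : ℝ, gaussianPDFReal 0 (1 / 2) x • Real.exp (-t * x ^ 2)
      = (√Real.pi)⁻¹ * Real.exp (-(1 + t) * x ^ 2) := fun x => by
    have h2 : ((1 / 2 : NNReal) : ℝ) = 1 / 2 := by simp
    rw [gaussianPDFReal, smul_eq_mul, mul_assoc, ← Real.exp_add, h2]
    congr 2
    · congr 1; ring_nf
    · ring
  simp_rw [h]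
  rw [integral_const_mul, integral_gaussian, Real.sqrt_div Real.pi_pos.le]
  have : √Real.pi ≠ 0 := (Real.sqrt_pos.2 Real.pi_pos).ne'
  field_simp

/-- The Laplace transform of an exponential variable of mean 1. Its powers are the transforms of
squared norms of Gaussian vectors, from which inverse moments are computed. -/
lemma integral_exp_neg_mul_norm_sq_stdCN {t : ℝ} (ht : 0 ≤ t) :
    ∫ z, Real.exp (-t * ‖z‖ ^ 2) ∂stdCN = (1 + t)⁻¹ := by
  rw [integral_stdCN (by fun_prop)]
  have h : ∀ q : ℝ × ℝ, Real.exp (-t * ‖(⟨q.1, q.2⟩ : ℂ)‖ ^ 2)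
      = Real.exp (-t * q.1 ^ 2) * Real.exp (-t * q.2 ^ 2) := fun q => by
    rw [← Complex.normSq_eq_norm_sq, Complex.normSq_apply, ← Real.exp_add]; congr 1; ring
  simp_rw [h]
  rw [integral_prod_mul (fun x : ℝ => Real.exp (-t * x ^ 2)) (fun x : ℝ => Real.exp (-t * x ^ 2)),
    integral_exp_neg_mul_sq_gaussianReal ht, ← mul_inv, Real.mul_self_sqrt (by linarith)]

/-- Law of a vector with i.i.d. `CN(0,1)` entries. -/
noncomputable def gaussianVec (m : ℕ) : Measure (Fin m → ℂ) := Measure.pi fun _ => stdCN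

instance (m : ℕ) : IsProbabilityMeasure (gaussianVec m) := by
  unfold gaussianVec; infer_instance

lemma gaussianArray_eq (m n : ℕ) : gaussianArray m n = Measure.pi fun _ => gaussianVec n := rfl

instance (m n : ℕ) : IsProbabilityMeasure (gaussianArray m n) := by
  unfold gaussianArray; infer_instance

instance (m n : ℕ) : IsProbabilityMeasure (fading m n) := by
  unfold fading; infer_instance

lemma charFun_gaussianVec {m : ℕ} (z : EuclideanSpace ℂ (Fin m)) :
    charFun ((gaussianVec m).map (WithLp.toLp 2)) z = Complex.exp (-‖z‖ ^ 2 / 4) := by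
  have h := charFun_pi (μ := fun _ : Fin m => stdCN) z
  unfold gaussianVec
  rw [h]
  simp_rw [charFun_stdCN]
  rw [← Complex.exp_sum, ← Complex.ofReal_pow, EuclideanSpace.norm_sq_eq]
  push_cast
  simp only [Finset.sum_div, neg_div, Finset.sum_neg_distrib]

lemma real_inner_euclideanSpace_complex {m : ℕ} (x y : EuclideanSpace ℂ (Fin m)) :
    inner ℝ x y = (inner ℂ x y).re := by
  simp [PiLp.inner_apply, Complex.inner]

lemma lintegral_exp_neg_mul_norm_sq_gaussianVec (n : ℕ) {t : ℝ} (ht : 0 ≤ t) :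
    ∫⁻ g, ENNReal.ofReal (Real.exp (-t * ‖WithLp.toLp 2 g‖ ^ 2)) ∂gaussianVec n
      = ENNReal.ofReal ((1 + t)⁻¹ ^ n) := by
  have h : ∀ g : Fin n → ℂ, Real.exp (-t * ‖WithLp.toLp 2 g‖ ^ 2)
      = ∏ i, Real.exp (-t * ‖g i‖ ^ 2) := fun g => by
    rw [EuclideanSpace.norm_sq_eq, ← Real.exp_sum, Finset.mul_sum]
  rw [← ofReal_integral_eq_lintegral_ofReal]
  · congr 1
    simp_rw [h]
    unfold gaussianVec
    rw [integral_fintype_prod_eq_prod (fun (_ : Fin n) (z : ℂ) => Real.exp (-t * ‖z‖ ^ 2))]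
    simp only [integral_exp_neg_mul_norm_sq_stdCN ht, Finset.prod_const, Finset.card_univ,
      Fintype.card_fin]
  · refine Integrable.of_bound (C := 1) ?_ (ae_of_all _ fun g => ?_)
    · refine Measurable.aestronglyMeasurable ?_
      simp_rw [h]
      fun_prop
    · rw [Real.norm_of_nonneg (Real.exp_pos _).le, Real.exp_le_one_iff]
      have := sq_nonneg ‖WithLp.toLp 2 g‖
      nlinarith
  · exact ae_of_all _ fun g => (Real.exp_pos _).le

/-- The coordinates of the projection of a Gaussian vector to a subspace, in an orthonormal basis of
the subspace, form a Gaussian vector. -/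
lemma map_orthogonalProjectionOnto_gaussianVec {m n : ℕ}
    (V : Submodule ℂ (EuclideanSpace ℂ (Fin m))) (e : V ≃ₗᵢ[ℂ] EuclideanSpace ℂ (Fin n)) :
    (gaussianVec m).map (fun g => e (V.orthogonalProjectionOnto (WithLp.toLp 2 g)))
      = (gaussianVec n).map (WithLp.toLp 2) := by
  have hm : Measurable (WithLp.toLp 2 : (Fin m → ℂ) → EuclideanSpace ℂ (Fin m)) := by fun_prop
  have hn : Measurable (WithLp.toLp 2 : (Fin n → ℂ) → EuclideanSpace ℂ (Fin n)) := by fun_prop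
  have hc : Continuous fun x : EuclideanSpace ℂ (Fin m) => e (V.orthogonalProjectionOnto x) := by
    fun_prop
  have hcomp : (gaussianVec m).map (fun g => e (V.orthogonalProjectionOnto (WithLp.toLp 2 g)))
      = ((gaussianVec m).map (WithLp.toLp 2)).map
        (fun x => e (V.orthogonalProjectionOnto x)) := by
    rw [Measure.map_map hc.measurable hm]; rfl
  have : IsProbabilityMeasure ((gaussianVec m).map (WithLp.toLp 2)) :=
    Measure.isProbabilityMeasure_map hm.aemeasurable
  have : IsProbabilityMeasure ((gaussianVec n).map (WithLp.toLp 2)) :=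
    Measure.isProbabilityMeasure_map hn.aemeasurable
  rw [hcomp]
  have : IsProbabilityMeasure (((gaussianVec m).map (WithLp.toLp 2)).map
        (fun x => e (V.orthogonalProjectionOnto x))) :=
    Measure.isProbabilityMeasure_map hc.measurable.aemeasurable
  refine Measure.ext_of_charFun (E := EuclideanSpace ℂ (Fin n)) ?_
  ext z
  rw [charFun_gaussianVec, charFun_apply, integral_map hc.measurable.aemeasurable
    (Measurable.aestronglyMeasurable (by fun_prop))]
  -- The adjoint of projection followed by `e` is `e.symm` followed by inclusion, which preserves
  -- norms. The characteristic function of the image is thus the same function of ‖z‖.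
  have h : ∀ x : EuclideanSpace ℂ (Fin m), inner ℝ (e (V.orthogonalProjectionOnto x)) z
      = inner ℝ x ((e.symm z : V) : EuclideanSpace ℂ (Fin m)) := fun x => by
    rw [real_inner_euclideanSpace_complex, real_inner_euclideanSpace_complex]
    have h1 := LinearIsometry.inner_map_map (𝕜 := ℂ) (E := V) (E' := EuclideanSpace ℂ (Fin n))
      e.toLinearIsometry (V.orthogonalProjectionOnto x) (e.symm z)
    have h2 : e.toLinearIsometry (e.symm z) = z := e.apply_symm_apply z
    rw [h2] at h1
    rw [← Submodule.inner_orthogonalProjectionOnto_eq_of_mem_right]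
    exact congrArg Complex.re h1
  simp_rw [h]
  have hz : ‖((e.symm z : V) : EuclideanSpace ℂ (Fin m))‖ = ‖z‖ := e.symm.norm_map z
  rw [← charFun_apply, charFun_gaussianVec, hz]

/-! ### Inverse moments of Gaussian norms. -/

/-- Stated in extended nonnegative reals so that x = 0 is covered, both sides being infinite. No
almost sure positivity is needed when it is applied to a random norm. -/
lemma lintegral_exp_neg_mul {x : ℝ} (hx : 0 ≤ x) :
    ∫⁻ t in Set.Ioi (0 : ℝ), ENNReal.ofReal (Real.exp (-t * x)) = (ENNReal.ofReal x)⁻¹ := by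
  rcases hx.eq_or_lt with rfl | hx
  · simp
  · rw [← ofReal_integral_eq_lintegral_ofReal]
    · rw [← ENNReal.ofReal_inv_of_pos hx]
      congr 1
      have := integral_exp_mul_Ioi (a := -x) (by linarith) 0
      simp only [mul_zero, Real.exp_zero] at this
      rw [← neg_div_neg_eq, neg_neg, neg_neg, one_div] at this
      rw [← this]
      congr 1; ext t; congr 1; ring
    · have := (integrableOn_exp_mul_Ioi (a := -x) (by linarith) 0)
      refine this.congr_fun (fun t _ => ?_) measurableSet_Ioi
      simp only; congr 1; ring
    · exact ae_of_all _ fun g => (Real.exp_pos _).le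

lemma lintegral_one_add_inv_pow {n : ℕ} (hn : 2 ≤ n) :
    ∫⁻ t in Set.Ioi (0 : ℝ), ENNReal.ofReal ((1 + t)⁻¹ ^ n) = (ENNReal.ofReal (n - 1))⁻¹ := by
  have hn' : (2 : ℝ) ≤ n := by exact_mod_cast hn
  have key : ∀ t : ℝ, 0 < t → (1 + t)⁻¹ ^ n = (t + 1) ^ (-(n : ℝ)) := fun t ht => by
    rw [Real.rpow_neg (by linarith), Real.rpow_natCast, inv_pow, add_comm]
  rw [← ofReal_integral_eq_lintegral_ofReal]
  · rw [← ENNReal.ofReal_inv_of_pos (by linarith)]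
    congr 1
    rw [setIntegral_congr_fun measurableSet_Ioi (fun t ht => key t ht)]
    have h := integral_Ioi_rpow_of_lt (a := -(n : ℝ)) (by linarith) (c := 1) one_pos
    have h2 := (measurePreserving_add_right volume (1 : ℝ)).setIntegral_preimage_emb
      (measurableEmbedding_addRight 1) (fun x : ℝ => x ^ (-(n : ℝ))) (Set.Ioi 1)
    rw [Set.preimage_add_const_Ioi, sub_self] at h2
    rw [h2, h, Real.one_rpow, ← neg_div_neg_eq, neg_neg, one_div]
    congr 1; ring
  · refine IntegrableOn.congr_fun ?_ (fun t ht => (key t ht).symm) measurableSet_Ioi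
    exact integrableOn_add_rpow_Ioi_of_lt (by linarith) (by norm_num)
  · refine (ae_restrict_iff' measurableSet_Ioi).2 (ae_of_all _ fun t ht => ?_)
    have : (0 : ℝ) < t := ht
    simp only [Pi.zero_apply]
    positivity

/-- Expectation of the inverse squared norm of the projection of a Gaussian vector. -/
lemma lintegral_inv_norm_sq_projection {m n : ℕ} (hn : 2 ≤ n)
    (V : Submodule ℂ (EuclideanSpace ℂ (Fin m))) (hV : Module.finrank ℂ V = n) :
    ∫⁻ g, (ENNReal.ofReal (‖V.orthogonalProjectionOnto (WithLp.toLp 2 g)‖ ^ 2))⁻¹ ∂gaussianVec m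
      = (ENNReal.ofReal (n - 1))⁻¹ := by
  obtain ⟨e⟩ : Nonempty (V ≃ₗᵢ[ℂ] EuclideanSpace ℂ (Fin n)) :=
    ⟨by subst hV; exact (stdOrthonormalBasis ℂ V).repr⟩
  have hP : Measurable fun g : Fin m → ℂ => e (V.orthogonalProjectionOnto (WithLp.toLp 2 g)) := by
    have : Continuous fun g : Fin m → ℂ => e (V.orthogonalProjectionOnto (WithLp.toLp 2 g)) := by
      fun_prop
    exact this.measurable
  have h1 : ∀ g : Fin m → ℂ, ‖V.orthogonalProjectionOnto (WithLp.toLp 2 g)‖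
      = ‖e (V.orthogonalProjectionOnto (WithLp.toLp 2 g))‖ := fun g => (e.norm_map _).symm
  simp_rw [h1]
  have hmap := map_orthogonalProjectionOnto_gaussianVec V e
  have hf : Measurable fun x : EuclideanSpace ℂ (Fin n) => (ENNReal.ofReal (‖x‖ ^ 2))⁻¹ := by
    fun_prop
  have hn2 : Measurable (WithLp.toLp 2 : (Fin n → ℂ) → EuclideanSpace ℂ (Fin n)) := by fun_prop
  rw [← lintegral_map (f := fun x : EuclideanSpace ℂ (Fin n) => (ENNReal.ofReal (‖x‖ ^ 2))⁻¹) hf hP,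
    hmap, lintegral_map hf hn2]
  -- Write 1/‖g‖² as the integral of e^{-t‖g‖²} over t > 0 and exchange by Tonelli. The inner
  -- expectation is (1+t)^{-n}.
  simp_rw [fun g : Fin n → ℂ => (lintegral_exp_neg_mul (sq_nonneg ‖WithLp.toLp 2 g‖)).symm]
  rw [lintegral_lintegral_swap]
  · rw [← lintegral_one_add_inv_pow hn]
    refine setLIntegral_congr_fun measurableSet_Ioi fun t ht => ?_
    exact lintegral_exp_neg_mul_norm_sq_gaussianVec n (le_of_lt ht)
  · refine Measurable.aemeasurable ?_
    refine ENNReal.measurable_ofReal.comp (Real.measurable_exp.comp ?_)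
    exact (measurable_snd.neg).mul (((hn2.comp measurable_fst).norm).pow_const 2)

/-! ### Zero-forcing with a Gaussian channel -/

/-- In the application `a` is a conjugated column of the pseudo-inverse, `g` the matching row and
`W` the span of the other rows. Projecting to `Wᗮ` gives a = c q with q the projection of g. Then
⟨a, g⟩ = ⟨a, q⟩ = 1 forces ‖c‖ ‖q‖² = 1. -/
lemma norm_sq_mul_norm_sq_projection_eq_one {E : Type*} [NormedAddCommGroup E]
    [InnerProductSpace ℂ E] [FiniteDimensional ℂ E] (W : Submodule ℂ E) {a g : E} {c : ℂ}
    (hc : a - c • g ∈ W) (ha : a ∈ Wᗮ) (hag : inner ℂ a g = 1) :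
    ‖a‖ ^ 2 * ‖Wᗮ.orthogonalProjectionOnto g‖ ^ 2 = 1 := by
  set q := Wᗮ.orthogonalProjectionOnto g
  have h1 : (⟨a, ha⟩ : Wᗮ) = c • q := by
    have h := Submodule.orthogonalProjectionOnto_orthogonal_apply_eq_zero hc
    rw [map_sub, map_smul, sub_eq_zero] at h
    rw [← h]
    exact (Submodule.orthogonalProjectionOnto_mem_subspace_eq_self (⟨a, ha⟩ : Wᗮ)).symm
  have h2 : inner ℂ (⟨a, ha⟩ : Wᗮ) q = 1 := by
    rw [Submodule.inner_orthogonalProjectionOnto_eq_of_mem_left]; exact hag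
  have h3 : ‖a‖ = ‖c‖ * ‖q‖ := by
    have : ‖a‖ = ‖(⟨a, ha⟩ : Wᗮ)‖ := rfl
    rw [this, h1, norm_smul]
  rw [h1, inner_smul_left, inner_self_eq_norm_sq_to_K] at h2
  have h4 : ‖c‖ * ‖q‖ ^ 2 = 1 := by
    have := congrArg norm h2
    simpa using this
  rw [h3]
  calc (‖c‖ * ‖q‖) ^ 2 * ‖q‖ ^ 2 = (‖c‖ * ‖q‖ ^ 2) ^ 2 := by ring
    _ = 1 := by rw [h4, one_pow]

/-! ### Pseudo-inverses of Gaussian matrices. -/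

/-- The right pseudo-inverse `Aᴴ (A Aᴴ)⁻¹`. -/
noncomputable def rightInv {K M : ℕ} (A : Matrix (Fin K) (Fin M) ℂ) : Matrix (Fin M) (Fin K) ℂ :=
  Aᴴ * (A * Aᴴ)⁻¹

lemma isUnit_mul_conjTranspose_iff {K M : ℕ} (A : Matrix (Fin K) (Fin M) ℂ) :
    IsUnit (A * Aᴴ) ↔ LinearIndependent ℂ A.row := by
  rw [← Matrix.vecMul_injective_iff_isUnit, ← Matrix.vecMul_injective_iff,
    ← Matrix.coe_vecMulLinear, ← Matrix.coe_vecMulLinear, injective_iff_map_eq_zero,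
    injective_iff_map_eq_zero]
  simp only [Matrix.vecMulLinear_apply]
  open scoped ComplexOrder in
  simp_rw [Matrix.vecMul_self_mul_conjTranspose_eq_zero]

lemma isUnit_mul_conjTranspose_iff_toLp {K M : ℕ} (u : Fin K → Fin M → ℂ) :
    IsUnit (Matrix.of u * (Matrix.of u)ᴴ) ↔
      LinearIndependent ℂ fun k => (WithLp.toLp 2 (u k) : EuclideanSpace ℂ (Fin M)) := by
  rw [isUnit_mul_conjTranspose_iff]
  exact (LinearMap.linearIndependent_iff (WithLp.linearEquiv 2 ℂ (Fin M → ℂ)).symm.toLinearMap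
    (LinearEquiv.ker _)).symm

lemma mul_rightInv {K M : ℕ} {A : Matrix (Fin K) (Fin M) ℂ} (h : IsUnit (A * Aᴴ)) :
    A * rightInv A = 1 := by
  rw [rightInv, ← Matrix.mul_assoc, Matrix.mul_nonsing_inv _ ((Matrix.isUnit_iff_isUnit_det _).1 h)]

lemma measurable_det_gram {K M : ℕ} :
    Measurable fun u : Fin K → Fin M → ℂ => (Matrix.of u * (Matrix.of u)ᴴ).det := by
  have : Continuous fun u : Fin K → Fin M → ℂ => (Matrix.of u * (Matrix.of u)ᴴ).det := by
    have h : Continuous fun u : Fin K → Fin M → ℂ => (Matrix.of u : Matrix _ _ ℂ) := continuous_id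
    exact (h.matrix_mul h.matrix_conjTranspose).matrix_det
  exact this.measurable

/-- By Cramer's rule the entry is a continuous function times the inverse determinant. The
convention 0⁻¹ = 0 keeps it measurable across the singular set. -/
lemma measurable_rightInv {K M : ℕ} (m : Fin M) (j : Fin K) :
    Measurable fun u : Fin K → Fin M → ℂ => rightInv (Matrix.of u) m j := by
  have h : Continuous fun u : Fin K → Fin M → ℂ => (Matrix.of u : Matrix _ _ ℂ) := continuous_id
  have h2 : Continuous fun u : Fin K → Fin M → ℂ =>
      ((Matrix.of u)ᴴ * (Matrix.of u * (Matrix.of u)ᴴ).adjugate) m j := by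
    refine Continuous.matrix_elem ?_ m j
    exact h.matrix_conjTranspose.matrix_mul
      (h.matrix_mul h.matrix_conjTranspose).matrix_adjugate
  have : (fun u : Fin K → Fin M → ℂ => rightInv (Matrix.of u) m j) = fun u =>
      ((Matrix.of u * (Matrix.of u)ᴴ).det)⁻¹ *
        ((Matrix.of u)ᴴ * (Matrix.of u * (Matrix.of u)ᴴ).adjugate) m j := by
    ext u
    rw [rightInv, Matrix.inv_def, Ring.inverse_eq_inv', Matrix.mul_smul, Matrix.smul_apply,
      smul_eq_mul]
  rw [this]
  exact measurable_det_gram.inv.mul h2.measurable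

lemma finrank_orthogonal_span {n m : ℕ} {v : Fin n → EuclideanSpace ℂ (Fin m)}
    (hv : LinearIndependent ℂ v) :
    Module.finrank ℂ (Submodule.span ℂ (Set.range v))ᗮ = m - n := by
  have h := Submodule.finrank_add_finrank_orthogonal (Submodule.span ℂ (Set.range v))
  rw [finrank_span_eq_card hv, finrank_euclideanSpace, Fintype.card_fin, Fintype.card_fin] at h
  omega

/-- Induction on the rows: a new row spoils independence only if its projection to the orthogonal
complement of the others vanishes. The inverse square of that projection has finite mean, because
the strict inequality leaves a complement of dimension at least 2. -/
lemma ae_isUnit_gram {n m : ℕ} (h : n < m) :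
    ∀ᵐ u ∂gaussianArray n m, IsUnit (Matrix.of u * (Matrix.of u)ᴴ) := by
  induction n with
  | zero =>
    refine ae_of_all _ fun u => ?_
    rw [isUnit_mul_conjTranspose_iff]
    exact linearIndependent_empty_type
  | succ n ih =>
    have hp := measurePreserving_piFinSuccAbove (fun _ : Fin (n + 1) => gaussianVec m) 0
    have hms : MeasurableSet {u : Fin (n + 1) → Fin m → ℂ |
        IsUnit (Matrix.of u * (Matrix.of u)ᴴ)} := by
      simp_rw [Matrix.isUnit_iff_isUnit_det, isUnit_iff_ne_zero]
      exact (measurableSet_eq_fun measurable_det_gram measurable_const).compl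
    have hsw : MeasurePreserving Prod.swap
        ((Measure.pi fun _ : Fin n => gaussianVec m).prod (gaussianVec m))
        ((gaussianVec m).prod (Measure.pi fun _ : Fin n => gaussianVec m)) :=
      Measure.measurePreserving_swap
    have hq := hp.symm.comp hsw
    rw [gaussianArray_eq, ← hq.map_eq, ae_map_iff hq.measurable.aemeasurable hms]
    refine (Measure.ae_prod_iff_ae_ae (hq.measurable hms)).2 ?_
    filter_upwards [ih (by omega)] with w hw
    rw [isUnit_mul_conjTranspose_iff_toLp] at hw
    set W := Submodule.span ℂ (Set.range fun k => (WithLp.toLp 2 (w k) : EuclideanSpace ℂ (Fin m)))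
      with hW
    have hl := lintegral_inv_norm_sq_projection (n := m - n) (by omega) Wᗮ
      (finrank_orthogonal_span hw)
    have hm : Measurable fun g : Fin m → ℂ =>
        (ENNReal.ofReal (‖Wᗮ.orthogonalProjectionOnto (WithLp.toLp 2 g)‖ ^ 2))⁻¹ := by
      have : Continuous fun g : Fin m → ℂ => ‖Wᗮ.orthogonalProjectionOnto (WithLp.toLp 2 g)‖ ^ 2 := by
        fun_prop
      exact this.measurable.ennreal_ofReal.inv
    have hfin := ae_lt_top hm (by
      rw [hl]
      refine ENNReal.inv_ne_top.2 ?_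
      rw [Ne, ENNReal.ofReal_eq_zero, not_le, sub_pos]
      exact_mod_cast (by omega : 1 < m - n))
    filter_upwards [hfin] with g hg
    simp only [Function.comp, Prod.swap]
    rw [isUnit_mul_conjTranspose_iff_toLp]
    have he : (fun k => (WithLp.toLp 2 ((MeasurableEquiv.piFinSuccAbove
        (fun _ : Fin (n + 1) => Fin m → ℂ) 0).symm (g, w) k) : EuclideanSpace ℂ (Fin m)))
        = Fin.cons (WithLp.toLp 2 g) fun k => WithLp.toLp 2 (w k) := by
      ext k
      refine Fin.cases ?_ (fun k => ?_) k
      · rfl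
      · rfl
    rw [he, linearIndependent_finCons]
    refine ⟨hw, fun hgW => ?_⟩
    have h0 := Submodule.orthogonalProjectionOnto_orthogonal_apply_eq_zero hgW
    rw [← hW] at h0
    rw [h0] at hg
    simp at hg

/-- The conjugated column j of the pseudo-inverse is a combination of the rows and is biorthogonal
to them. It is therefore orthogonal to all rows but the j-th and has inner product 1 with that one.
Conjugation appears because the inner product is conjugate linear in its first argument. -/
lemma sum_enorm_sq_rightInv {n m : ℕ} (u : Fin (n + 1) → Fin m → ℂ) (j : Fin (n + 1))
    (hu : IsUnit (Matrix.of u * (Matrix.of u)ᴴ)) :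
    ∑ i, ‖rightInv (Matrix.of u) i j‖ₑ ^ 2 = (ENNReal.ofReal (‖(Submodule.span ℂ (Set.range
      fun k => (WithLp.toLp 2 (u (j.succAbove k)) :
        EuclideanSpace ℂ (Fin m))))ᗮ.orthogonalProjectionOnto (WithLp.toLp 2 (u j))‖ ^ 2))⁻¹ := by
  set W := Submodule.span ℂ (Set.range fun k => (WithLp.toLp 2 (u (j.succAbove k)) :
        EuclideanSpace ℂ (Fin m)))
  set F := rightInv (Matrix.of u)
  set a : EuclideanSpace ℂ (Fin m) := WithLp.toLp 2 fun i => star (F i j) with ha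
  set c : Fin (n + 1) → ℂ := fun k => star ((Matrix.of u * (Matrix.of u)ᴴ)⁻¹ k j) with hc
  have hinner : ∀ k, inner ℂ a (WithLp.toLp 2 (u k)) = (1 : Matrix _ _ ℂ) k j := fun k => by
    rw [← mul_rightInv hu, Matrix.mul_apply]
    simp [PiLp.inner_apply, ha, F]
  have hsum : a = ∑ k, c k • (WithLp.toLp 2 (u k) : EuclideanSpace ℂ (Fin m)) := by
    ext i
    simp [ha, hc, F, rightInv, Matrix.mul_apply, mul_comm]
  have key := norm_sq_mul_norm_sq_projection_eq_one W (a := a) (g := WithLp.toLp 2 (u j))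
    (c := c j) (by
      rw [hsum, Fin.sum_univ_succAbove _ j, add_sub_cancel_left]
      exact Submodule.sum_mem _ fun k _ => Submodule.smul_mem _ _
        (Submodule.subset_span ⟨k, rfl⟩)) (by
      rw [Submodule.mem_orthogonal']
      intro x hx
      induction hx using Submodule.span_induction with
      | mem x hx =>
        obtain ⟨k, rfl⟩ := hx
        simp only [hinner]
        exact Matrix.one_apply_ne (Fin.succAbove_ne j k)
      | zero => exact inner_zero_right _
      | add x y _ _ hx hy => rw [inner_add_right, hx, hy, add_zero]
      | smul t x _ hx => rw [inner_smul_right, hx, mul_zero])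
    (by rw [hinner, Matrix.one_apply_eq])
  have hnorm : ∑ i, ‖F i j‖ₑ ^ 2 = ENNReal.ofReal (‖a‖ ^ 2) := by
    rw [EuclideanSpace.norm_sq_eq, ENNReal.ofReal_sum_of_nonneg fun i _ => sq_nonneg _]
    refine Finset.sum_congr rfl fun i _ => ?_
    rw [ENNReal.ofReal_pow (norm_nonneg _), ofReal_norm]
    simp [ha, enorm_eq_nnnorm]
  rw [hnorm]
  refine ENNReal.eq_inv_of_mul_eq_one_left ?_
  rw [← ENNReal.ofReal_mul (sq_nonneg _), key, ENNReal.ofReal_one]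

/-- Mean power of the columns of the zero-forcing matrix. -/
lemma lintegral_sum_enorm_sq_rightInv {K M : ℕ} (h : K < M) (j : Fin K) :
    ∫⁻ u, ∑ i, ‖rightInv (Matrix.of u) i j‖ₑ ^ 2 ∂gaussianArray K M
      = (ENNReal.ofReal ((M : ℝ) - K))⁻¹ := by
  obtain ⟨n, rfl⟩ : ∃ n, K = n + 1 := ⟨K - 1, by have := j.2; omega⟩
  have hp := measurePreserving_piFinSuccAbove (fun _ : Fin (n + 1) => gaussianVec M) j
  have hsw : MeasurePreserving Prod.swap
      ((Measure.pi fun _ : Fin n => gaussianVec M).prod (gaussianVec M))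
      ((gaussianVec M).prod (Measure.pi fun _ : Fin n => gaussianVec M)) :=
    Measure.measurePreserving_swap
  have hq := hp.symm.comp hsw
  have hmeas : Measurable fun u : Fin (n + 1) → Fin M → ℂ =>
      ∑ i, ‖rightInv (Matrix.of u) i j‖ₑ ^ 2 :=
    Finset.measurable_sum _ fun i _ => (measurable_rightInv i j).enorm.pow_const 2
  have hae := Measure.ae_ae_of_ae_prod (hq.quasiMeasurePreserving.ae (ae_isUnit_gram h))
  rw [gaussianArray_eq, ← hq.lintegral_comp hmeas]
  refine (lintegral_prod _ (hmeas.comp hq.measurable).aemeasurable).trans ?_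
  have hw : ∀ᵐ w ∂Measure.pi fun _ : Fin n => gaussianVec M,
      IsUnit (Matrix.of w * (Matrix.of w)ᴴ) := ae_isUnit_gram (by omega)
  -- With n = K-1 other rows the complement has dimension M-n = M-K+1, so the inverse moment is
  -- 1/(M-K).
  have hcast : ((M - n : ℕ) : ℝ) - 1 = (M : ℝ) - ((n + 1 : ℕ) : ℝ) := by
    rw [Nat.cast_sub (by omega)]; push_cast; ring
  rw [← hcast]
  calc _ = ∫⁻ w, (ENNReal.ofReal (((M - n : ℕ) : ℝ) - 1))⁻¹
        ∂Measure.pi fun _ : Fin n => gaussianVec M := by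
        refine lintegral_congr_ae ?_
        filter_upwards [hae, hw] with w hw1 hw2
        rw [isUnit_mul_conjTranspose_iff_toLp] at hw2
        rw [← lintegral_inv_norm_sq_projection (n := M - n) (by omega) _
          (finrank_orthogonal_span hw2)]
        refine lintegral_congr_ae ?_
        filter_upwards [hw1] with g hg
        have := sum_enorm_sq_rightInv _ j hg
        have e1 : ∀ k, ((MeasurableEquiv.piFinSuccAbove (fun _ : Fin (n + 1) => Fin M → ℂ) j).symm ∘
            Prod.swap) (w, g) (j.succAbove k) = w k := fun k =>
          Fin.insertNth_apply_succAbove (α := fun _ => Fin M → ℂ) j g w k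
        have e2 : ((MeasurableEquiv.piFinSuccAbove (fun _ : Fin (n + 1) => Fin M → ℂ) j).symm ∘
            Prod.swap) (w, g) j = g := Fin.insertNth_apply_same (α := fun _ => Fin M → ℂ) j g w
        rw [funext fun k => congrArg (WithLp.toLp 2) (e1 k), e2] at this
        exact this
    _ = _ := by simp

/-! ### Symmetries of the fading law -/

/-- Both laws agree on boxes of boxes, where they are the same double product taken in two orders.
This carries the M × K source arrays to K × M arrays. -/
lemma measurePreserving_swap_gaussianArray (m n : ℕ) :
    MeasurePreserving (fun x : Fin m → Fin n → ℂ => fun i j => x j i)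
      (gaussianArray m n) (gaussianArray n m) := by
  have hm : Measurable fun x : Fin m → Fin n → ℂ => fun i j => x j i := by fun_prop
  refine ⟨hm, ?_⟩
  symm
  refine Measure.pi_eq_generateFrom
    (C := fun _ => Set.pi Set.univ '' Set.pi Set.univ fun _ : Fin m => {s : Set ℂ | MeasurableSet s})
    (fun i => generateFrom_pi) (fun i => isPiSystem_pi)
    (fun i => ⟨fun _ => Set.univ, fun _ => ⟨fun _ => Set.univ, fun _ _ =>
        (MeasurableSet.univ : MeasurableSet (Set.univ : Set ℂ)), Set.pi_univ _⟩,
      fun _ => measure_lt_top _ _, Set.iUnion_const _⟩) ?_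
  intro s hs
  choose t ht hts using hs
  have hms : MeasurableSet (Set.univ.pi s) :=
    MeasurableSet.univ_pi fun i => by
      rw [← hts i]; exact MeasurableSet.univ_pi fun j => ht i j (Set.mem_univ j)
  rw [Measure.map_apply hm hms]
  have : (fun x : Fin m → Fin n → ℂ => fun i j => x j i) ⁻¹' (Set.univ.pi s)
      = Set.univ.pi fun j => Set.univ.pi fun i => t i j := by
    ext x
    simp only [Set.mem_preimage, Set.mem_pi, Set.mem_univ, true_imp_iff, ← hts]
    exact forall_comm
  rw [this, gaussianArray, Measure.pi_pi]
  simp_rw [Measure.pi_pi]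
  rw [Finset.prod_comm]
  refine Finset.prod_congr rfl fun i _ => ?_
  rw [← hts i, Measure.pi_pi]

lemma measurePreserving_pi_prod {ι α : Type*} [Fintype ι] [MeasurableSpace α] (μ : Measure α)
    [SigmaFinite μ] (f : ι → α × α → α × α)
    (hf : ∀ i, MeasurePreserving (f i) (μ.prod μ) (μ.prod μ)) :
    MeasurePreserving (fun z : (ι → α) × (ι → α) =>
        (fun i => (f i (z.1 i, z.2 i)).1, fun i => (f i (z.1 i, z.2 i)).2))
      ((Measure.pi fun _ => μ).prod (Measure.pi fun _ => μ))
      ((Measure.pi fun _ => μ).prod (Measure.pi fun _ => μ)) := by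
  have h1 := measurePreserving_arrowProdEquivProdArrow α α ι (fun _ => μ) (fun _ => μ)
  have h2 := measurePreserving_pi (fun _ : ι => μ.prod μ) (fun _ : ι => μ.prod μ) hf
  exact (h1.comp h2).comp h1.symm

lemma measurePreserving_rotation_stdCN (θ : ℝ) :
    MeasurePreserving (fun z : ℂ × ℂ => ((Real.cos θ : ℂ) * z.1 + (Real.sin θ : ℂ) * z.2,
      -(Real.sin θ : ℂ) * z.1 + (Real.cos θ : ℂ) * z.2)) (stdCN.prod stdCN) (stdCN.prod stdCN) := by
  have h := IsGaussian.map_rotation_eq_self (μ := stdCN) integral_id_stdCN θ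
  refine ⟨by fun_prop, ?_⟩
  convert h using 2
  ext z
  · simp [ContinuousLinearMap.rotation_apply]
  · simp [ContinuousLinearMap.rotation_apply]

/-- Row-wise rotation of a pair of arrays. -/
noncomputable def rotRows {K M : ℕ} (θ : Fin K → ℝ)
    (s : (Fin K → Fin M → ℂ) × (Fin K → Fin M → ℂ)) :
    (Fin K → Fin M → ℂ) × (Fin K → Fin M → ℂ) :=
  (fun k m => (Real.cos (θ k) : ℂ) * s.1 k m + (Real.sin (θ k) : ℂ) * s.2 k m,
    fun k m => -(Real.sin (θ k) : ℂ) * s.1 k m + (Real.cos (θ k) : ℂ) * s.2 k m)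

lemma measurePreserving_rotRows {K M : ℕ} (θ : Fin K → ℝ) :
    MeasurePreserving (rotRows (M := M) θ) (fading K M) (fading K M) :=
  measurePreserving_pi_prod (gaussianVec M) _ fun k =>
    measurePreserving_pi_prod stdCN _ fun _ => measurePreserving_rotation_stdCN (θ k)

/-! ### Moments of Gaussian arrays -/

lemma measurePreserving_eval_gaussianVec {m : ℕ} (i : Fin m) :
    MeasurePreserving (Function.eval i) (gaussianVec m) stdCN :=
  measurePreserving_eval (fun _ : Fin m => stdCN) i

lemma measurePreserving_eval_gaussianArray {m n : ℕ} (i : Fin m) :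
    MeasurePreserving (Function.eval i) (gaussianArray m n) (gaussianVec n) :=
  measurePreserving_eval (fun _ : Fin m => gaussianVec n) i

lemma memLp_entry {K M : ℕ} (k : Fin K) (m : Fin M) :
    MemLp (fun v : Fin K → Fin M → ℂ => v k m) 2 (gaussianArray K M) :=
  memLp_stdCN.comp_measurePreserving ((measurePreserving_eval_gaussianVec m).comp
    (measurePreserving_eval_gaussianArray k))

lemma integral_entry {K M : ℕ} (k : Fin K) (m : Fin M) :
    ∫ v, v k m ∂gaussianArray K M = 0 := by
  have h := (measurePreserving_eval_gaussianVec m).comp (measurePreserving_eval_gaussianArray k)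
  have h2 := integral_map (μ := gaussianArray K M) h.measurable.aemeasurable
    (f := fun z : ℂ => z) (by fun_prop)
  rw [h.map_eq, integral_id_stdCN] at h2
  exact h2.symm

lemma integral_entry_mul_star {K M : ℕ} (k : Fin K) (m m' : Fin M) :
    ∫ v, v k m * star (v k m') ∂gaussianArray K M = if m = m' then 1 else 0 := by
  have h := measurePreserving_eval_gaussianArray (n := M) k
  have h2 := integral_map (μ := gaussianArray K M) h.measurable.aemeasurable
    (f := fun g : Fin M → ℂ => g m * star (g m')) (by fun_prop)
  rw [h.map_eq] at h2
  have h3 : ∫ v, v k m * star (v k m') ∂gaussianArray K M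
      = ∫ g, g m * star (g m') ∂gaussianVec M := h2.symm
  rw [h3]
  have he : ∀ i : Fin M, ∫ g, g i ∂gaussianVec M = 0 := fun i => by
    have h := measurePreserving_eval_gaussianVec i
    have h2 := integral_map (μ := gaussianVec M) h.measurable.aemeasurable
      (f := fun z : ℂ => z) (by fun_prop)
    rw [h.map_eq, integral_id_stdCN] at h2
    exact h2.symm
  split_ifs with hmm
  · subst hmm
    have h := measurePreserving_eval_gaussianVec m
    have h2 := integral_map (μ := gaussianVec M) h.measurable.aemeasurable
      (f := fun z : ℂ => z * star z) (by fun_prop)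
    rw [h.map_eq] at h2
    have h4 : ∀ z : ℂ, z * star z = ((‖z‖ ^ 2 : ℝ) : ℂ) := fun z => by
      rw [Complex.star_def, Complex.mul_conj, Complex.normSq_eq_norm_sq]
    simp only [Function.eval] at h2
    rw [← h2]
    simp_rw [h4]
    rw [integral_complex_ofReal, integral_norm_sq_stdCN, Complex.ofReal_one]
  · have hi : iIndepFun (fun (i : Fin M) (g : Fin M → ℂ) => g i) (gaussianVec M) :=
      iIndepFun_pi (X := fun (_ : Fin M) (z : ℂ) => z) fun _ => aemeasurable_id
    have hi2 : IndepFun (fun g : Fin M → ℂ => g m) (fun g : Fin M → ℂ => star (g m'))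
        (gaussianVec M) :=
      (hi.indepFun hmm).comp (φ := id) (ψ := star) measurable_id (by fun_prop)
    rw [hi2.integral_fun_mul_eq_mul_integral (Continuous.aestronglyMeasurable (by fun_prop))
      (Continuous.aestronglyMeasurable (by fun_prop)), he, zero_mul]

lemma integrable_mul_star {Ω : Type*} [MeasurableSpace Ω] {μ : Measure Ω} {f g : Ω → ℂ}
    (hf : MemLp f 2 μ) (hg : MemLp g 2 μ) : Integrable (fun x => f x * star (g x)) μ :=
  hf.integrable_mul hg.star

section Quadratic

variable {K M : ℕ} {F : (Fin K → Fin M → ℂ) → Fin M → ℂ}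

lemma integral_sum_mul_entry (hF : ∀ m, MemLp (fun u => F u m) 2 (gaussianArray K M)) (k : Fin K) :
    Integrable (fun s : (Fin K → Fin M → ℂ) × (Fin K → Fin M → ℂ) => ∑ m, F s.1 m * s.2 k m)
      (fading K M) ∧ ∫ s, ∑ m, F s.1 m * s.2 k m ∂fading K M = 0 := by
  have hi : ∀ m, Integrable (fun s : (Fin K → Fin M → ℂ) × (Fin K → Fin M → ℂ) =>
      F s.1 m * s.2 k m) (fading K M) := fun m =>
    ((hF m).integrable one_le_two).mul_prod ((memLp_entry k m).integrable one_le_two)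
  refine ⟨integrable_finsetSum _ fun m _ => hi m, ?_⟩
  rw [integral_finsetSum _ fun m _ => hi m]
  refine Finset.sum_eq_zero fun m _ => ?_
  have := integral_prod_mul (μ := gaussianArray K M) (ν := gaussianArray K M)
    (fun u => F u m) (fun v => v k m)
  rw [integral_entry, mul_zero] at this
  exact this

/-- After expanding the square, independence and E[v_m conj v_m'] = δ leave only the diagonal terms.
-/
lemma integral_norm_sq_sum_mul_entry (hF : ∀ m, MemLp (fun u => F u m) 2 (gaussianArray K M))
    (k : Fin K) :
    ∫ s, ‖∑ m, F s.1 m * s.2 k m‖ ^ 2 ∂fading K M = ∫ u, ∑ m, ‖F u m‖ ^ 2 ∂gaussianArray K M := by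
  have hz : ∀ z : ℂ, ((‖z‖ ^ 2 : ℝ) : ℂ) = z * star z := fun z => by
    rw [Complex.star_def, Complex.mul_conj, Complex.normSq_eq_norm_sq]
  apply Complex.ofReal_injective
  rw [← integral_complex_ofReal, ← integral_complex_ofReal]
  have h1 : ∀ s : (Fin K → Fin M → ℂ) × (Fin K → Fin M → ℂ),
      ((‖∑ m, F s.1 m * s.2 k m‖ ^ 2 : ℝ) : ℂ)
        = ∑ m, ∑ m', (F s.1 m * star (F s.1 m')) * (s.2 k m * star (s.2 k m')) := fun s => by
    rw [hz, star_sum, Finset.sum_mul_sum]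
    refine Finset.sum_congr rfl fun m _ => Finset.sum_congr rfl fun m' _ => ?_
    rw [star_mul]; ring
  have hi : ∀ m m', Integrable (fun s : (Fin K → Fin M → ℂ) × (Fin K → Fin M → ℂ) =>
      (F s.1 m * star (F s.1 m')) * (s.2 k m * star (s.2 k m'))) (fading K M) := fun m m' =>
    (integrable_mul_star (hF m) (hF m')).mul_prod
      (integrable_mul_star (memLp_entry k m) (memLp_entry k m'))
  have h2 : ∀ m m', ∫ s, (F s.1 m * star (F s.1 m')) * (s.2 k m * star (s.2 k m')) ∂fading K M
      = if m = m' then ∫ u, F u m * star (F u m') ∂gaussianArray K M else 0 := fun m m' => by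
    have := integral_prod_mul (μ := gaussianArray K M) (ν := gaussianArray K M)
      (fun u => F u m * star (F u m')) (fun v => v k m * star (v k m'))
    rw [integral_entry_mul_star, mul_ite, mul_one, mul_zero] at this
    exact this
  simp_rw [h1]
  rw [integral_finsetSum _ fun m _ => integrable_finsetSum _ fun m' _ => hi m m']
  simp_rw [fun m => integral_finsetSum Finset.univ fun m' _ => hi m m', h2, Finset.sum_ite_eq,
    Finset.mem_univ, if_true, Complex.ofReal_sum, hz]
  rw [integral_finsetSum _ fun m _ => integrable_mul_star (hF m) (hF m)]

end Quadratic

lemma memLp_rightInv {K M : ℕ} (h : K < M) (m : Fin M) (j : Fin K) :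
    MemLp (fun u : Fin K → Fin M → ℂ => rightInv (Matrix.of u) m j) 2 (gaussianArray K M) := by
  refine ⟨(measurable_rightInv m j).aestronglyMeasurable, ?_⟩
  rw [eLpNorm_lt_top_iff_lintegral_rpow_enorm_lt_top two_ne_zero ENNReal.ofNat_ne_top]
  have h1 := lintegral_sum_enorm_sq_rightInv h j
  have h2 : (ENNReal.ofReal ((M : ℝ) - K))⁻¹ < ⊤ := by
    rw [ENNReal.inv_lt_top, ENNReal.ofReal_pos, sub_pos]; exact_mod_cast h
  rw [← h1] at h2
  refine lt_of_le_of_lt (lintegral_mono fun u => ?_) h2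
  simp only [ENNReal.toReal_ofNat, ENNReal.rpow_ofNat]
  exact Finset.single_le_sum (f := fun i => ‖rightInv (Matrix.of u) i j‖ₑ ^ 2)
    (fun _ _ => zero_le) (Finset.mem_univ m)

lemma integral_sum_norm_sq_rightInv {K M : ℕ} (h : K < M) (j : Fin K) :
    ∫ u, ∑ m, ‖rightInv (Matrix.of u) m j‖ ^ 2 ∂gaussianArray K M = ((M : ℝ) - K)⁻¹ := by
  rw [integral_eq_lintegral_of_nonneg_ae (ae_of_all _ fun u => Finset.sum_nonneg fun _ _ =>
    sq_nonneg _) (Finset.measurable_sum _ fun m _ =>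
      (measurable_rightInv m j).norm.pow_const 2).aestronglyMeasurable]
  have : ∀ u : Fin K → Fin M → ℂ, ENNReal.ofReal (∑ m, ‖rightInv (Matrix.of u) m j‖ ^ 2)
      = ∑ m, ‖rightInv (Matrix.of u) m j‖ₑ ^ 2 := fun u => by
    rw [ENNReal.ofReal_sum_of_nonneg fun i _ => sq_nonneg _]
    refine Finset.sum_congr rfl fun i _ => ?_
    rw [ENNReal.ofReal_pow (norm_nonneg _), ofReal_norm]
  simp_rw [this]
  rw [lintegral_sum_enorm_sq_rightInv h, ENNReal.toReal_inv, ENNReal.toReal_ofReal]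
  rw [sub_nonneg]; exact_mod_cast h.le

/-! ### Closed forms of the SINR -/

lemma pilotSNR_pos (p : Params) {K : ℕ} (hK : 0 < K) : 0 < pilotSNR p K := by
  have := p.ρ_pos
  have : (0 : ℝ) < K := by exact_mod_cast hK
  unfold pilotSNR; positivity

lemma estVar_pos (p : Params) {K : ℕ} (hK : 0 < K) {β : ℝ} (hβ : 0 < β) : 0 < estVar p K β := by
  have := pilotSNR_pos p hK
  unfold estVar; positivity

lemma errVar_eq (p : Params) {K : ℕ} (hK : 0 < K) {β : ℝ} (hβ : 0 < β) :
    errVar p K β = β / (1 + pilotSNR p K * β) := by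
  have := pilotSNR_pos p hK
  have : 1 + pilotSNR p K * β ≠ 0 := by positivity
  unfold errVar estVar
  field_simp
  ring

lemma errVar_pos (p : Params) {K : ℕ} (hK : 0 < K) {β : ℝ} (hβ : 0 < β) : 0 < errVar p K β := by
  have := pilotSNR_pos p hK
  rw [errVar_eq p hK hβ]; positivity

/-- θ is the argument of √(τβ) + i with τ the pilot SNR, so tan θ is the ratio of noise to signal
amplitude. The first two identities are the coefficients of fading and noise in g = √β' u - √β̃ v;
the last two are those of noise and fading in ĝ = √β' u, where (u, v) is the rotated pair. -/
lemma exists_angle (p : Params) {K : ℕ} (hK : 0 < K) {β : ℝ} (hβ : 0 < β) :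
    ∃ θ : ℝ, √(estVar p K β) * Real.cos θ + √(errVar p K β) * Real.sin θ = √β ∧
      √(estVar p K β) * Real.sin θ - √(errVar p K β) * Real.cos θ = 0 ∧
      √(pilotSNR p K) * β / (1 + pilotSNR p K * β) = √(estVar p K β) * Real.sin θ ∧
      √(pilotSNR p K) * β / (1 + pilotSNR p K * β) * √(pilotSNR p K) * √β
        = √(estVar p K β) * Real.cos θ := by
  have ht := pilotSNR_pos p hK
  set t := pilotSNR p K with htdef
  have hr : 0 < √t * √β := by positivity
  have hq : 0 < √(1 + t * β) := by positivity
  have hq2 : √(1 + t * β) ^ 2 = 1 + t * β := Real.sq_sqrt (by positivity)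
  have hz : (⟨√t * √β, 1⟩ : ℂ) ≠ 0 := fun h => by
    have := congrArg Complex.im h; simp at this
  have hn : ‖(⟨√t * √β, 1⟩ : ℂ)‖ = √(1 + t * β) := by
    rw [Complex.norm_def, Complex.normSq_apply]
    congr 1
    simp only
    calc √t * √β * (√t * √β) + 1 * 1 = √t ^ 2 * √β ^ 2 + 1 := by ring
      _ = 1 + t * β := by rw [Real.sq_sqrt ht.le, Real.sq_sqrt hβ.le]; ring
  refine ⟨Complex.arg ⟨√t * √β, 1⟩, ?_⟩
  rw [Complex.cos_arg hz, Complex.sin_arg, hn]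
  have h1 : √(estVar p K β) = √t * β / √(1 + t * β) := by
    rw [estVar, ← htdef, Real.sqrt_div (by positivity), Real.sqrt_mul ht.le, Real.sqrt_sq hβ.le]
  have h2 : √(errVar p K β) = √β / √(1 + t * β) := by
    rw [errVar_eq p hK hβ, ← htdef, Real.sqrt_div hβ.le]
  have hts : √t ^ 2 = t := Real.sq_sqrt ht.le
  have hbs : √β ^ 2 = β := Real.sq_sqrt hβ.le
  rw [h1, h2]
  generalize √(1 + t * β) = q at *
  rw [← hq2]
  set r := √t
  set b := √β
  have hq3 : q ^ 2 = 1 + r ^ 2 * b ^ 2 := by rw [hts, hbs, hq2]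
  refine ⟨?_, ?_, ?_, ?_⟩
  · field_simp
    rw [← hbs, hq3]; ring
  · field_simp
    rw [← hbs]; ring
  · field_simp
  · field_simp

section

variable (p : Params) {K M : ℕ} (β : Fin K → ℝ)

lemma exists_angles (hβ : ∀ k, 0 < β k) :
    ∃ θ : Fin K → ℝ, ∀ (s : (Fin K → Fin M → ℂ) × (Fin K → Fin M → ℂ)) k m,
      estD p β s k m = ((√(estVar p K (β k)) : ℝ) : ℂ) * (rotRows θ s).1 k m ∧
      chanD β s.1 k m = ((√(estVar p K (β k)) : ℝ) : ℂ) * (rotRows θ s).1 k m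
        - ((√(errVar p K (β k)) : ℝ) : ℂ) * (rotRows θ s).2 k m := by
  choose θ h1 h2 h3 h4 using fun k : Fin K => exists_angle p k.pos (hβ k)
  refine ⟨θ, fun s k m => ⟨?_, ?_⟩⟩
  · simp only [estD, mmse, chanD, rotRows, Matrix.of_apply]
    have e3 := congrArg (fun x : ℝ => (x : ℂ)) (h3 k)
    have e4 := congrArg (fun x : ℝ => (x : ℂ)) (h4 k)
    push_cast at e3 e4 ⊢
    linear_combination (s.1 k m) * e4 + (s.2 k m) * e3
  · simp only [chanD, rotRows, Matrix.of_apply]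
    have e1 := congrArg (fun x : ℝ => (x : ℂ)) (h1 k)
    have e2 := congrArg (fun x : ℝ => (x : ℂ)) (h2 k)
    push_cast at e1 e2 ⊢
    linear_combination -(s.1 k m) * e1 - (s.2 k m) * e2

/-- Only the diagonal factor has to be invertible, as the matrix inverse reverses products even for
singular factors. The formula for the zero-forcing matrix thus holds at every sample point. -/
lemma rightInv_diagonal_mul {d : Fin K → ℂ} (hd : ∀ k, d k ≠ 0) (A : Matrix (Fin K) (Fin M) ℂ)
    (m : Fin M) (j : Fin K) : rightInv (Matrix.diagonal d * A) m j = rightInv A m j * (d j)⁻¹ := by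
  have hD : IsUnit (Matrix.diagonal d).det := by
    rw [Matrix.det_diagonal, isUnit_iff_ne_zero]; exact Finset.prod_ne_zero_iff.2 fun k _ => hd k
  have hD' : IsUnit ((Matrix.diagonal d)ᴴ).det := by
    rw [Matrix.det_conjTranspose]; exact hD.star
  have hinv : (Matrix.diagonal d)⁻¹ = Matrix.diagonal fun k => (d k)⁻¹ := by
    refine Matrix.inv_eq_left_inv ?_
    rw [Matrix.diagonal_mul_diagonal, ← Matrix.diagonal_one]
    congr 1; ext k; exact inv_mul_cancel₀ (hd k)
  have : rightInv (Matrix.diagonal d * A) = rightInv A * (Matrix.diagonal d)⁻¹ := by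
    rw [rightInv, rightInv, Matrix.conjTranspose_mul,
      show Matrix.diagonal d * A * (Aᴴ * (Matrix.diagonal d)ᴴ)
        = Matrix.diagonal d * ((A * Aᴴ) * (Matrix.diagonal d)ᴴ) by simp only [Matrix.mul_assoc],
      Matrix.mul_inv_rev, Matrix.mul_inv_rev]
    simp only [Matrix.mul_assoc]
    rw [← Matrix.mul_assoc _ ((Matrix.diagonal d)ᴴ)⁻¹, Matrix.mul_nonsing_inv _ hD', Matrix.one_mul]
  rw [this, hinv, Matrix.mul_diagonal]

/-- The effective destination channel in terms of independent Gaussian arrays. -/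
noncomputable def effGauss (s : (Fin K → Fin M → ℂ) × (Fin K → Fin M → ℂ)) (k j : Fin K) : ℂ :=
  (1 : Matrix (Fin K) (Fin K) ℂ) k j
    - ((√(errVar p K (β k)) : ℝ) : ℂ) * (((√(estVar p K (β j)) : ℝ) : ℂ))⁻¹
      * ∑ m, rightInv (Matrix.of s.1) m j * s.2 k m

lemma measurable_effGauss (k j : Fin K) :
    Measurable fun s : (Fin K → Fin M → ℂ) × (Fin K → Fin M → ℂ) => effGauss p β s k j := by
  unfold effGauss
  refine measurable_const.sub (measurable_const.mul (Finset.measurable_sum _ fun m _ => ?_))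
  exact ((measurable_rightInv m j).comp measurable_fst).mul (by fun_prop)

variable {β}

/-- With Ĝ = D'^{1/2} U and G = D'^{1/2} U - D̃^{1/2} V, the precoder is U⁺ D'^{-1/2}, and U U⁺ = 1
turns the first part of G into the identity. Only this last cancellation needs full rank, hence the
"almost every" in the last clause alone. -/
lemma exists_rotation (hβ : ∀ k, 0 < β k) (h : K < M) :
    ∃ R : (Fin K → Fin M → ℂ) × (Fin K → Fin M → ℂ) → (Fin K → Fin M → ℂ) × (Fin K → Fin M → ℂ),
      MeasurePreserving R (fading K M) (fading K M) ∧
      (∀ s m j, zfD p β s m j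
        = rightInv (Matrix.of (R s).1) m j * (((√(estVar p K (β j)) : ℝ) : ℂ))⁻¹) ∧
      ∀ᵐ s ∂fading K M, ∀ k j, effD p β s k j = effGauss p β (R s) k j := by
  obtain ⟨θ, hθ⟩ := exists_angles p (M := M) β hβ
  have hd : ∀ k, ((√(estVar p K (β k)) : ℝ) : ℂ) ≠ 0 := fun k =>
    Complex.ofReal_ne_zero.2 (Real.sqrt_pos.2 (estVar_pos p k.pos (hβ k))).ne'
  have hR := measurePreserving_rotRows (M := M) θ
  have hest : ∀ s : (Fin K → Fin M → ℂ) × (Fin K → Fin M → ℂ), estD p β s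
      = Matrix.diagonal (fun k => ((√(estVar p K (β k)) : ℝ) : ℂ))
        * Matrix.of (rotRows θ s).1 := fun s => by
    ext k m
    rw [Matrix.diagonal_mul, (hθ s k m).1, Matrix.of_apply]
  have hzf : ∀ (s : (Fin K → Fin M → ℂ) × (Fin K → Fin M → ℂ)) m j, zfD p β s m j
      = rightInv (Matrix.of (rotRows θ s).1) m j * (((√(estVar p K (β j)) : ℝ) : ℂ))⁻¹ :=
    fun s m j => by
      have : zfD p β s = rightInv (estD p β s) := rfl
      rw [this, hest, rightInv_diagonal_mul hd]
  refine ⟨rotRows θ, hR, hzf, ?_⟩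
  have hfst : MeasurePreserving Prod.fst (fading K M) (gaussianArray K M) := measurePreserving_fst
  filter_upwards [(hfst.comp hR).quasiMeasurePreserving.ae (ae_isUnit_gram h)] with s hs k j
  set u := (rotRows θ s).1
  set v := (rotRows θ s).2
  have h1 := congrFun (congrFun (mul_rightInv hs) k) j
  rw [Matrix.mul_apply] at h1
  have h1' : ∑ m, u k m * rightInv (Matrix.of u) m j = (1 : Matrix (Fin K) (Fin K) ℂ) k j := h1
  rw [effD, Matrix.mul_apply]
  simp_rw [hzf, (hθ s k _).2]
  have h2 : ((√(estVar p K (β k)) : ℝ) : ℂ) * (1 : Matrix (Fin K) (Fin K) ℂ) k j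
      * (((√(estVar p K (β j)) : ℝ) : ℂ))⁻¹ = (1 : Matrix (Fin K) (Fin K) ℂ) k j := by
    by_cases hkj : k = j
    · subst hkj
      rw [Matrix.one_apply_eq, mul_one, mul_inv_cancel₀ (hd k)]
    · rw [Matrix.one_apply_ne hkj, mul_zero, zero_mul]
  rw [effGauss, ← h2, ← h1', Finset.mul_sum, Finset.mul_sum, Finset.sum_mul,
    ← Finset.sum_sub_distrib]
  refine Finset.sum_congr rfl fun m _ => ?_
  ring

lemma integral_comp_effD (hβ : ∀ k, 0 < β k) (h : K < M) {E : Type*} [NormedAddCommGroup E]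
    [NormedSpace ℝ E] {Φ : ℂ → E} (hΦ : Continuous Φ) (k j : Fin K) :
    ∫ s, Φ (effD p β s k j) ∂fading K M = ∫ s, Φ (effGauss p β s k j) ∂fading K M := by
  obtain ⟨R, hR, -, hae⟩ := exists_rotation p hβ h
  rw [← hR.map_eq, integral_map hR.measurable.aemeasurable
    (hΦ.comp_aestronglyMeasurable (measurable_effGauss p β k j).aestronglyMeasurable), hR.map_eq]
  refine integral_congr_ae ?_
  filter_upwards [hae] with s hs
  rw [hs]

lemma integral_effD (hβ : ∀ k, 0 < β k) (h : K < M) (k j : Fin K) :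
    ∫ s, effD p β s k j ∂fading K M = (1 : Matrix (Fin K) (Fin K) ℂ) k j := by
  refine (integral_comp_effD p hβ h continuous_id k j).trans ?_
  obtain ⟨hi, h0⟩ := integral_sum_mul_entry (fun m => memLp_rightInv h m j) k
  simp only [id, effGauss]
  rw [integral_sub (integrable_const _) (hi.const_mul _), integral_const_mul, h0]
  simp

lemma integral_norm_sq_effD_sub (hβ : ∀ k, 0 < β k) (h : K < M) (k j : Fin K) :
    ∫ s, ‖effD p β s k j - (1 : Matrix (Fin K) (Fin K) ℂ) k j‖ ^ 2 ∂fading K M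
      = errVar p K (β k) * (estVar p K (β j))⁻¹ * ((M : ℝ) - K)⁻¹ := by
  rw [integral_comp_effD p hβ h
    (Φ := fun z => ‖z - (1 : Matrix (Fin K) (Fin K) ℂ) k j‖ ^ 2) (by fun_prop)]
  have h1 := integral_norm_sq_sum_mul_entry (fun m => memLp_rightInv h m j) k
  rw [integral_sum_norm_sq_rightInv h] at h1
  have h2 : ∀ s : (Fin K → Fin M → ℂ) × (Fin K → Fin M → ℂ),
      ‖effGauss p β s k j - (1 : Matrix (Fin K) (Fin K) ℂ) k j‖ ^ 2
        = errVar p K (β k) * (estVar p K (β j))⁻¹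
          * ‖∑ m, rightInv (Matrix.of s.1) m j * s.2 k m‖ ^ 2 := fun s => by
    rw [effGauss, sub_sub_cancel_left, norm_neg, norm_mul, norm_mul, norm_inv,
      Complex.norm_real, Complex.norm_real, Real.norm_of_nonneg (Real.sqrt_nonneg _),
      Real.norm_of_nonneg (Real.sqrt_nonneg _), mul_pow, mul_pow, inv_pow,
      Real.sq_sqrt (errVar_pos p k.pos (hβ k)).le, Real.sq_sqrt (estVar_pos p k.pos (hβ j)).le]
  simp_rw [h2]
  rw [integral_const_mul, h1]

lemma cvar_effD (hβ : ∀ k, 0 < β k) (h : K < M) (k : Fin K) :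
    cvar (fading K M) (fun s => effD p β s k k)
      = errVar p K (β k) * (estVar p K (β k))⁻¹ * ((M : ℝ) - K)⁻¹ := by
  rw [cvar, integral_effD p hβ h, integral_norm_sq_effD_sub p hβ h]

lemma integral_norm_sq_effD (hβ : ∀ k, 0 < β k) (h : K < M) {k j : Fin K} (hkj : k ≠ j) :
    ∫ s, ‖effD p β s k j‖ ^ 2 ∂fading K M
      = errVar p K (β k) * (estVar p K (β j))⁻¹ * ((M : ℝ) - K)⁻¹ := by
  have := integral_norm_sq_effD_sub p hβ h k j
  rw [Matrix.one_apply_ne hkj] at this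
  simpa using this

lemma integral_sum_norm_sq_zfD (hβ : ∀ k, 0 < β k) (h : K < M) (j : Fin K) :
    Integrable (fun s => ∑ m, ‖zfD p β s m j‖ ^ 2) (fading K M) ∧
    ∫ s, ∑ m, ‖zfD p β s m j‖ ^ 2 ∂fading K M = (estVar p K (β j))⁻¹ * ((M : ℝ) - K)⁻¹ := by
  obtain ⟨R, hR, hz, -⟩ := exists_rotation p hβ h
  have hfst : MeasurePreserving Prod.fst (fading K M) (gaussianArray K M) := measurePreserving_fst
  have hc := hfst.comp hR
  have h2 : ∀ s : (Fin K → Fin M → ℂ) × (Fin K → Fin M → ℂ), ∑ m, ‖zfD p β s m j‖ ^ 2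
      = (estVar p K (β j))⁻¹ * ∑ m, ‖rightInv (Matrix.of (R s).1) m j‖ ^ 2 := fun s => by
    rw [Finset.mul_sum]
    refine Finset.sum_congr rfl fun m _ => ?_
    rw [hz, norm_mul, norm_inv, Complex.norm_real, Real.norm_of_nonneg (Real.sqrt_nonneg _),
      mul_pow, inv_pow, Real.sq_sqrt (estVar_pos p j.pos (hβ j)).le, mul_comm]
  simp_rw [h2]
  have hi : Integrable (fun u : Fin K → Fin M → ℂ => ∑ m, ‖rightInv (Matrix.of u) m j‖ ^ 2)
      (gaussianArray K M) := integrable_finsetSum _ fun m _ => (memLp_rightInv h m j).integrable_norm_pow two_ne_zero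
  refine ⟨(hc.integrable_comp_of_integrable hi).const_mul _, ?_⟩
  rw [integral_const_mul, ← integral_sum_norm_sq_rightInv h j]
  congr 1
  have h3 := integral_map (μ := fading K M) hc.measurable.aemeasurable
    (f := fun u => ∑ m, ‖rightInv (Matrix.of u) m j‖ ^ 2) (by rw [hc.map_eq]; exact hi.1)
  rw [hc.map_eq] at h3
  exact h3.symm

lemma relayPower_eq (hβ : ∀ k, 0 < β k) (h : K < M) (w : Fin K → ℝ) :
    relayPower p M β w = ((M : ℝ) - K)⁻¹ * ∑ j, w j * (estVar p K (β j))⁻¹ := by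
  have h1 : ∀ s : (Fin K → Fin M → ℂ) × (Fin K → Fin M → ℂ), (Matrix.trace (zfD p β s *
      Matrix.diagonal (fun k => ((w k : ℝ) : ℂ)) * (zfD p β s)ᴴ)).re
        = ∑ j, w j * ∑ m, ‖zfD p β s m j‖ ^ 2 := fun s => by
    rw [Matrix.trace]
    simp only [Matrix.diag_apply, Matrix.mul_apply (M := _ * _), Matrix.mul_diagonal,
      Matrix.conjTranspose_apply, Complex.re_sum, Finset.mul_sum]
    rw [Finset.sum_comm]
    refine Finset.sum_congr rfl fun j _ => Finset.sum_congr rfl fun m _ => ?_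
    rw [mul_right_comm, Complex.star_def, Complex.mul_conj, Complex.normSq_eq_norm_sq,
      ← Complex.ofReal_mul, Complex.ofReal_re, mul_comm]
  rw [relayPower]
  simp_rw [h1]
  rw [integral_finsetSum _ fun j _ => (integral_sum_norm_sq_zfD p hβ h j).1.const_mul _,
    Finset.mul_sum]
  refine Finset.sum_congr rfl fun j _ => ?_
  rw [integral_const_mul, (integral_sum_norm_sq_zfD p hβ h j).2]
  ring

lemma sum_inv_estVar_pos (hK : 0 < K) (hβ : ∀ k, 0 < β k) : 0 < ∑ j, (estVar p K (β j))⁻¹ :=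
  Finset.sum_pos (fun j _ => inv_pos.2 (estVar_pos p hK (hβ j))) ⟨⟨0, hK⟩, Finset.mem_univ _⟩

/-- The normalization of the allocation is chosen for this. The power terms of the actual and the
deterministic efficiency then coincide exactly, not only in the limit. -/
lemma relayPower_equalPower (hK : 0 < K) (hβ : ∀ k, 0 < β k) (h : K < M) :
    relayPower p M β (equalPower p M β) = p.PR := by
  have hS := sum_inv_estVar_pos p hK hβ
  have ht : (0 : ℝ) < (M : ℝ) - K := by rw [sub_pos]; exact_mod_cast h
  rw [relayPower_eq p hβ h]
  simp only [equalPower]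
  rw [← Finset.mul_sum]
  generalize ∑ j, (estVar p K (β j))⁻¹ = S at *
  field_simp

lemma sinr2_equalPower (hβ : ∀ k, 0 < β k) (h : K < M) (k : Fin K) :
    sinr2 p M β (equalPower p M β) k = ((M : ℝ) - K) * p.PR /
      ((p.PR * errVar p K (β k) + p.σD2) * ∑ j, (estVar p K (β j))⁻¹) := by
  have hS := sum_inv_estVar_pos p k.pos hβ
  have ht : (0 : ℝ) < (M : ℝ) - K := by rw [sub_pos]; exact_mod_cast h
  have hE := errVar_pos p k.pos (hβ k)
  have hPR := p.PR_pos
  have hσ := p.σD2_pos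
  have h1 : ∑ j ∈ Finset.univ.erase k, equalPower p M β j * ∫ s, ‖effD p β s k j‖ ^ 2 ∂fading K M
      = ∑ j ∈ Finset.univ.erase k, equalPower p M β k *
        (errVar p K (β k) * (estVar p K (β j))⁻¹ * ((M : ℝ) - K)⁻¹) :=
    Finset.sum_congr rfl fun j hj => by
      rw [integral_norm_sq_effD p hβ h (Finset.ne_of_mem_erase hj).symm]; rfl
  -- The variance term has the form of the missing interference term j = k, so the two together make
  -- the full sum of 1/β'_j. This cancels against the power normalization and leaves P_R β̃_k.
  rw [sinr2, h1, cvar_effD p hβ h, integral_effD p hβ h, Matrix.one_apply_eq,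
    Finset.add_sum_erase _ (fun j => equalPower p M β k *
        (errVar p K (β k) * (estVar p K (β j))⁻¹ * ((M : ℝ) - K)⁻¹)) (Finset.mem_univ k)]
  rw [← Finset.mul_sum, ← Finset.sum_mul, ← Finset.mul_sum, equalPower]
  simp only [norm_one, one_pow, mul_one]
  generalize ∑ j, (estVar p K (β j))⁻¹ = S at *
  field_simp

end

section

variable (p : Params) {K M : ℕ} {β : Fin K → ℝ}

/-- Transposition of a pair of arrays. -/
def swapPair (s : (Fin M → Fin K → ℂ) × (Fin M → Fin K → ℂ)) :
    (Fin K → Fin M → ℂ) × (Fin K → Fin M → ℂ) :=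
  (fun i j => s.1 j i, fun i j => s.2 j i)

lemma measurePreserving_swapPair :
    MeasurePreserving (swapPair (K := K) (M := M)) (fading M K) (fading K M) :=
  (measurePreserving_swap_gaussianArray M K).prod (measurePreserving_swap_gaussianArray M K)

/-- Plain transposition, without conjugation, turns the source estimate into a destination estimate
and the receive filter into the precoder. The first hop needs no separate moment computation. -/
lemma zfS_eq (s : (Fin M → Fin K → ℂ) × (Fin M → Fin K → ℂ)) :
    zfS p β s = (zfD p β (swapPair s))ᵀ := by
  have h : estD p β (swapPair s) = (estS p β s)ᵀ := rfl
  rw [zfD, h, zfS, Matrix.transpose_mul, Matrix.transpose_nonsing_inv, Matrix.transpose_mul]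
  rfl

lemma effS_apply (s : (Fin M → Fin K → ℂ) × (Fin M → Fin K → ℂ)) (k j : Fin K) :
    effS p β s k j = effD p β (swapPair s) j k := by
  have : effS p β s = (effD p β (swapPair s))ᵀ := by
    rw [effS, effD, Matrix.transpose_mul, zfS_eq]
    rfl
  rw [this, Matrix.transpose_apply]

lemma integral_comp_swapPair {E : Type*} [NormedAddCommGroup E] [NormedSpace ℝ E]
    {f : (Fin K → Fin M → ℂ) × (Fin K → Fin M → ℂ) → E} :
    ∫ s, f (swapPair s) ∂fading M K = ∫ s, f s ∂fading K M := by
  refine measurePreserving_swapPair.integral_comp ?_ f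
  exact MeasurableEquiv.measurableEmbedding
    { toFun := swapPair
      invFun := swapPair
      left_inv := fun _ => rfl
      right_inv := fun _ => rfl
      measurable_toFun := measurePreserving_swapPair.measurable
      measurable_invFun := measurePreserving_swapPair.measurable }

lemma sinr1_eq (hβ : ∀ k, 0 < β k) (h : K < M) (k : Fin K) :
    sinr1 p M β k = ((M : ℝ) - K) * p.Pd * estVar p K (β k) /
      (p.Pd * ∑ j, errVar p K (β j) + p.σR2) := by
  have ht : (0 : ℝ) < (M : ℝ) - K := by rw [sub_pos]; exact_mod_cast h
  have hE := estVar_pos p k.pos (hβ k)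
  have hS : 0 < ∑ j, errVar p K (β j) :=
    Finset.sum_pos (fun j _ => errVar_pos p j.pos (hβ j)) ⟨k, Finset.mem_univ _⟩
  have hPd := p.Pd_pos
  have hσ := p.σR2_pos
  have h0 : ∫ s, effS p β s k k ∂fading M K = 1 := by
    simp_rw [effS_apply]
    rw [integral_comp_swapPair (f := fun s => effD p β s k k), integral_effD p hβ h,
      Matrix.one_apply_eq]
  have h1 : cvar (fading M K) (fun s => effS p β s k k)
      = errVar p K (β k) * ((estVar p K (β k))⁻¹ * ((M : ℝ) - K)⁻¹) := by
    have := cvar_effD p hβ h k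
    rw [cvar, integral_effD p hβ h, Matrix.one_apply_eq] at this
    rw [cvar, h0]
    simp_rw [effS_apply]
    rw [integral_comp_swapPair (f := fun s => ‖effD p β s k k - 1‖ ^ 2), this, mul_assoc]
  -- Transposition exchanges the indices: the summed quantity is now the error variance, while
  -- 1/β'_k is common to all terms.
  have h2 : ∑ j ∈ Finset.univ.erase k, ∫ s, ‖effS p β s k j‖ ^ 2 ∂fading M K
      = ∑ j ∈ Finset.univ.erase k, errVar p K (β j) * ((estVar p K (β k))⁻¹ * ((M : ℝ) - K)⁻¹) :=
    Finset.sum_congr rfl fun j hj => by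
      simp_rw [effS_apply]
      rw [integral_comp_swapPair (f := fun s => ‖effD p β s j k‖ ^ 2),
        integral_norm_sq_effD p hβ h (Finset.ne_of_mem_erase hj), mul_assoc]
  have h3 : ∫ s, ∑ m, ‖zfS p β s k m‖ ^ 2 ∂fading M K
      = (estVar p K (β k))⁻¹ * ((M : ℝ) - K)⁻¹ := by
    simp_rw [zfS_eq, Matrix.transpose_apply]
    rw [integral_comp_swapPair (f := fun s => ∑ m, ‖zfD p β s m k‖ ^ 2),
      (integral_sum_norm_sq_zfD p hβ h k).2]
  rw [sinr1, h0, h1, h2, h3, ← mul_add, Finset.add_sum_erase _ (fun j =>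
    errVar p K (β j) * ((estVar p K (β k))⁻¹ * ((M : ℝ) - K)⁻¹)) (Finset.mem_univ k),
    ← Finset.sum_mul]
  simp only [norm_one, one_pow, mul_one]
  field_simp

end

/-! ### The closed forms `A1` and `A2` -/

/-- Used as (b)_n/(b+1)_n = b/(b+n), which is the integral of b t^{b-1+n} over the unit interval. -/
lemma ascPochhammer_eval_add_one (b : ℝ) (n : ℕ) :
    (ascPochhammer ℝ n).eval b * (b + n) = b * (ascPochhammer ℝ n).eval (b + 1) := by
  induction n with
  | zero => simp
  | succ n ih =>
    rw [ascPochhammer_succ_eval, ascPochhammer_succ_eval, ih]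
    push_cast
    ring

/-- Euler's integral for `₂F₁(1, b; b + 1; z)`. -/
lemma hyp2F1_one_eq_integral {b z : ℝ} (hb : 0 < b) :
    hyp2F1 1 b (b + 1) z = ∫ t in (0 : ℝ)..1, b * t ^ (b - 1) / (1 - z * t) := by
  unfold hyp2F1
  split_ifs with h
  · have hcoef : ∀ n : ℕ, ((n.factorial : ℝ)⁻¹ * (ascPochhammer ℝ n).eval 1 *
        (ascPochhammer ℝ n).eval b * ((ascPochhammer ℝ n).eval (b + 1))⁻¹) • z ^ n
        = ∫ t in (0 : ℝ)..1, (b * z ^ n) * t ^ (b - 1 + n) := fun n => by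
      have h1 := ascPochhammer_eval_add_one b n
      have h2 : 0 < (ascPochhammer ℝ n).eval (b + 1) := ascPochhammer_pos n _ (by linarith)
      have h3 : (n.factorial : ℝ) ≠ 0 := by exact_mod_cast n.factorial_ne_zero
      have hn : (0 : ℝ) ≤ n := n.cast_nonneg
      rw [intervalIntegral.integral_const_mul, integral_rpow (Or.inl (by linarith)),
        Real.one_rpow, Real.zero_rpow (by linarith), ascPochhammer_eval_one, inv_mul_cancel₀ h3,
        smul_eq_mul]
      have h4 : b - 1 + n + 1 = b + n := by ring
      have h5 : b + n ≠ 0 := by positivity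
      rw [h4]
      field_simp
      linear_combination z ^ n * h1
    rw [ordinaryHypergeometric_eq_tsum]
    simp only [hcoef]
    have hint : IntervalIntegrable (fun t : ℝ => t ^ (b - 1)) volume 0 1 :=
      intervalIntegral.intervalIntegrable_rpow' (by linarith)
    have hsum : HasSum (fun n : ℕ => ∫ t in (0 : ℝ)..1, (b * z ^ n) * t ^ (b - 1 + n))
        (∫ t in (0 : ℝ)..1, b * t ^ (b - 1) / (1 - z * t)) := by
      -- Inside the unit disc, integrate the geometric series of 1/(1-zt) term by term. The factor
      -- t^(b-1) may be singular at 0 but is integrable.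
      refine intervalIntegral.hasSum_integral_of_dominated_convergence
        (fun n t => |z| ^ n * (b * t ^ (b - 1))) (fun n => ?_) (fun n => ae_of_all _ fun t ht => ?_)
        (ae_of_all _ fun t ht => ?_) ?_ (ae_of_all _ fun t ht => ?_)
      · exact Measurable.aestronglyMeasurable (by fun_prop)
      · rw [Set.uIoc_of_le zero_le_one] at ht
        rw [Real.rpow_add ht.1, Real.rpow_natCast, norm_mul, norm_mul, norm_pow, Real.norm_eq_abs z,
          Real.norm_of_nonneg hb.le, norm_mul, norm_pow, Real.norm_of_nonneg ht.1.le,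
          Real.norm_of_nonneg (Real.rpow_nonneg ht.1.le _)]
        have h1 : t ^ n ≤ 1 := pow_le_one₀ ht.1.le ht.2
        have h2 := Real.rpow_nonneg ht.1.le (b - 1)
        calc b * |z| ^ n * (t ^ (b - 1) * t ^ n) = (|z| ^ n * (b * t ^ (b - 1))) * t ^ n := by ring
          _ ≤ (|z| ^ n * (b * t ^ (b - 1))) * 1 := by gcongr
          _ = _ := mul_one _
      · exact (summable_geometric_of_lt_one (abs_nonneg z) h).mul_right _
      · simp_rw [tsum_mul_right]
        exact (hint.const_mul b).const_mul _
      · rw [Set.uIoc_of_le zero_le_one] at ht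
        have hzt : |z * t| < 1 := by
          rw [abs_mul, abs_of_pos ht.1]
          calc |z| * t ≤ |z| * 1 := by gcongr; exact ht.2
            _ < 1 := by rwa [mul_one]
        have := (hasSum_geometric_of_abs_lt_one hzt).mul_left (b * t ^ (b - 1))
        rw [← div_eq_mul_inv] at this
        refine this.congr_fun fun n => ?_
        rw [Real.rpow_add ht.1, Real.rpow_natCast, mul_pow]
        ring
    exact hsum.tsum_eq
  -- Outside the disc the definition already is Euler's integral; the exponent of 1-t is 0 and the
  -- Gamma quotient equals b.
  · have h1 : b + 1 - b = 1 := by ring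
    rw [h1, Real.Gamma_one, Real.Gamma_add_one hb.ne', mul_one,
      mul_div_assoc, div_self (Real.Gamma_pos_of_pos hb).ne', mul_one,
      ← intervalIntegral.integral_const_mul]
    refine intervalIntegral.integral_congr fun t _ => ?_
    simp only [sub_self, Real.rpow_zero, mul_one, Real.rpow_neg_one]
    rw [mul_div_assoc, div_eq_mul_inv]

/-- Substitution t = r^α. The indicator of (-∞, 1] moves it to the half-line, where the change of
variables is available, and r ≤ 1 iff r^α ≤ 1. -/
lemma integral_div_one_add_rpow {α x : ℝ} (hα : 0 < α) :
    ∫ r in (0 : ℝ)..1, 2 * r / (1 + x * r ^ α)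
      = ∫ t in (0 : ℝ)..1, 2 / α * t ^ (2 / α - 1) / (1 - -x * t) := by
  rw [intervalIntegral.integral_of_le zero_le_one, intervalIntegral.integral_of_le zero_le_one]
  have h := integral_comp_rpow_Ioi_of_pos (g := (Set.Iic (1 : ℝ)).indicator
    fun t => 2 / α * t ^ (2 / α - 1) / (1 - -x * t)) hα
  rw [setIntegral_indicator measurableSet_Iic, Set.Ioi_inter_Iic] at h
  rw [← h, ← Set.Ioi_inter_Iic, ← setIntegral_indicator measurableSet_Iic]
  refine setIntegral_congr_fun measurableSet_Ioi fun r hr => ?_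
  have hr0 : (0 : ℝ) < r := hr
  by_cases h1 : r ≤ 1
  · have h2 : r ^ α ≤ 1 := Real.rpow_le_one hr0.le h1 hα.le
    simp only [Set.indicator, Set.mem_Iic, h1, h2, if_true, smul_eq_mul]
    have h3 : r ^ (α - 1) * (r ^ α) ^ (2 / α - 1) = r := by
      rw [← Real.rpow_mul hr0.le, ← Real.rpow_add hr0]
      have : α - 1 + α * (2 / α - 1) = 1 := by field_simp; ring
      rw [this, Real.rpow_one]
    have h4 : 1 - -x * r ^ α = 1 + x * r ^ α := by ring
    rw [h4, ← mul_div_assoc]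
    congr 1
    calc 2 * r = 2 * (r ^ (α - 1) * (r ^ α) ^ (2 / α - 1)) := by rw [h3]
      _ = α * r ^ (α - 1) * (2 / α * (r ^ α) ^ (2 / α - 1)) := by field_simp
  · have h2 : ¬ r ^ α ≤ 1 := not_le.2 (Real.one_lt_rpow (not_le.1 h1) hα)
    simp [Set.indicator, h1, h2]

/-- Scaling l = R r makes both hypergeometric terms of `A1` integrals of one integrand from 0, so
that their difference is an integral over the annulus radii. -/
lemma sq_mul_hyp2F1 {α x R : ℝ} (hα : 0 < α) (hR : 0 < R) :
    R ^ 2 * hyp2F1 1 (2 / α) ((α + 2) / α) (-(x * R ^ α))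
      = ∫ l in (0 : ℝ)..R, 2 * l / (1 + x * l ^ α) := by
  have h1 : (α + 2) / α = 2 / α + 1 := by field_simp; ring
  rw [h1, hyp2F1_one_eq_integral (by positivity), ← integral_div_one_add_rpow hα]
  have h3 := intervalIntegral.mul_integral_comp_mul_left (a := 0) (b := 1)
    (f := fun l => 2 * l / (1 + x * l ^ α)) R
  rw [mul_zero, mul_one] at h3
  rw [← h3, sq, mul_assoc, ← intervalIntegral.integral_const_mul]
  congr 1
  refine intervalIntegral.integral_congr fun r hr => ?_
  rw [Set.uIcc_of_le zero_le_one] at hr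
  rw [Real.mul_rpow hR.le hr.1]
  ring

section

variable (p : Params)

lemma Rmax_pos : 0 < p.Rmax := p.Rmin_pos.trans p.Rmin_lt

lemma Rmax_sq_sub_pos : 0 < p.Rmax ^ 2 - p.Rmin ^ 2 := by
  have := p.Rmin_pos; have := p.Rmin_lt; nlinarith

lemma pathLoss_pos {l : ℝ} (hl : 0 < l) : 0 < pathLoss p l :=
  mul_pos p.c_pos (Real.rpow_pos_of_pos hl _)

lemma A1_eq {K : ℕ} (hK : 0 < K) : A1 p K = K * (∫ l in p.Rmin..p.Rmax,
    errVar p K (pathLoss p l) * distDensity p l) := by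
  have hα := p.α_pos
  have hc := p.c_pos
  have hρ := p.ρ_pos
  have hR1 := p.Rmin_pos
  have hR2 := Rmax_pos p
  have hD := Rmax_sq_sub_pos p
  have hK' : (0 : ℝ) < K := by exact_mod_cast hK
  set x : ℝ := (2 * K * p.c * p.ρ)⁻¹ with hx
  have hx0 : 0 < x := by positivity
  -- The absolute value keeps the denominator positive on the whole line and changes nothing on (0,
  -- R].
  have hcont : Continuous fun l : ℝ => 2 * l / (1 + x * |l| ^ p.α) := by
    refine Continuous.div (by fun_prop) ?_ fun l => ?_
    · exact continuous_const.add (continuous_const.mul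
        (continuous_abs.rpow_const fun _ => Or.inr hα.le))
    · have := Real.rpow_nonneg (abs_nonneg l) p.α; positivity
  have hint : ∀ R, 0 < R → IntervalIntegrable (fun l : ℝ => 2 * l / (1 + x * l ^ p.α)) volume 0 R :=
    fun R hR => by
      refine (hcont.intervalIntegrable 0 R).congr fun l hl => ?_
      rw [Set.uIoc_of_le hR.le] at hl
      simp only [abs_of_pos hl.1]
  have hz : ∀ R : ℝ, -(R ^ p.α / (2 * K * p.c * p.ρ)) = -(x * R ^ p.α) := fun R => by
    rw [hx, div_eq_inv_mul]
  unfold A1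
  rw [hz, hz, sq_mul_hyp2F1 hα hR2, sq_mul_hyp2F1 hα hR1,
    intervalIntegral.integral_interval_sub_left (hint _ hR2) (hint _ hR1), div_eq_mul_inv,
    mul_assoc, ← intervalIntegral.integral_const_mul]
  congr 1
  refine intervalIntegral.integral_congr fun l hl => ?_
  rw [Set.uIcc_of_le p.Rmin_lt.le] at hl
  have hl0 : 0 < l := hR1.trans_le hl.1
  have hlα : 0 < l ^ p.α := Real.rpow_pos_of_pos hl0 _
  rw [errVar_eq p hK (pathLoss_pos p hl0), pathLoss, distDensity, Real.rpow_neg hl0.le, hx, pilotSNR]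
  field_simp
  ring

lemma inv_estVar_pathLoss {K : ℕ} (hK : 0 < K) {l : ℝ} (hl : 0 < l) :
    (estVar p K (pathLoss p l))⁻¹
      = l ^ p.α / p.c + (l ^ p.α) ^ 2 / (2 * K * p.ρ * p.c ^ 2) := by
  have hlα : 0 < l ^ p.α := Real.rpow_pos_of_pos hl _
  have hc := p.c_pos
  have hρ := p.ρ_pos
  have hK' : (0 : ℝ) < K := by exact_mod_cast hK
  rw [estVar, pathLoss, Real.rpow_neg hl.le, pilotSNR]
  field_simp
  ring

lemma A2_eq {K : ℕ} (hK : 0 < K) : A2 p K = K * (∫ l in p.Rmin..p.Rmax,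
    (estVar p K (pathLoss p l))⁻¹ * distDensity p l) := by
  have hα := p.α_pos
  have hc := p.c_pos
  have hρ := p.ρ_pos
  have hR1 := p.Rmin_pos
  have hR2 := Rmax_pos p
  have hD := Rmax_sq_sub_pos p
  have hK' : (0 : ℝ) < K := by exact_mod_cast hK
  have h1 : ∫ l in p.Rmin..p.Rmax, (estVar p K (pathLoss p l))⁻¹ * distDensity p l
      = ∫ l in p.Rmin..p.Rmax, (2 / (p.c * (p.Rmax ^ 2 - p.Rmin ^ 2)) * l ^ (p.α + 1)
        + 2 / (2 * K * p.ρ * p.c ^ 2 * (p.Rmax ^ 2 - p.Rmin ^ 2)) * l ^ (2 * p.α + 1)) := by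
    refine intervalIntegral.integral_congr fun l hl => ?_
    rw [Set.uIcc_of_le p.Rmin_lt.le] at hl
    have hl0 : 0 < l := hR1.trans_le hl.1
    rw [inv_estVar_pathLoss p hK hl0, distDensity, Real.rpow_add hl0, Real.rpow_add hl0,
      Real.rpow_one, mul_comm 2 p.α, Real.rpow_mul hl0.le, Real.rpow_two]
    field_simp
  rw [h1, intervalIntegral.integral_add
    ((intervalIntegral.intervalIntegrable_rpow' (by linarith)).const_mul _)
    ((intervalIntegral.intervalIntegrable_rpow' (by linarith)).const_mul _),
    intervalIntegral.integral_const_mul, intervalIntegral.integral_const_mul,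
    integral_rpow (Or.inl (by linarith)), integral_rpow (Or.inl (by linarith)), A2]
  have e1 : p.α + 1 + 1 = p.α + 2 := by ring
  have e2 : 2 * p.α + 1 + 1 = 2 * (p.α + 1) := by ring
  rw [e1, e2]
  field_simp
  ring

end

/-! ### The distance to the relay -/

section

variable (p : Params)

lemma measurableSet_coverage : MeasurableSet (coverage p) := by
  have : coverage p = (fun z : ℂ => ‖z‖) ⁻¹' Set.Icc p.Rmin p.Rmax := rfl
  rw [this]
  exact measurable_norm measurableSet_Icc

/-- Polar coordinates. The area of the unit disc is kept as a symbol, since it cancels in the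
normalized uniform law. -/
lemma setIntegral_coverage (g : ℝ → ℝ) : ∫ z in coverage p, g ‖z‖ =
    2 * volume.real (Metric.ball (0 : ℂ) 1) * ∫ l in p.Rmin..p.Rmax, l * g l := by
  have h := integral_fun_norm_addHaar (E := ℂ) volume ((Set.Icc p.Rmin p.Rmax).indicator g)
  rw [Complex.finrank_real_complex] at h
  have h1 : ∫ z in coverage p, g ‖z‖ = ∫ z : ℂ, (Set.Icc p.Rmin p.Rmax).indicator g ‖z‖ := by
    rw [← integral_indicator (measurableSet_coverage p)]
    rfl
  rw [h1, h, intervalIntegral.integral_of_le p.Rmin_lt.le, ← integral_Icc_eq_integral_Ioc]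
  have h2 : ∀ y : ℝ, y ^ (2 - 1) • (Set.Icc p.Rmin p.Rmax).indicator g y
      = (Set.Icc p.Rmin p.Rmax).indicator (fun y => y * g y) y := fun y => by
    by_cases hy : y ∈ Set.Icc p.Rmin p.Rmax <;> simp [Set.indicator, hy]
  simp_rw [h2]
  rw [setIntegral_indicator measurableSet_Icc, Set.inter_eq_self_of_subset_right]
  · simp [mul_assoc]
  · exact fun y hy => p.Rmin_pos.trans_le hy.1

lemma volume_coverage : volume.real (coverage p)
    = volume.real (Metric.ball (0 : ℂ) 1) * (p.Rmax ^ 2 - p.Rmin ^ 2) := by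
  have h := setIntegral_coverage p (fun _ => 1)
  simp only [mul_one, integral_id] at h
  rw [setIntegral_const, smul_eq_mul, mul_one] at h
  rw [h]; ring

lemma volume_coverage_ne : volume (coverage p) ≠ 0 ∧ volume (coverage p) ≠ ⊤ := by
  have hb : 0 < volume.real (Metric.ball (0 : ℂ) 1) :=
    ENNReal.toReal_pos (Metric.measure_ball_pos _ _ one_pos).ne' measure_ball_lt_top.ne
  have h : 0 < volume.real (coverage p) := by
    rw [volume_coverage]; exact mul_pos hb (Rmax_sq_sub_pos p)
  exact (ENNReal.toReal_pos_iff.1 h).imp ne_of_gt ne_of_lt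

/-- Law of the distance between a device and the relay. -/
noncomputable def distLaw : Measure ℝ :=
  (ProbabilityTheory.cond volume (coverage p)).map fun z : ℂ => ‖z‖

instance : IsProbabilityMeasure (distLaw p) := by
  have := cond_isProbabilityMeasure_of_finite (volume_coverage_ne p).1 (volume_coverage_ne p).2
  exact Measure.isProbabilityMeasure_map measurable_norm.aemeasurable

lemma integral_distLaw {g : ℝ → ℝ} (hg : Measurable g) :
    ∫ l, g l ∂distLaw p = ∫ l in p.Rmin..p.Rmax, g l * distDensity p l := by
  have hb : 0 < volume.real (Metric.ball (0 : ℂ) 1) :=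
    ENNReal.toReal_pos (Metric.measure_ball_pos _ _ one_pos).ne' measure_ball_lt_top.ne
  have hD := Rmax_sq_sub_pos p
  rw [distLaw, integral_map measurable_norm.aemeasurable hg.aestronglyMeasurable,
    ProbabilityTheory.cond, integral_smul_measure, setIntegral_coverage, ENNReal.toReal_inv]
  have hv : (volume (coverage p)).toReal = _ := volume_coverage p
  rw [hv, smul_eq_mul, ← mul_assoc, ← intervalIntegral.integral_const_mul]
  congr 1
  ext l
  rw [distDensity]
  field_simp

lemma ae_distLaw : ∀ᵐ l ∂distLaw p, l ∈ Set.Icc p.Rmin p.Rmax := by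
  refine (ae_map_iff measurable_norm.aemeasurable
    (measurableSet_Icc : MeasurableSet (Set.Icc p.Rmin p.Rmax))).2 ?_
  exact ae_cond_mem (measurableSet_coverage p)

lemma map_norm_of_isUniform {Ω : Type*} [MeasurableSpace Ω] {P : Measure Ω} {Y : Ω → ℂ}
    (hY : Measurable Y) (hu : pdf.IsUniform Y (coverage p) P volume) :
    P.map (fun ω => ‖Y ω‖) = distLaw p := by
  have hu' : P.map Y = ProbabilityTheory.cond volume (coverage p) := hu
  rw [distLaw, ← hu', Measure.map_map measurable_norm hY]
  rfl

end

/-! ### Comparison of logarithms -/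

/-- The 2 is a crude bound for 1/log 2. -/
lemma two_logb_le {θ : ℝ} (hθ : 1 ≤ θ) : Real.logb 2 θ ≤ 2 * (θ - 1) := by
  have h1 := Real.log_two_gt_d9
  have h2 := Real.log_le_sub_one_of_pos (by linarith : 0 < θ)
  rw [Real.logb, div_le_iff₀ (by linarith)]
  nlinarith

lemma logb_one_add_le_add {θ x y : ℝ} (hθ : 1 ≤ θ) (hx : 0 ≤ x) (hy : 0 ≤ y) (h : x ≤ θ * y) :
    Real.logb 2 (1 + x) ≤ Real.logb 2 (1 + y) + 2 * (θ - 1) := by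
  have h1 : Real.logb 2 (1 + x) ≤ Real.logb 2 (θ * (1 + y)) :=
    Real.logb_le_logb_of_le one_lt_two (by linarith) (by nlinarith)
  rw [Real.logb_mul (by linarith) (by linarith)] at h1
  linarith [two_logb_le hθ]

lemma abs_logb_sub_le {θ x y : ℝ} (hθ : 1 ≤ θ) (hx : 0 ≤ x) (hy : 0 ≤ y) (h1 : x ≤ θ * y)
    (h2 : y ≤ θ * x) :
    |Real.logb 2 (1 + x) - Real.logb 2 (1 + y)| ≤ 2 * (θ - 1) := by
  rw [abs_sub_le_iff]
  constructor <;> linarith [logb_one_add_le_add hθ hx hy h1, logb_one_add_le_add hθ hy hx h2]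

/-- Bernoulli's inequality: 1 + θy ≤ (1+y)^θ. -/
lemma logb_one_add_le_mul {θ x y : ℝ} (hθ : 1 ≤ θ) (hx : 0 ≤ x) (hy : 0 ≤ y) (h : x ≤ θ * y) :
    Real.logb 2 (1 + x) ≤ θ * Real.logb 2 (1 + y) := by
  have h1 : 1 + x ≤ (1 + y) ^ θ :=
    le_trans (by linarith) (one_add_mul_self_le_rpow_one_add (by linarith) hθ)
  have h2 := Real.logb_le_logb_of_le one_lt_two (by linarith) h1
  rwa [Real.logb_rpow_eq_mul_logb_of_pos (by linarith)] at h2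

lemma logb_one_add_nonneg {x : ℝ} (hx : 0 ≤ x) : 0 ≤ Real.logb 2 (1 + x) :=
  Real.logb_nonneg one_lt_two (by linarith)

lemma logb_one_add_le_two_mul {x : ℝ} (hx : 0 ≤ x) : Real.logb 2 (1 + x) ≤ 2 * x := by
  have := two_logb_le (by linarith : 1 ≤ 1 + x)
  linarith

/-- Relative comparison of logarithms. -/
lemma abs_logb_sub_le_mul {θ x y : ℝ} (hθ : 1 ≤ θ) (hx : 0 ≤ x) (hy : 0 ≤ y) (h1 : x ≤ θ * y)
    (h2 : y ≤ θ * x) :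
    |Real.logb 2 (1 + x) - Real.logb 2 (1 + y)| ≤ (θ - 1) * Real.logb 2 (1 + y) := by
  have a1 := logb_one_add_le_mul hθ hx hy h1
  have a2 := logb_one_add_le_mul hθ hy hx h2
  have a3 := logb_one_add_nonneg hx
  have a4 := logb_one_add_nonneg hy
  rw [abs_sub_le_iff]
  constructor
  · linarith
  · by_contra hc
    rw [not_le] at hc
    nlinarith

/-! ### Large-scale quantities on the coverage area -/

section

variable (p : Params)

lemma pos_of_mem {l : ℝ} (hl : l ∈ Set.Icc p.Rmin p.Rmax) : 0 < l := p.Rmin_pos.trans_le hl.1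

lemma pathLoss_mem {l : ℝ} (hl : l ∈ Set.Icc p.Rmin p.Rmax) :
    pathLoss p p.Rmax ≤ pathLoss p l ∧ pathLoss p l ≤ pathLoss p p.Rmin := by
  have hα : -p.α ≤ 0 := by linarith [p.α_pos]
  constructor
  · exact mul_le_mul_of_nonneg_left (Real.rpow_le_rpow_of_nonpos (pos_of_mem p hl) hl.2 hα)
      p.c_pos.le
  · exact mul_le_mul_of_nonneg_left (Real.rpow_le_rpow_of_nonpos p.Rmin_pos hl.1 hα) p.c_pos.le

lemma pathLoss_Rmax_pos : 0 < pathLoss p p.Rmax := pathLoss_pos p (Rmax_pos p)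

lemma pathLoss_Rmin_pos : 0 < pathLoss p p.Rmin := pathLoss_pos p p.Rmin_pos

lemma measurable_pathLoss : Measurable (pathLoss p) := by unfold pathLoss; fun_prop

lemma measurable_estVar (K : ℕ) : Measurable fun l => estVar p K (pathLoss p l) := by
  have := measurable_pathLoss p
  unfold estVar; fun_prop

lemma measurable_errVar (K : ℕ) : Measurable fun l => errVar p K (pathLoss p l) := by
  have := measurable_pathLoss p
  have := measurable_estVar p K
  unfold errVar; fun_prop

/-- Bound on `β / β'`. -/
noncomputable def estRatio (K : ℕ) : ℝ := 1 + 1 / (pilotSNR p K * pathLoss p p.Rmax)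

lemma one_le_estRatio (K : ℕ) : 1 ≤ estRatio p K := by
  have := pathLoss_Rmax_pos p
  have := p.ρ_pos
  have : 0 ≤ pilotSNR p K := by unfold pilotSNR; positivity
  unfold estRatio
  linarith [show 0 ≤ 1 / (pilotSNR p K * pathLoss p p.Rmax) by positivity]

lemma tendsto_pilotSNR : Tendsto (pilotSNR p) atTop atTop := by
  have h : Tendsto (fun K : ℕ => (2 * p.ρ) * (K : ℝ)) atTop atTop :=
    tendsto_natCast_atTop_atTop.const_mul_atTop (by linarith [p.ρ_pos])
  refine h.congr fun K => ?_
  unfold pilotSNR; ring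

lemma tendsto_estRatio : Tendsto (estRatio p) atTop (𝓝 1) := by
  have h := ((tendsto_pilotSNR p).atTop_mul_const (pathLoss_Rmax_pos p)).inv_tendsto_atTop
  have h2 := h.const_add 1
  rw [add_zero] at h2
  refine h2.congr fun K => ?_
  simp [estRatio]

variable {p} in
lemma estVar_le {K : ℕ} (hK : 0 < K) {β : ℝ} (hβ : 0 < β) : estVar p K β ≤ β := by
  have := errVar_pos p hK hβ
  unfold errVar at this
  linarith

lemma pathLoss_le_estVar {K : ℕ} (hK : 0 < K) {l : ℝ} (hl : l ∈ Set.Icc p.Rmin p.Rmax) :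
    pathLoss p l ≤ estRatio p K * estVar p K (pathLoss p l) := by
  have hτ := pilotSNR_pos p hK
  have hb := pathLoss_Rmax_pos p
  have hβ := pathLoss_pos p (pos_of_mem p hl)
  have h1 := (pathLoss_mem p hl).1
  have h2 : 1 + 1 / (pilotSNR p K * pathLoss p l) ≤ estRatio p K := by
    unfold estRatio; gcongr
  have h3 := estVar_pos p hK hβ
  calc pathLoss p l = (1 + 1 / (pilotSNR p K * pathLoss p l)) * estVar p K (pathLoss p l) := by
        unfold estVar; field_simp; ring
    _ ≤ _ := by gcongr

/-- Kβ/(1+2Kρβ) lies below 1/(2ρ) for every β. As the pilot length grows with K, the total error of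
K devices stays bounded and nearly independent of the locations, so the first-hop interference sum
needs no law of large numbers. -/
lemma mul_errVar_le {K : ℕ} (hK : 0 < K) {β : ℝ} (hβ : 0 < β) :
    K * errVar p K β ≤ 1 / (2 * p.ρ) := by
  have hρ := p.ρ_pos
  have hK' : (0 : ℝ) < K := by exact_mod_cast hK
  rw [errVar_eq p hK hβ, pilotSNR, ← mul_div_assoc, div_le_div_iff₀ (by positivity) (by positivity)]
  nlinarith

lemma le_mul_errVar {K : ℕ} (hK : 0 < K) {l : ℝ} (hl : l ∈ Set.Icc p.Rmin p.Rmax) :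
    1 / (2 * p.ρ) ≤ estRatio p K * (K * errVar p K (pathLoss p l)) := by
  have hρ := p.ρ_pos
  have hK' : (0 : ℝ) < K := by exact_mod_cast hK
  have hb := pathLoss_Rmax_pos p
  have hβ := pathLoss_pos p (pos_of_mem p hl)
  have hτ := pilotSNR_pos p hK
  have h1 := (pathLoss_mem p hl).1
  have h2 : 1 + 1 / (pilotSNR p K * pathLoss p l) ≤ estRatio p K := by
    unfold estRatio; gcongr
  have h3 := errVar_pos p hK hβ
  calc 1 / (2 * p.ρ)
      = (1 + 1 / (pilotSNR p K * pathLoss p l)) * (K * errVar p K (pathLoss p l)) := by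
        rw [errVar_eq p hK hβ, pilotSNR]; field_simp; ring
    _ ≤ _ := by gcongr

/-! ### Source-to-relay SINR -/

/-- Source-to-relay SINR with total estimation error variance `S`. -/
noncomputable def snr1 (K M : ℕ) (S l : ℝ) : ℝ :=
  ((M : ℝ) - K) * p.Pd * estVar p K (pathLoss p l) / (p.Pd * S + p.σR2)

/-- Ratio of the limit of the source-to-relay SINR to `(M - K) β`. -/
noncomputable def gain1 : ℝ := p.Pd / (p.Pd * (1 / (2 * p.ρ)) + p.σR2)

lemma gain1_pos : 0 < gain1 p := by
  have := p.Pd_pos; have := p.ρ_pos; have := p.σR2_pos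
  unfold gain1; positivity

variable {p}

/-- `S` stands for both the random sum of error variances and its mean `A1`, which satisfy the same
bounds. The comparison model does not involve `S`. -/
lemma snr1_bounds {K M : ℕ} (hK : 0 < K) (hKM : K < M) {S : ℝ} (hS : 0 ≤ S)
    (hS1 : S ≤ 1 / (2 * p.ρ)) (hS2 : 1 / (2 * p.ρ) ≤ estRatio p K * S) {l : ℝ}
    (hl : l ∈ Set.Icc p.Rmin p.Rmax) :
    0 ≤ snr1 p K M S l ∧
    snr1 p K M S l ≤ estRatio p K * (((M : ℝ) - K) * (gain1 p * pathLoss p l)) ∧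
    ((M : ℝ) - K) * (gain1 p * pathLoss p l) ≤ estRatio p K * snr1 p K M S l := by
  have ht : (0 : ℝ) < (M : ℝ) - K := by rw [sub_pos]; exact_mod_cast hKM
  have hPd := p.Pd_pos
  have hρ := p.ρ_pos
  have hσ := p.σR2_pos
  have hβ := pathLoss_pos p (pos_of_mem p hl)
  have hE := estVar_pos p hK hβ
  have hθ := one_le_estRatio p K
  have h1 := estVar_le (p := p) hK hβ
  have h2 := pathLoss_le_estVar p hK hl
  have hr : 0 < 1 / (2 * p.ρ) := by positivity
  unfold snr1 gain1
  set r := 1 / (2 * p.ρ)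
  set θ := estRatio p K
  set b := pathLoss p l
  set e := estVar p K b
  set t := (M : ℝ) - K
  have hθ0 : 0 < θ := by linarith
  refine ⟨by positivity, ?_, ?_⟩
  · have h3 : p.Pd * r + p.σR2 ≤ θ * (p.Pd * S + p.σR2) := by nlinarith
    calc t * p.Pd * e / (p.Pd * S + p.σR2) ≤ t * p.Pd * b / (p.Pd * S + p.σR2) := by gcongr
      _ ≤ t * p.Pd * b / ((p.Pd * r + p.σR2) / θ) := by
        gcongr
        rw [div_le_iff₀ hθ0]; linarith
      _ = _ := by field_simp
  · calc t * (p.Pd / (p.Pd * r + p.σR2) * b) = t * p.Pd * b / (p.Pd * r + p.σR2) := by ring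
      _ ≤ t * p.Pd * (θ * e) / (p.Pd * S + p.σR2) := by gcongr
      _ = _ := by ring

lemma logb_snr1_close {K M : ℕ} (hK : 0 < K) (hKM : K < M) {S : ℝ} (hS : 0 ≤ S)
    (hS1 : S ≤ 1 / (2 * p.ρ)) (hS2 : 1 / (2 * p.ρ) ≤ estRatio p K * S) {l : ℝ}
    (hl : l ∈ Set.Icc p.Rmin p.Rmax) :
    |Real.logb 2 (1 + snr1 p K M S l)
      - Real.logb 2 (1 + ((M : ℝ) - K) * (gain1 p * pathLoss p l))| ≤ 2 * (estRatio p K - 1) := by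
  have ht : (0 : ℝ) < (M : ℝ) - K := by rw [sub_pos]; exact_mod_cast hKM
  obtain ⟨h0, h1, h2⟩ := snr1_bounds hK hKM hS hS1 hS2 hl
  have := gain1_pos p
  have := pathLoss_pos p (pos_of_mem p hl)
  exact abs_logb_sub_le (one_le_estRatio p K) h0 (by positivity) h1 h2

lemma sum_errVar_bounds {K : ℕ} (hK : 0 < K) {d : Fin K → ℝ}
    (hd : ∀ k, d k ∈ Set.Icc p.Rmin p.Rmax) :
    0 ≤ ∑ j, errVar p K (pathLoss p (d j)) ∧
    ∑ j, errVar p K (pathLoss p (d j)) ≤ 1 / (2 * p.ρ) ∧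
    1 / (2 * p.ρ) ≤ estRatio p K * ∑ j, errVar p K (pathLoss p (d j)) := by
  have hK' : (0 : ℝ) < K := by exact_mod_cast hK
  have hθ := one_le_estRatio p K
  have hβ := fun j => pathLoss_pos p (pos_of_mem p (hd j))
  refine ⟨Finset.sum_nonneg fun j _ => (errVar_pos p hK (hβ j)).le, ?_, ?_⟩
  · have h : ∑ j, errVar p K (pathLoss p (d j)) ≤ ∑ _j : Fin K, 1 / (2 * p.ρ) / K :=
      Finset.sum_le_sum fun j _ => by
        rw [le_div_iff₀ hK', mul_comm]; exact mul_errVar_le p hK (hβ j)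
    rw [Finset.sum_const, Finset.card_univ, Fintype.card_fin, nsmul_eq_mul,
      mul_div_cancel₀ _ hK'.ne'] at h
    exact h
  · have h : ∑ _j : Fin K, 1 / (2 * p.ρ) / K
        ≤ ∑ j, estRatio p K * errVar p K (pathLoss p (d j)) :=
      Finset.sum_le_sum fun j _ => by
        rw [div_le_iff₀ hK']; linarith [le_mul_errVar p hK (hd j)]
    rw [Finset.sum_const, Finset.card_univ, Fintype.card_fin, nsmul_eq_mul,
      mul_div_cancel₀ _ hK'.ne', ← Finset.mul_sum] at h
    exact h

lemma integrable_distLaw {g : ℝ → ℝ} (hg : Measurable g) {C : ℝ}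
    (hC : ∀ l ∈ Set.Icc p.Rmin p.Rmax, |g l| ≤ C) : Integrable g (distLaw p) :=
  Integrable.of_bound hg.aestronglyMeasurable C
    ((ae_distLaw p).mono fun l hl => hC l hl)

lemma integral_distLaw_mono {f g : ℝ → ℝ} (hf : Integrable f (distLaw p))
    (hg : Integrable g (distLaw p)) (h : ∀ l ∈ Set.Icc p.Rmin p.Rmax, f l ≤ g l) :
    ∫ l, f l ∂distLaw p ≤ ∫ l, g l ∂distLaw p :=
  integral_mono_ae hf hg ((ae_distLaw p).mono h)

lemma abs_integral_distLaw_sub_le {f g : ℝ → ℝ} (hf : Integrable f (distLaw p))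
    (hg : Integrable g (distLaw p)) {C : ℝ}
    (h : ∀ l ∈ Set.Icc p.Rmin p.Rmax, |f l - g l| ≤ C) :
    |∫ l, f l ∂distLaw p - ∫ l, g l ∂distLaw p| ≤ C := by
  rw [← integral_sub hf hg]
  have := norm_integral_le_of_norm_le_const (μ := distLaw p) (f := fun l => f l - g l) (C := C)
    ((ae_distLaw p).mono h)
  simpa using this

lemma A1_bounds {K : ℕ} (hK : 0 < K) :
    0 ≤ A1 p K ∧ A1 p K ≤ 1 / (2 * p.ρ) ∧ 1 / (2 * p.ρ) ≤ estRatio p K * A1 p K := by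
  have hK' : (0 : ℝ) < K := by exact_mod_cast hK
  have hρ := p.ρ_pos
  have hβ := fun l (hl : l ∈ Set.Icc p.Rmin p.Rmax) => pathLoss_pos p (pos_of_mem p hl)
  have hi : Integrable (fun l => K * errVar p K (pathLoss p l)) (distLaw p) :=
    integrable_distLaw (C := 1 / (2 * p.ρ)) ((measurable_errVar p K).const_mul _) fun l hl => by
      rw [abs_of_pos (mul_pos hK' (errVar_pos p hK (hβ l hl)))]
      exact mul_errVar_le p hK (hβ l hl)
  have hA : A1 p K = ∫ l, K * errVar p K (pathLoss p l) ∂distLaw p := by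
    rw [integral_const_mul, integral_distLaw p (measurable_errVar p K), A1_eq p hK]
  have h1 := integral_distLaw_mono hi (integrable_const (1 / (2 * p.ρ)))
    fun l hl => mul_errVar_le p hK (hβ l hl)
  have h2 := integral_distLaw_mono (integrable_const (1 / (2 * p.ρ))) (hi.const_mul (estRatio p K))
    fun l hl => le_mul_errVar p hK hl
  have h3 := integral_distLaw_mono (integrable_const 0) hi
    fun l hl => (mul_pos hK' (errVar_pos p hK (hβ l hl))).le
  rw [integral_const_mul, ← hA] at h2
  rw [← hA] at h1 h3
  simp only [integral_const, probReal_univ, one_smul] at h1 h2 h3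
  exact ⟨h3, h1, h2⟩

lemma rate1_eq {K M : ℕ} (hKM : K < M) {d : Fin K → ℝ}
    (hd : ∀ k, d k ∈ Set.Icc p.Rmin p.Rmax) (k : Fin K) :
    rate1 p M d k
      = Real.logb 2 (1 + snr1 p K M (∑ j, errVar p K (pathLoss p (d j))) (d k)) := by
  rw [rate1, sinr1_eq p (fun j => pathLoss_pos p (pos_of_mem p (hd j))) hKM]
  rfl

variable (p) in
lemma measurable_logb_snr1 (K M : ℕ) (S : ℝ) :
    Measurable fun l => Real.logb 2 (1 + snr1 p K M S l) := by
  have := measurable_estVar p K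
  unfold snr1 Real.logb
  fun_prop

variable (p) in
lemma limRate1_eq (K M : ℕ) :
    limRate1 p K M = ∫ l, Real.logb 2 (1 + snr1 p K M (A1 p K) l) ∂distLaw p := by
  rw [integral_distLaw p (measurable_logb_snr1 p K M _)]
  rfl

/-- Model for the source-to-relay rate, with `t = M - K`. -/
noncomputable def modelRate1 (p : Params) (t l : ℝ) : ℝ :=
  Real.logb 2 (1 + t * (gain1 p * pathLoss p l))

lemma measurable_modelRate1 (t : ℝ) : Measurable (modelRate1 p t) := by
  have := measurable_pathLoss p
  unfold modelRate1 Real.logb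
  fun_prop

lemma integrable_modelRate1 {t : ℝ} (ht : 0 ≤ t) : Integrable (modelRate1 p t) (distLaw p) := by
  refine integrable_distLaw (C := 2 * (t * (gain1 p * pathLoss p p.Rmin)))
    (measurable_modelRate1 t) fun l hl => ?_
  have h1 := gain1_pos p
  have h2 := pathLoss_pos p (pos_of_mem p hl)
  have h3 := (pathLoss_mem p hl).2
  rw [modelRate1, abs_of_nonneg (logb_one_add_nonneg (by positivity))]
  refine (logb_one_add_le_two_mul (by positivity)).trans ?_
  gcongr

lemma abs_limRate1_sub_le {K M : ℕ} (hK : 0 < K) (hKM : K < M) :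
    Integrable (fun l => Real.logb 2 (1 + snr1 p K M (A1 p K) l)) (distLaw p) ∧
    |limRate1 p K M - ∫ l, modelRate1 p ((M : ℝ) - K) l ∂distLaw p| ≤ 2 * (estRatio p K - 1) := by
  have ht : (0 : ℝ) < (M : ℝ) - K := by rw [sub_pos]; exact_mod_cast hKM
  obtain ⟨h0, h1, h2⟩ := A1_bounds (p := p) hK
  have hi := integrable_modelRate1 (p := p) ht.le
  have hclose := fun l (hl : l ∈ Set.Icc p.Rmin p.Rmax) => logb_snr1_close hK hKM h0 h1 h2 hl
  have hi2 : Integrable (fun l => Real.logb 2 (1 + snr1 p K M (A1 p K) l)) (distLaw p) := by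
    have h3 : Integrable (fun l => (Real.logb 2 (1 + snr1 p K M (A1 p K) l)
        - modelRate1 p ((M : ℝ) - K) l) + modelRate1 p ((M : ℝ) - K) l) (distLaw p) :=
      (integrable_distLaw ((measurable_logb_snr1 p K M _).sub (measurable_modelRate1 _))
        hclose).add hi
    simpa using h3
  refine ⟨hi2, ?_⟩
  rw [limRate1_eq]
  exact abs_integral_distLaw_sub_le hi2 hi hclose

lemma abs_rate1_sub_le {K M : ℕ} (hKM : K < M) {d : Fin K → ℝ}
    (hd : ∀ k, d k ∈ Set.Icc p.Rmin p.Rmax) (k : Fin K) :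
    |rate1 p M d k - modelRate1 p ((M : ℝ) - K) (d k)| ≤ 2 * (estRatio p K - 1) := by
  obtain ⟨h0, h1, h2⟩ := sum_errVar_bounds k.pos hd
  rw [rate1_eq hKM hd]
  exact logb_snr1_close k.pos hKM h0 h1 h2 (hd k)

/-! ### Relay-to-destination SINR -/

variable (p) in
/-- Relay-to-destination SINR with power normalization sum `S`. -/
noncomputable def snr2 (K M : ℕ) (S l : ℝ) : ℝ :=
  ((M : ℝ) - K) * p.PR / ((p.PR * errVar p K (pathLoss p l) + p.σD2) * S)

variable (p) in
/-- Bound on the relative effect of the channel estimation error at the destinations. -/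
noncomputable def noiseRatio (K : ℕ) : ℝ := 1 + p.PR / p.σD2 * (1 / pilotSNR p K)

variable (p) in
lemma one_le_noiseRatio (K : ℕ) : 1 ≤ noiseRatio p K := by
  have := p.ρ_pos; have := p.PR_pos; have := p.σD2_pos
  have : 0 ≤ pilotSNR p K := by unfold pilotSNR; positivity
  unfold noiseRatio
  linarith [show 0 ≤ p.PR / p.σD2 * (1 / pilotSNR p K) by positivity]

variable (p) in
lemma tendsto_noiseRatio : Tendsto (noiseRatio p) atTop (𝓝 1) := by
  have h := ((tendsto_pilotSNR p).inv_tendsto_atTop.const_mul (p.PR / p.σD2)).const_add 1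
  rw [mul_zero, add_zero] at h
  refine h.congr fun K => ?_
  simp [noiseRatio]

variable (p) in
/-- Mean of `1 / β`. -/
noncomputable def meanInv : ℝ := ∫ l, (pathLoss p l)⁻¹ ∂distLaw p

lemma inv_pathLoss_mem {l : ℝ} (hl : l ∈ Set.Icc p.Rmin p.Rmax) :
    (pathLoss p p.Rmin)⁻¹ ≤ (pathLoss p l)⁻¹ ∧ (pathLoss p l)⁻¹ ≤ (pathLoss p p.Rmax)⁻¹ :=
  ⟨inv_anti₀ (pathLoss_pos p (pos_of_mem p hl)) (pathLoss_mem p hl).2,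
    inv_anti₀ (pathLoss_Rmax_pos p) (pathLoss_mem p hl).1⟩

variable (p) in
lemma integrable_inv_pathLoss : Integrable (fun l => (pathLoss p l)⁻¹) (distLaw p) :=
  integrable_distLaw (C := (pathLoss p p.Rmax)⁻¹) (measurable_pathLoss p).inv fun l hl => by
    rw [abs_of_pos (inv_pos.2 (pathLoss_pos p (pos_of_mem p hl)))]
    exact (inv_pathLoss_mem hl).2

variable (p) in
lemma meanInv_mem : (pathLoss p p.Rmin)⁻¹ ≤ meanInv p ∧ meanInv p ≤ (pathLoss p p.Rmax)⁻¹ := by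
  have h1 := integral_distLaw_mono (integrable_const _) (integrable_inv_pathLoss p)
    fun l hl => (inv_pathLoss_mem hl).1
  have h2 := integral_distLaw_mono (integrable_inv_pathLoss p) (integrable_const _)
    fun l hl => (inv_pathLoss_mem hl).2
  simp only [integral_const, probReal_univ, one_smul] at h1 h2
  exact ⟨h1, h2⟩

variable (p) in
lemma meanInv_pos : 0 < meanInv p :=
  (inv_pos.2 (pathLoss_Rmin_pos p)).trans_le (meanInv_mem p).1

variable (p) in
/-- Limit of the relay-to-destination SINR. -/
noncomputable def limSnr2 (K M : ℕ) : ℝ := ((M : ℝ) - K) * p.PR / (p.σD2 * (K * meanInv p))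

lemma limSnr2_pos {K M : ℕ} (hK : 0 < K) (hKM : K < M) : 0 < limSnr2 p K M := by
  have ht : (0 : ℝ) < (M : ℝ) - K := by rw [sub_pos]; exact_mod_cast hKM
  have hK' : (0 : ℝ) < K := by exact_mod_cast hK
  have := p.PR_pos; have := p.σD2_pos; have := meanInv_pos p
  unfold limSnr2; positivity

/-- `S` is again either the random sum of 1/β' or its mean `A2`. The factor `κ` measures its
distance from K E[1/β], and `noiseRatio` absorbs the residual error P_R β̃ relative to σ_D². -/
lemma snr2_bounds {K M : ℕ} (hK : 0 < K) (hKM : K < M) {S κ : ℝ} (hκ : 1 ≤ κ) (hS : 0 < S)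
    (hS1 : S ≤ κ * (K * meanInv p)) (hS2 : K * meanInv p ≤ κ * S) {l : ℝ}
    (hl : l ∈ Set.Icc p.Rmin p.Rmax) :
    0 ≤ snr2 p K M S l ∧ snr2 p K M S l ≤ κ * noiseRatio p K * limSnr2 p K M ∧
    limSnr2 p K M ≤ κ * noiseRatio p K * snr2 p K M S l := by
  have ht : (0 : ℝ) < (M : ℝ) - K := by rw [sub_pos]; exact_mod_cast hKM
  have hK' : (0 : ℝ) < K := by exact_mod_cast hK
  have hPR := p.PR_pos
  have hσ := p.σD2_pos
  have hm := meanInv_pos p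
  have hβ := pathLoss_pos p (pos_of_mem p hl)
  have hE := errVar_pos p hK hβ
  have hτ := pilotSNR_pos p hK
  have hν := one_le_noiseRatio p K
  have hlim := limSnr2_pos (p := p) hK hKM
  have h1 : errVar p K (pathLoss p l) ≤ 1 / pilotSNR p K := by
    rw [errVar_eq p hK hβ, div_le_div_iff₀ (by positivity) hτ]; nlinarith
  have h2 : p.PR * errVar p K (pathLoss p l) + p.σD2 ≤ noiseRatio p K * p.σD2 := by
    unfold noiseRatio
    have : (1 + p.PR / p.σD2 * (1 / pilotSNR p K)) * p.σD2 = p.σD2 + p.PR * (1 / pilotSNR p K) := by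
      field_simp
    rw [this]
    nlinarith
  unfold snr2
  set e := errVar p K (pathLoss p l)
  set ν := noiseRatio p K
  set t := (M : ℝ) - K
  have hm' : 0 < K * meanInv p := by positivity
  have hν0 : 0 < ν := by linarith
  have hκ0 : 0 < κ := by linarith
  refine ⟨by positivity, ?_, ?_⟩
  · calc t * p.PR / ((p.PR * e + p.σD2) * S) ≤ t * p.PR / (p.σD2 * (K * meanInv p / κ)) := by
          gcongr
          · nlinarith
          · rw [div_le_iff₀ hκ0]; linarith
      _ = κ * 1 * limSnr2 p K M := by unfold limSnr2; field_simp; rfl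
      _ ≤ κ * ν * limSnr2 p K M := by gcongr
  · calc limSnr2 p K M ≤ t * p.PR / ((p.PR * e + p.σD2) / ν * (S / κ)) := by
          unfold limSnr2
          gcongr
          · rw [div_le_iff₀ hν0]; linarith
          · rw [div_le_iff₀ hκ0]; linarith
      _ = _ := by field_simp

lemma inv_estVar_mem {K : ℕ} (hK : 0 < K) {l : ℝ} (hl : l ∈ Set.Icc p.Rmin p.Rmax) :
    (pathLoss p l)⁻¹ ≤ (estVar p K (pathLoss p l))⁻¹ ∧
    (estVar p K (pathLoss p l))⁻¹ ≤ estRatio p K * (pathLoss p l)⁻¹ := by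
  have hβ := pathLoss_pos p (pos_of_mem p hl)
  have hE := estVar_pos p hK hβ
  refine ⟨inv_anti₀ hE (estVar_le hK hβ), ?_⟩
  have h := pathLoss_le_estVar p hK hl
  rw [← div_eq_mul_inv, le_div_iff₀ hβ, inv_mul_le_iff₀ hE]
  linarith

lemma A2_bounds {K : ℕ} (hK : 0 < K) :
    0 < A2 p K ∧ K * meanInv p ≤ A2 p K ∧ A2 p K ≤ estRatio p K * (K * meanInv p) := by
  have hK' : (0 : ℝ) < K := by exact_mod_cast hK
  have hm := meanInv_pos p
  have hθ := one_le_estRatio p K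
  have hi : Integrable (fun l => (estVar p K (pathLoss p l))⁻¹) (distLaw p) :=
    integrable_distLaw (C := estRatio p K * (pathLoss p p.Rmax)⁻¹)
      (measurable_estVar p K).inv fun l hl => by
      rw [abs_of_pos (inv_pos.2 (estVar_pos p hK (pathLoss_pos p (pos_of_mem p hl))))]
      refine (inv_estVar_mem hK hl).2.trans ?_
      exact mul_le_mul_of_nonneg_left (inv_pathLoss_mem hl).2 (by linarith)
  have hA : A2 p K = K * ∫ l, (estVar p K (pathLoss p l))⁻¹ ∂distLaw p := by
    rw [integral_distLaw p (g := fun l => (estVar p K (pathLoss p l))⁻¹)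
      (measurable_estVar p K).inv, A2_eq p hK]
  have h1 := integral_distLaw_mono (integrable_inv_pathLoss p) hi
    fun l hl => (inv_estVar_mem hK hl).1
  have h2 := integral_distLaw_mono hi ((integrable_inv_pathLoss p).const_mul (estRatio p K))
    fun l hl => (inv_estVar_mem hK hl).2
  rw [integral_const_mul] at h2
  change meanInv p ≤ _ at h1
  change _ ≤ estRatio p K * meanInv p at h2
  have h3 : K * meanInv p ≤ A2 p K := by rw [hA]; gcongr
  refine ⟨lt_of_lt_of_le (by positivity) h3, h3, ?_⟩
  rw [hA, mul_left_comm]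
  gcongr

lemma rate2_eq {K M : ℕ} (hKM : K < M) {d : Fin K → ℝ}
    (hd : ∀ k, d k ∈ Set.Icc p.Rmin p.Rmax) (k : Fin K) :
    rate2 p M d k
      = Real.logb 2 (1 + snr2 p K M (∑ j, (estVar p K (pathLoss p (d j)))⁻¹) (d k)) := by
  rw [rate2, sinr2_equalPower p (fun j => pathLoss_pos p (pos_of_mem p (hd j))) hKM]
  rfl

variable (p) in
lemma measurable_logb_snr2 (K M : ℕ) (S : ℝ) :
    Measurable fun l => Real.logb 2 (1 + snr2 p K M S l) := by
  have := measurable_errVar p K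
  unfold snr2 Real.logb
  fun_prop

variable (p) in
lemma limRate2_eq (K M : ℕ) :
    limRate2 p K M = ∫ l, Real.logb 2 (1 + snr2 p K M (A2 p K) l) ∂distLaw p := by
  rw [integral_distLaw p (measurable_logb_snr2 p K M _)]
  rfl

variable (p) in
/-- Limit of the relay-to-destination rate. -/
noncomputable def modelRate2 (K M : ℕ) : ℝ := Real.logb 2 (1 + limSnr2 p K M)

/-- The absolute bound serves the rate statements. The relative one is needed for the efficiency,
since the rate itself tends to 0 when (M-K)/K does. -/
lemma logb_snr2_close {K M : ℕ} (hK : 0 < K) (hKM : K < M) {S κ : ℝ} (hκ : 1 ≤ κ) (hS : 0 < S)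
    (hS1 : S ≤ κ * (K * meanInv p)) (hS2 : K * meanInv p ≤ κ * S) {l : ℝ}
    (hl : l ∈ Set.Icc p.Rmin p.Rmax) :
    |Real.logb 2 (1 + snr2 p K M S l) - modelRate2 p K M| ≤ 2 * (κ * noiseRatio p K - 1) ∧
    |Real.logb 2 (1 + snr2 p K M S l) - modelRate2 p K M|
      ≤ (κ * noiseRatio p K - 1) * modelRate2 p K M := by
  obtain ⟨h0, h1, h2⟩ := snr2_bounds hK hKM hκ hS hS1 hS2 hl
  have h3 : 1 ≤ κ * noiseRatio p K := one_le_mul_of_one_le_of_one_le hκ (one_le_noiseRatio p K)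
  exact ⟨abs_logb_sub_le h3 h0 (limSnr2_pos hK hKM).le h1 h2,
    abs_logb_sub_le_mul h3 h0 (limSnr2_pos hK hKM).le h1 h2⟩

/-- The last bound converts errors relative to `modelRate2` into errors relative to `limRate2`. -/
lemma limRate2_close {K M : ℕ} (hK : 0 < K) (hKM : K < M) :
    Integrable (fun l => Real.logb 2 (1 + snr2 p K M (A2 p K) l)) (distLaw p) ∧
    |limRate2 p K M - modelRate2 p K M| ≤ 2 * (estRatio p K * noiseRatio p K - 1) ∧
    |limRate2 p K M - modelRate2 p K M|
      ≤ (estRatio p K * noiseRatio p K - 1) * modelRate2 p K M ∧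
    0 ≤ limRate2 p K M ∧
    modelRate2 p K M ≤ estRatio p K * noiseRatio p K * limRate2 p K M := by
  obtain ⟨h0, h1, h2⟩ := A2_bounds (p := p) hK
  have hθ := one_le_estRatio p K
  have h1' : K * meanInv p ≤ estRatio p K * A2 p K := by nlinarith
  have hc := fun l (hl : l ∈ Set.Icc p.Rmin p.Rmax) =>
    logb_snr2_close (M := M) hK hKM hθ h0 h2 h1' hl
  have hb := fun l (hl : l ∈ Set.Icc p.Rmin p.Rmax) =>
    snr2_bounds (M := M) hK hKM hθ h0 h2 h1' hl
  have h3 : 1 ≤ estRatio p K * noiseRatio p K :=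
    one_le_mul_of_one_le_of_one_le hθ (one_le_noiseRatio p K)
  have hi : Integrable (fun l => Real.logb 2 (1 + snr2 p K M (A2 p K) l)) (distLaw p) := by
    have h4 := (integrable_distLaw ((measurable_logb_snr2 p K M (A2 p K)).sub
      (measurable_const (a := modelRate2 p K M))) fun l hl => (hc l hl).1).add
      (integrable_const (modelRate2 p K M))
    refine h4.congr (ae_of_all _ fun l => ?_)
    simp
  have e : ∫ _l, modelRate2 p K M ∂distLaw p = modelRate2 p K M := by simp
  have g1 := abs_integral_distLaw_sub_le hi (integrable_const (modelRate2 p K M))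
    fun l hl => (hc l hl).1
  have g2 := abs_integral_distLaw_sub_le hi (integrable_const (modelRate2 p K M))
    fun l hl => (hc l hl).2
  have g3 := integral_distLaw_mono (integrable_const 0) hi
    fun l hl => logb_one_add_nonneg (hb l hl).1
  have g4 := integral_distLaw_mono (integrable_const (modelRate2 p K M))
    (hi.const_mul (estRatio p K * noiseRatio p K))
    fun l hl => logb_one_add_le_mul h3 (limSnr2_pos hK hKM).le (hb l hl).1 (hb l hl).2.2
  rw [e, ← limRate2_eq] at g1 g2
  rw [integral_const_mul, e, ← limRate2_eq] at g4
  rw [← limRate2_eq, integral_zero] at g3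
  exact ⟨hi, g1, g2, g3, g4⟩

end

/-! ### The second hop is the bottleneck -/

section

variable {p : Params}

/-- The first SINR is of order M-K, the second of order (M-K)/K. The common factor M-K drops out, so
the threshold on K is uniform in M and in the locations. -/
lemma eventually_snr2_le_snr1 (p : Params) : ∀ᶠ K : ℕ in atTop, ∀ M, K < M → ∀ S S' l l',
    0 ≤ S' → S' ≤ 1 / (2 * p.ρ) → 1 / (2 * p.ρ) ≤ estRatio p K * S' →
    K * (pathLoss p p.Rmin)⁻¹ ≤ S → l ∈ Set.Icc p.Rmin p.Rmax → l' ∈ Set.Icc p.Rmin p.Rmax →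
    snr2 p K M S l' ≤ snr1 p K M S' l := by
  have hg := gain1_pos p
  have hb := pathLoss_Rmax_pos p
  have hB := pathLoss_Rmin_pos p
  have hPR := p.PR_pos
  have hσ := p.σD2_pos
  have h1 := (tendsto_estRatio p).eventually (gt_mem_nhds (by norm_num : (1 : ℝ) < 2))
  -- From this K on, the upper bound for the second SINR is at most half the smallest model value of
  -- the first; the half pays for `estRatio` < 2.
  have h2 := tendsto_natCast_atTop_atTop (R := ℝ) |>.eventually_ge_atTop
    (2 * p.PR * pathLoss p p.Rmin / (p.σD2 * gain1 p * pathLoss p p.Rmax))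
  filter_upwards [h1, h2, eventually_gt_atTop 0] with K hθ hK2 hK M hKM S S' l l' hS0 hS1 hS2 hS hl hl'
  have hK' : (0 : ℝ) < K := by exact_mod_cast hK
  have ht : (0 : ℝ) < (M : ℝ) - K := by rw [sub_pos]; exact_mod_cast hKM
  have hθ1 := one_le_estRatio p K
  obtain ⟨-, -, h3⟩ := snr1_bounds hK hKM hS0 hS1 hS2 hl
  have h4 := errVar_pos p hK (pathLoss_pos p (pos_of_mem p hl'))
  have h5 := (pathLoss_mem p hl).1
  have h6 : snr2 p K M S l'
      ≤ ((M : ℝ) - K) * p.PR / (p.σD2 * (K * (pathLoss p p.Rmin)⁻¹)) := by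
    unfold snr2
    gcongr
    nlinarith
  rw [div_le_iff₀ (by positivity)] at hK2
  have h7 : ((M : ℝ) - K) * p.PR / (p.σD2 * (K * (pathLoss p p.Rmin)⁻¹))
      ≤ ((M : ℝ) - K) * (gain1 p * pathLoss p p.Rmax) / 2 := by
    rw [div_le_div_iff₀ (by positivity) two_pos]
    have : ((M : ℝ) - K) * p.PR * 2 = ((M : ℝ) - K) *
      (2 * p.PR * pathLoss p p.Rmin) * (pathLoss p p.Rmin)⁻¹ := by field_simp
    rw [this]
    calc _ ≤ ((M : ℝ) - K) * (K * (p.σD2 * gain1 p * pathLoss p p.Rmax))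
          * (pathLoss p p.Rmin)⁻¹ := by gcongr
      _ = _ := by ring
  have h8 : ((M : ℝ) - K) * (gain1 p * pathLoss p p.Rmax) / 2 ≤ snr1 p K M S' l := by
    have h9 : ((M : ℝ) - K) * (gain1 p * pathLoss p p.Rmax)
        ≤ ((M : ℝ) - K) * (gain1 p * pathLoss p l) := by gcongr
    have h10 : 0 ≤ snr1 p K M S' l := (snr1_bounds hK hKM hS0 hS1 hS2 hl).1
    nlinarith
  linarith

lemma sum_inv_estVar_bounds {K : ℕ} (hK : 0 < K) {d : Fin K → ℝ}
    (hd : ∀ k, d k ∈ Set.Icc p.Rmin p.Rmax) :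
    ∑ j, (pathLoss p (d j))⁻¹ ≤ ∑ j, (estVar p K (pathLoss p (d j)))⁻¹ ∧
    ∑ j, (estVar p K (pathLoss p (d j)))⁻¹ ≤ estRatio p K * ∑ j, (pathLoss p (d j))⁻¹ := by
  refine ⟨Finset.sum_le_sum fun j _ => (inv_estVar_mem hK (hd j)).1, ?_⟩
  rw [Finset.mul_sum]
  exact Finset.sum_le_sum fun j _ => (inv_estVar_mem hK (hd j)).2

lemma sum_inv_pathLoss_mem {K : ℕ} {d : Fin K → ℝ} (hd : ∀ k, d k ∈ Set.Icc p.Rmin p.Rmax) :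
    K * (pathLoss p p.Rmin)⁻¹ ≤ ∑ j, (pathLoss p (d j))⁻¹ ∧
    ∑ j, (pathLoss p (d j))⁻¹ ≤ K * (pathLoss p p.Rmax)⁻¹ := by
  have h1 := Finset.sum_le_sum fun j (_ : j ∈ Finset.univ) => (inv_pathLoss_mem (hd j)).1
  have h2 := Finset.sum_le_sum fun j (_ : j ∈ Finset.univ) => (inv_pathLoss_mem (hd j)).2
  simp only [Finset.sum_const, Finset.card_univ, Fintype.card_fin, nsmul_eq_mul] at h1 h2
  exact ⟨h1, h2⟩

lemma eventually_rate2_le_rate1 (p : Params) : ∀ᶠ K : ℕ in atTop, ∀ M, K < M →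
    (∀ d d' : Fin K → ℝ, (∀ k, d k ∈ Set.Icc p.Rmin p.Rmax) →
      (∀ k, d' k ∈ Set.Icc p.Rmin p.Rmax) → ∀ k, rate2 p M d' k ≤ rate1 p M d k) ∧
    limRate2 p K M ≤ limRate1 p K M := by
  filter_upwards [eventually_snr2_le_snr1 p, eventually_gt_atTop 0] with K h hK M hKM
  have hK' : (0 : ℝ) < K := by exact_mod_cast hK
  have ht : (0 : ℝ) < (M : ℝ) - K := by rw [sub_pos]; exact_mod_cast hKM
  have hB := pathLoss_Rmin_pos p
  have hPR := p.PR_pos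
  have hσ := p.σD2_pos
  have hnn : ∀ S l, 0 < S → l ∈ Set.Icc p.Rmin p.Rmax → 0 ≤ snr2 p K M S l := fun S l hS hl => by
    have := errVar_pos p hK (pathLoss_pos p (pos_of_mem p hl))
    unfold snr2; positivity
  have hpos : 0 < K * (pathLoss p p.Rmin)⁻¹ := by positivity
  refine ⟨fun d d' hd hd' k => ?_, ?_⟩
  · obtain ⟨a0, a1, a2⟩ := sum_errVar_bounds hK hd
    have b1 := (sum_inv_pathLoss_mem hd').1.trans (sum_inv_estVar_bounds hK hd').1
    rw [rate1_eq hKM hd, rate2_eq hKM hd']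
    have h1 := h M hKM _ _ (d k) (d' k) a0 a1 a2 b1 (hd k) (hd' k)
    have h2 := hnn _ _ (hpos.trans_le b1) (hd' k)
    exact Real.logb_le_logb_of_le one_lt_two (by linarith) (by linarith)
  · obtain ⟨a0, a1, a2⟩ := A1_bounds (p := p) hK
    obtain ⟨b0, b1, -⟩ := A2_bounds (p := p) hK
    have b2 : K * (pathLoss p p.Rmin)⁻¹ ≤ A2 p K :=
      (mul_le_mul_of_nonneg_left (meanInv_mem p).1 hK'.le).trans b1
    rw [limRate1_eq, limRate2_eq]
    refine integral_distLaw_mono (limRate2_close hK hKM).1 (abs_limRate1_sub_le hK hKM).1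
      fun l hl => ?_
    have h1 := h M hKM _ _ l l a0 a1 a2 b2 hl hl
    have h2 := hnn _ _ b0 hl
    exact Real.logb_le_logb_of_le one_lt_two (by linarith) (by linarith)

/-! ### Power consumption -/

lemma totalPower_lower_bound (p : Params) : ∀ᶠ K : ℕ in atTop, ∀ M, K < M → ∀ T : ℝ, 0 < T →
    p.B / (2 * p.LR) * (M * K) * (1 + 2 * K / T) ≤ totalPower p K M T p.PR := by
  have hB := p.B_pos
  have hL := p.LR_pos
  have hPR := p.PR_pos
  have hPd := p.Pd_pos
  have hρ := p.ρ_pos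
  have hσ := p.σR2_pos
  have hηd := p.ηd_mem.1
  have hηR := p.ηR_mem.1
  have h1 := p.Pfix_nonneg
  have h2 := p.Pant_nonneg
  have h3 := p.Pdev_nonneg
  have h4 := p.Psyn_nonneg
  have h := (tendsto_natCast_atTop_atTop (R := ℝ)).eventually_ge_atTop
    ((p.ηd⁻¹ / 2 * p.Pd + p.ηR⁻¹ / 2 * p.PR) * (p.LR / p.B))
  filter_upwards [h, eventually_ge_atTop 1] with K hK hK1 M hKM T hT
  have hK' : (1 : ℝ) ≤ K := by exact_mod_cast hK1
  have hM : (K : ℝ) ≤ M := by exact_mod_cast hKM.le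
  set a := p.ηd⁻¹ / 2 * p.Pd
  set b := p.ηR⁻¹ / 2 * p.PR
  have ha : 0 < a := by positivity
  have hb : 0 < b := by positivity
  set e := p.B / p.LR with he
  have he0 : 0 < e := by positivity
  have hab : a + b ≤ e * K := by
    have : (a + b) * (p.LR / p.B) = (a + b) / e := by rw [he]; field_simp
    rw [this, div_le_iff₀ he0] at hK
    linarith
  set u := 2 * K / T with hu
  have hu0 : 0 < u := by positivity
  have hTu : (T : ℝ)⁻¹ = u / (2 * K) := by rw [hu]; field_simp
  -- With u = 2K/T the terms 4eMK(1-u) and 4eMKu add up to 4eMK. As T may be less than 2K, 1-u may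
  -- be negative. The loss u(aK+b) ≤ u e MK is then covered by the share (9/6) u e MK of the last
  -- term, which leaves u e MK/2.
  have key : totalPower p K M T p.PR = (a * K + b) * (1 - u)
      + 2 * K * p.ρ * p.σR2 * p.ηd⁻¹ * u + p.Pfix + (M * p.Pant + 2 * K * p.Pdev + p.Psyn)
      + 4 * e * M * K + u * e * (K ^ 2 + 9 * M * K + 3 * M) / 6 := by
    unfold totalPower
    rw [← hu]
    simp only [div_eq_mul_inv _ T, hTu, a, b, he]
    field_simp
    ring
  have hcoef : a * K + b ≤ e * M * K := by
    have h5 : a * K + b ≤ (a + b) * K := by nlinarith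
    have h6 : (a + b) * K ≤ e * K * K := by gcongr
    have h7 : e * K * K ≤ e * M * K := by gcongr
    linarith
  have hL2 : p.B / (2 * p.LR) = e / 2 := by rw [he]; field_simp
  rw [key, hL2]
  have h8 : 0 ≤ 2 * K * p.ρ * p.σR2 * p.ηd⁻¹ * u := by positivity
  have h9 : 0 ≤ M * p.Pant + 2 * K * p.Pdev + p.Psyn := by positivity
  have h10 : u * (a * K + b) ≤ u * (e * M * K) := by gcongr
  have h11 : 0 ≤ u * e * K ^ 2 := by positivity
  have h12 : 0 ≤ u * e * M := by positivity
  have h13 : 0 ≤ e * M * K := by positivity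
  have h14 : 0 < a * K + b := by positivity
  nlinarith

lemma limRate2_le {K M : ℕ} (hK : 0 < K) (hKM : K < M) : limRate2 p K M
    ≤ estRatio p K * noiseRatio p K * (2 * (p.PR / (p.σD2 * meanInv p)) * (M / K)) := by
  have hK' : (0 : ℝ) < K := by exact_mod_cast hK
  have hPR := p.PR_pos
  have hσ := p.σD2_pos
  have hm := meanInv_pos p
  obtain ⟨-, -, h2, h3, -⟩ := limRate2_close (p := p) hK hKM
  have h4 : limRate2 p K M ≤ estRatio p K * noiseRatio p K * modelRate2 p K M := by
    have := (abs_sub_le_iff.1 h2).1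
    linarith
  have h5 := logb_one_add_le_two_mul (limSnr2_pos (p := p) hK hKM).le
  have h6 : limSnr2 p K M ≤ p.PR / (p.σD2 * meanInv p) * (M / K) := by
    have : p.PR / (p.σD2 * meanInv p) * (M / K) = M * p.PR / (p.σD2 * (K * meanInv p)) := by
      field_simp
    rw [this]
    unfold limSnr2
    gcongr
    linarith
  have h7 : modelRate2 p K M ≤ 2 * (p.PR / (p.σD2 * meanInv p)) * (M / K) := by
    unfold modelRate2; linarith
  have h8 := one_le_estRatio p K
  have h9 := one_le_noiseRatio p K
  exact h4.trans (mul_le_mul_of_nonneg_left h7 (by positivity))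

/-- From log₂(1+x) ≤ 2x the sum rate is O(M), against a power of at least a constant times MK(1+u)
and a prefactor |1-u| ≤ 1+u. A factor 1/K is given away, as boundedness suffices when multiplied by
a vanishing relative error. -/
lemma limEff_bounded (p : Params) : ∃ C : ℝ, ∀ᶠ K : ℕ in atTop, ∀ M, K < M → ∀ T : ℝ, 0 < T →
    |limEff p K M T| ≤ C := by
  have hPR := p.PR_pos
  have hσ := p.σD2_pos
  have hm := meanInv_pos p
  have hB := p.B_pos
  have hL := p.LR_pos
  have hlim := ((tendsto_estRatio p).mul (tendsto_noiseRatio p)).eventually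
    (gt_mem_nhds (by norm_num : (1 : ℝ) * 1 < 2))
  refine ⟨p.LR * (2 * (2 * (p.PR / (p.σD2 * meanInv p)))), ?_⟩
  filter_upwards [totalPower_lower_bound p, hlim, eventually_rate2_le_rate1 p,
    eventually_ge_atTop 1] with K hP hθ hR hK M hKM T hT
  have hK' : (1 : ℝ) ≤ K := by exact_mod_cast hK
  have hM : (K : ℝ) ≤ M := by exact_mod_cast hKM.le
  have h1 := hP M hKM T hT
  have hr0 : 0 ≤ limRate2 p K M := (limRate2_close (p := p) hK hKM).2.2.2.1
  have hr1 : limRate2 p K M ≤ 2 * (2 * (p.PR / (p.σD2 * meanInv p)) * (M / K)) :=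
    (limRate2_le hK hKM).trans (mul_le_mul_of_nonneg_right hθ.le (by positivity))
  rw [limEff, min_eq_right (hR M hKM).2, effOfRate]
  set u := 2 * K / T
  set D := p.PR / (p.σD2 * meanInv p)
  have hu0 : 0 < u := by positivity
  have hD0 : 0 < D := by positivity
  have hM0 : (0 : ℝ) < M := by linarith
  have hpos : 0 < p.B / (2 * p.LR) * (M * K) * (1 + u) := by positivity
  rw [abs_div, abs_mul, abs_mul, abs_of_pos (hpos.trans_le h1), abs_of_pos (half_pos hB),
    abs_of_nonneg (by positivity : 0 ≤ K * limRate2 p K M), div_le_iff₀ (hpos.trans_le h1)]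
  have hu : |1 - u| ≤ 1 + u := by rw [abs_le]; constructor <;> linarith
  calc |1 - u| * (p.B / 2) * (K * limRate2 p K M)
      ≤ (1 + u) * (p.B / 2) * (K * (2 * (2 * D * (M / K)))) := by gcongr
    _ = p.LR * (2 * (2 * D)) * (p.B / (2 * p.LR) * (M * 1) * (1 + u)) := by field_simp
    _ ≤ p.LR * (2 * (2 * D)) * (p.B / (2 * p.LR) * (M * K) * (1 + u)) := by gcongr
    _ ≤ _ := by gcongr

/-! ### Fluctuation of the power normalization -/

/-- Ratio between the power normalization sum and its mean, up to the estimation error. -/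
noncomputable def normRatio (p : Params) {K : ℕ} (d : Fin K → ℝ) : ℝ :=
  -- One plus both deviations dominates the ratio, its inverse and 1 simultaneously, and still tends
  -- to 1.
  1 + |(∑ j, (pathLoss p (d j))⁻¹) / (K * meanInv p) - 1|
    + |K * meanInv p / (∑ j, (pathLoss p (d j))⁻¹) - 1|

lemma one_le_normRatio {K : ℕ} (d : Fin K → ℝ) : 1 ≤ normRatio p d := by
  unfold normRatio
  linarith [abs_nonneg ((∑ j, (pathLoss p (d j))⁻¹) / (K * meanInv p) - 1),
    abs_nonneg (K * meanInv p / (∑ j, (pathLoss p (d j))⁻¹) - 1)]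

/-- The deterministic majorant for dominated convergence over the locations. -/
lemma normRatio_le {K : ℕ} {d : Fin K → ℝ} (hd : ∀ k, d k ∈ Set.Icc p.Rmin p.Rmax) :
    normRatio p d ≤ 3 + (pathLoss p p.Rmax)⁻¹ / meanInv p + meanInv p * pathLoss p p.Rmin := by
  have hm := meanInv_pos p
  have hb := pathLoss_Rmax_pos p
  have hB := pathLoss_Rmin_pos p
  obtain ⟨h1, h2⟩ := sum_inv_pathLoss_mem hd
  unfold normRatio
  set V := ∑ j, (pathLoss p (d j))⁻¹
  rcases Nat.eq_zero_or_pos K with hK | hK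
  -- For K = 0 both quotients are 0/0 = 0, so the value is 3.
  · have hV : V = 0 := by subst hK; simp [V]
    rw [hV, hK]
    have : 0 < (pathLoss p p.Rmax)⁻¹ / meanInv p + meanInv p * pathLoss p p.Rmin := by positivity
    norm_num
    linarith
  · have hK' : (0 : ℝ) < K := by exact_mod_cast hK
    have hV : 0 < V := lt_of_lt_of_le (by positivity) h1
    have h3 : V / (K * meanInv p) ≤ (pathLoss p p.Rmax)⁻¹ / meanInv p := by
      rw [div_le_div_iff₀ (by positivity) hm]
      nlinarith
    have h4 : K * meanInv p / V ≤ meanInv p * pathLoss p p.Rmin := by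
      rw [div_le_iff₀ hV]
      have : K * meanInv p = meanInv p * pathLoss p p.Rmin * (K * (pathLoss p p.Rmin)⁻¹) := by
        field_simp
      rw [this]
      gcongr
    have h5 : |V / (K * meanInv p) - 1| ≤ V / (K * meanInv p) + 1 := by
      have : 0 < V / (K * meanInv p) := by positivity
      rw [abs_le]; constructor <;> linarith
    have h6 : |K * meanInv p / V - 1| ≤ K * meanInv p / V + 1 := by
      have : 0 < K * meanInv p / V := by positivity
      rw [abs_le]; constructor <;> linarith
    linarith

variable (p) in
/-- Absolute error of the relay-to-destination rate. -/
noncomputable def absErr (K : ℕ) (r : ℝ) : ℝ :=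
  2 * (estRatio p K * r * noiseRatio p K - 1) + 2 * (estRatio p K * noiseRatio p K - 1)

variable (p) in
/-- Relative error of the relay-to-destination rate. -/
noncomputable def relErr (K : ℕ) (r : ℝ) : ℝ :=
  ((estRatio p K * r * noiseRatio p K - 1) + (estRatio p K * noiseRatio p K - 1))
    * (estRatio p K * noiseRatio p K)

lemma tendsto_absErr {r : ℕ → ℝ} (hr : Tendsto r atTop (𝓝 1)) :
    Tendsto (fun K => absErr p K (r K)) atTop (𝓝 0) := by
  have h1 := tendsto_estRatio p
  have h2 := tendsto_noiseRatio p
  have := ((((h1.mul hr).mul h2).sub_const 1).const_mul 2).add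
    (((h1.mul h2).sub_const 1).const_mul 2)
  simpa [absErr] using this

lemma tendsto_relErr {r : ℕ → ℝ} (hr : Tendsto r atTop (𝓝 1)) :
    Tendsto (fun K => relErr p K (r K)) atTop (𝓝 0) := by
  have h1 := tendsto_estRatio p
  have h2 := tendsto_noiseRatio p
  have := ((((h1.mul hr).mul h2).sub_const 1).add ((h1.mul h2).sub_const 1)).mul (h1.mul h2)
  simpa [relErr] using this

lemma abs_rate2_sub_le {K M : ℕ} (hKM : K < M) {d : Fin K → ℝ}
    (hd : ∀ k, d k ∈ Set.Icc p.Rmin p.Rmax) (k : Fin K) :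
    |rate2 p M d k - limRate2 p K M| ≤ absErr p K (normRatio p d) ∧
    |rate2 p M d k - limRate2 p K M| ≤ relErr p K (normRatio p d) * limRate2 p K M := by
  have hK := k.pos
  have hK' : (0 : ℝ) < K := by exact_mod_cast hK
  have hm := meanInv_pos p
  have hB := pathLoss_Rmin_pos p
  obtain ⟨h1, h2⟩ := sum_inv_pathLoss_mem hd
  obtain ⟨h3, h4⟩ := sum_inv_estVar_bounds hK hd
  have hθ := one_le_estRatio p K
  have hr := one_le_normRatio (p := p) d
  have hV : 0 < ∑ j, (pathLoss p (d j))⁻¹ := lt_of_lt_of_le (by positivity) h1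
  have hr1 : ∑ j, (pathLoss p (d j))⁻¹ ≤ normRatio p d * (K * meanInv p) := by
    rw [← div_le_iff₀ (by positivity)]
    unfold normRatio
    have a1 := le_abs_self ((∑ j, (pathLoss p (d j))⁻¹) / (K * meanInv p) - 1)
    have a2 := abs_nonneg (K * meanInv p / (∑ j, (pathLoss p (d j))⁻¹) - 1)
    linarith
  have hr2 : K * meanInv p ≤ normRatio p d * ∑ j, (pathLoss p (d j))⁻¹ := by
    rw [← div_le_iff₀ hV]
    unfold normRatio
    have a1 := abs_nonneg ((∑ j, (pathLoss p (d j))⁻¹) / (K * meanInv p) - 1)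
    have a2 := le_abs_self (K * meanInv p / (∑ j, (pathLoss p (d j))⁻¹) - 1)
    linarith
  have hS : 0 < ∑ j, (estVar p K (pathLoss p (d j)))⁻¹ := hV.trans_le h3
  set V := ∑ j, (pathLoss p (d j))⁻¹
  set S := ∑ j, (estVar p K (pathLoss p (d j)))⁻¹ with hSdef
  set r := normRatio p d
  obtain ⟨c1, c2⟩ := logb_snr2_close (M := M) hK hKM (κ := estRatio p K * r)
    (one_le_mul_of_one_le_of_one_le hθ hr) hS
    (by
      calc S ≤ estRatio p K * V := h4
        _ ≤ estRatio p K * (r * (K * meanInv p)) := by gcongr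
        _ = _ := by ring)
    (by
      calc K * meanInv p ≤ r * V := hr2
        _ ≤ r * S := by gcongr
        _ ≤ estRatio p K * (r * S) := le_mul_of_one_le_left (by positivity) hθ
        _ = _ := by ring) (hd k)
  obtain ⟨-, e1, e2, e3, e4⟩ := limRate2_close (p := p) hK hKM
  rw [rate2_eq hKM hd, ← hSdef]
  have htri := abs_sub_le (Real.logb 2 (1 + snr2 p K M S (d k))) (modelRate2 p K M)
    (limRate2 p K M)
  rw [abs_sub_comm (modelRate2 p K M)] at htri
  refine ⟨by unfold absErr; linarith, ?_⟩
  have hν := one_le_noiseRatio p K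
  have f1 : 0 ≤ (estRatio p K * r * noiseRatio p K - 1) + (estRatio p K * noiseRatio p K - 1) := by
    have g1 := one_le_mul_of_one_le_of_one_le (one_le_mul_of_one_le_of_one_le hθ hr) hν
    have g2 := one_le_mul_of_one_le_of_one_le hθ hν
    linarith
  have f2 := mul_le_mul_of_nonneg_left e4 f1
  unfold relErr
  linarith

end

/-! ### Laws of large numbers over the locations -/

section

variable {p : Params} {Ω : Type*} [MeasurableSpace Ω] {P : Measure Ω} {D : ℕ → Ω → ℝ}

lemma strong_law_distLaw (hD : ∀ i, Measurable (D i)) (hlaw : ∀ i, P.map (D i) = distLaw p)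
    (hind : Pairwise fun i j => IndepFun (D i) (D j) P) {g : ℝ → ℝ} (hg : Measurable g)
    (hi : Integrable g (distLaw p)) :
    ∀ᵐ ω ∂P, Tendsto (fun n : ℕ => (∑ i : Fin n, g (D i ω)) / n) atTop
      (𝓝 (∫ l, g l ∂distLaw p)) := by
  have h0 : Integrable (fun ω => g (D 0 ω)) P := by
    rw [← hlaw 0] at hi
    exact hi.comp_measurable (hD 0)
  have h := strong_law_ae_real (fun i ω => g (D i ω)) h0
    (fun i j hij => (hind hij).comp hg hg)
    (fun i => IdentDistrib.comp (u := g) ⟨(hD i).aemeasurable, (hD 0).aemeasurable, by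
      rw [hlaw, hlaw]⟩ hg)
  have e : ∫ ω, g (D 0 ω) ∂P = ∫ l, g l ∂distLaw p := by
    rw [← hlaw 0, integral_map (hD 0).aemeasurable hg.aestronglyMeasurable]
  rw [e] at h
  filter_upwards [h] with ω hω
  refine hω.congr fun n => ?_
  rw [Finset.sum_range]

lemma ae_forall_mem (hD : ∀ i, Measurable (D i)) (hlaw : ∀ i, P.map (D i) = distLaw p) :
    ∀ᵐ ω ∂P, ∀ i, D i ω ∈ Set.Icc p.Rmin p.Rmax := by
  rw [ae_all_iff]
  intro i
  have := ae_distLaw p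
  rw [← hlaw i] at this
  exact ae_of_ae_map (hD i).aemeasurable this

/-- A law of large numbers that is uniform over a Lipschitz family of functions. -/
lemma strong_law_uniform (hD : ∀ i, Measurable (D i)) (hlaw : ∀ i, P.map (D i) = distLaw p)
    (hind : Pairwise fun i j => IndepFun (D i) (D j) P) {φ : ℝ → ℝ → ℝ}
    (hφ : ∀ s, Measurable (φ s)) (hi : ∀ s ∈ Set.Icc (0 : ℝ) 1, Integrable (φ s) (distLaw p))
    {L : ℝ} (hL : ∀ s ∈ Set.Icc (0 : ℝ) 1, ∀ s' ∈ Set.Icc (0 : ℝ) 1,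
      ∀ l ∈ Set.Icc p.Rmin p.Rmax, |φ s l - φ s' l| ≤ L * |s - s'|)
    {s : ℕ → ℝ} (hs : ∀ K, s K ∈ Set.Icc (0 : ℝ) 1) :
    ∀ᵐ ω ∂P, Tendsto (fun K : ℕ => (∑ i : Fin K, φ (s K) (D i ω)) / K
      - ∫ l, φ (s K) l ∂distLaw p) atTop (𝓝 0) := by
  have hL0 : 0 ≤ L := by
    have h1 := hL 0 (by simp) 1 (by simp) p.Rmin ⟨le_rfl, p.Rmin_lt.le⟩
    simp only [zero_sub, abs_neg, abs_one, mul_one] at h1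
    exact (abs_nonneg _).trans h1
  have hgrid : ∀ n i : ℕ, i ≤ n → ((i : ℝ) / n) ∈ Set.Icc (0 : ℝ) 1 := fun n i hin =>
    ⟨by positivity, div_le_one_of_le₀ (by exact_mod_cast hin) n.cast_nonneg⟩
  -- Only the countably many parameters i/n enter, so one null set serves them all.
  have hall : ∀ᵐ ω ∂P, ∀ n i : ℕ, i ≤ n →
      Tendsto (fun K : ℕ => (∑ j : Fin K, φ ((i : ℝ) / n) (D j ω)) / K) atTop
        (𝓝 (∫ l, φ ((i : ℝ) / n) l ∂distLaw p)) := by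
    rw [ae_all_iff]; intro n
    rw [ae_all_iff]; intro i
    by_cases hin : i ≤ n
    · filter_upwards [strong_law_distLaw hD hlaw hind (hφ _) (hi _ (hgrid n i hin))] with ω hω _
      exact hω
    · exact ae_of_all _ fun ω h => absurd h hin
  filter_upwards [hall, ae_forall_mem hD hlaw] with ω hω hmem
  rw [Metric.tendsto_atTop]
  intro ε hε
  -- The mesh is fine enough that replacing s by the grid point below it costs at most ε/4, once in
  -- the average and once in the mean. A third ε/4 comes from the law of large numbers at the grid
  -- point.
  obtain ⟨n, hn⟩ := exists_nat_gt (4 * L / ε)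
  have hn0 : (0 : ℝ) < n := lt_of_le_of_lt (by positivity) hn
  have hLn : L / n ≤ ε / 4 := by
    rw [div_lt_iff₀ hε] at hn
    rw [div_le_div_iff₀ hn0 (by norm_num)]; linarith
  have hev : ∀ᶠ K : ℕ in atTop, ∀ i ∈ Finset.range (n + 1),
      |(∑ j : Fin K, φ ((i : ℝ) / n) (D j ω)) / K - ∫ l, φ ((i : ℝ) / n) l ∂distLaw p|
        < ε / 4 := by
    rw [Finset.eventually_all]
    intro i hi
    have h := Metric.tendsto_nhds.1 (hω n i (by simpa [Nat.lt_succ_iff] using hi)) (ε / 4)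
      (by positivity)
    simpa [Real.dist_eq] using h
  obtain ⟨N, hN⟩ := eventually_atTop.1 (hev.and (eventually_gt_atTop 0))
  refine ⟨N, fun K hK => ?_⟩
  obtain ⟨hK1, hK0⟩ := hN K hK
  have hK' : (0 : ℝ) < K := by exact_mod_cast hK0
  set i := ⌊s K * n⌋₊
  have hsn : 0 ≤ s K * n := mul_nonneg (hs K).1 hn0.le
  have hin : i ≤ n := Nat.floor_le_of_le (by nlinarith [(hs K).2])
  have hdist : |s K - (i : ℝ) / n| ≤ 1 / n := by
    have h1 := Nat.floor_le hsn
    have h2 := Nat.lt_floor_add_one (s K * n)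
    have h3 : s K - (i : ℝ) / n = (s K * n - i) / n := by field_simp
    rw [h3, abs_of_nonneg (div_nonneg (by linarith) hn0.le)]
    gcongr
    linarith
  have hcl : ∀ l ∈ Set.Icc p.Rmin p.Rmax, |φ (s K) l - φ ((i : ℝ) / n) l| ≤ ε / 4 :=
    fun l hl => by
      refine (hL _ (hs K) _ (hgrid n i hin) l hl).trans ?_
      calc L * |s K - (i : ℝ) / n| ≤ L * (1 / n) := by gcongr
        _ = L / n := by ring
        _ ≤ ε / 4 := hLn
  have h1 := abs_integral_distLaw_sub_le (hi _ (hs K)) (hi _ (hgrid n i hin)) hcl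
  have h2 : |(∑ j : Fin K, φ (s K) (D j ω)) / K - (∑ j : Fin K, φ ((i : ℝ) / n) (D j ω)) / K|
      ≤ ε / 4 := by
    rw [← sub_div, ← Finset.sum_sub_distrib, abs_div, abs_of_pos hK', div_le_iff₀ hK']
    refine (Finset.abs_sum_le_sum_abs _ _).trans ?_
    refine (Finset.sum_le_sum fun (j : Fin K) _ => hcl (D j ω) (hmem (j : ℕ))).trans ?_
    simp [mul_comm]
  have h3 := hK1 i (Finset.mem_range.2 (Nat.lt_succ_of_le hin))
  rw [Real.dist_eq, sub_zero]
  rw [abs_le] at h1 h2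
  rw [abs_lt] at h3 ⊢
  constructor <;> linarith [h1.1, h1.2, h2.1, h2.2, h3.1, h3.2]

lemma abs_logb_add_sub_le {b s s' x : ℝ} (hb : 0 < b) (hs : 0 ≤ s) (hs' : 0 ≤ s') (hx : b ≤ x) :
    |Real.logb 2 (s + x) - Real.logb 2 (s' + x)| ≤ 2 / b * |s - s'| := by
  have key : ∀ u v : ℝ, 0 ≤ v → v ≤ u →
      |Real.logb 2 (u + x) - Real.logb 2 (v + x)| ≤ 2 / b * |u - v| := fun u v hv huv => by
    have h1 : 0 < v + x := by linarith
    have h2 : 1 ≤ (u + x) / (v + x) := by rw [one_le_div h1]; linarith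
    rw [← Real.logb_div (by linarith) h1.ne', abs_of_nonneg (Real.logb_nonneg one_lt_two h2),
      abs_of_nonneg (by linarith)]
    refine (two_logb_le h2).trans ?_
    have h3 : (u + x) / (v + x) - 1 = (u - v) / (v + x) := by field_simp; ring
    rw [h3]
    calc 2 * ((u - v) / (v + x)) ≤ 2 * ((u - v) / b) := by
          gcongr
          linarith
      _ = _ := by ring
  rcases le_total s' s with h | h
  · exact key s s' hs' h
  · rw [abs_sub_comm, abs_sub_comm s]; exact key s' s hs h

/-- t = M-K varies with K and may be unbounded. From log₂(1+tx) = log₂ t + log₂(1/t + x), the first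
term cancels between average and mean, while the second is a family Lipschitz in s = 1/t ∈ [0,1],
because x is bounded away from 0. -/
lemma tendsto_avg_modelRate1 (hD : ∀ i, Measurable (D i)) (hlaw : ∀ i, P.map (D i) = distLaw p)
    (hind : Pairwise fun i j => IndepFun (D i) (D j) P) {t : ℕ → ℝ} (ht : ∀ K, 1 ≤ t K) :
    ∀ᵐ ω ∂P, Tendsto (fun K : ℕ => (∑ i : Fin K, modelRate1 p (t K) (D i ω)) / K
      - ∫ l, modelRate1 p (t K) l ∂distLaw p) atTop (𝓝 0) := by
  have hg := gain1_pos p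
  have hb := pathLoss_Rmax_pos p
  set φ : ℝ → ℝ → ℝ := fun s l => Real.logb 2 (s + gain1 p * pathLoss p l) with hφdef
  have hφ : ∀ s, Measurable (φ s) := fun s => by
    have := measurable_pathLoss p
    simp only [hφdef, Real.logb]
    fun_prop
  have hi : ∀ s ∈ Set.Icc (0 : ℝ) 1, Integrable (φ s) (distLaw p) := fun s hs => by
    refine integrable_distLaw (hφ s) (C := max |Real.logb 2 (s + gain1 p * pathLoss p p.Rmax)|
      |Real.logb 2 (s + gain1 p * pathLoss p p.Rmin)|) fun l hl => ?_
    obtain ⟨h1, h2⟩ := pathLoss_mem p hl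
    have h3 : gain1 p * pathLoss p p.Rmax ≤ gain1 p * pathLoss p l := by gcongr
    have h4 : gain1 p * pathLoss p l ≤ gain1 p * pathLoss p p.Rmin := by gcongr
    have h5 : 0 < gain1 p * pathLoss p p.Rmax := by positivity
    have h6 := hs.1
    exact abs_le_max_abs_abs
      (Real.logb_le_logb_of_le one_lt_two (by linarith) (by linarith))
      (Real.logb_le_logb_of_le one_lt_two (by linarith) (by linarith))
  have h := strong_law_uniform hD hlaw hind hφ hi (L := 2 / (gain1 p * pathLoss p p.Rmax))
    (fun s hs s' hs' l hl => abs_logb_add_sub_le (by positivity) hs.1 hs'.1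
      (mul_le_mul_of_nonneg_left (pathLoss_mem p hl).1 hg.le))
    (s := fun K => (t K)⁻¹)
    (fun K => ⟨by have := ht K; positivity, inv_le_one_of_one_le₀ (ht K)⟩)
  have hsplit : ∀ K, ∀ l ∈ Set.Icc p.Rmin p.Rmax,
      modelRate1 p (t K) l = Real.logb 2 (t K) + φ (t K)⁻¹ l := fun K l hl => by
    have h1 : 0 < t K := by linarith [ht K]
    have h2 := pathLoss_pos p (pos_of_mem p hl)
    have h3 : 0 < gain1 p * pathLoss p l := by positivity
    rw [hφdef, ← Real.logb_mul h1.ne' (by positivity), modelRate1]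
    congr 1
    field_simp
  filter_upwards [h, ae_forall_mem hD hlaw] with ω hω hmem
  refine hω.congr' ?_
  filter_upwards [eventually_gt_atTop 0] with K hK
  have hK' : (K : ℝ) ≠ 0 := by exact_mod_cast hK.ne'
  have h1 : ∫ l, modelRate1 p (t K) l ∂distLaw p
      = Real.logb 2 (t K) + ∫ l, φ (t K)⁻¹ l ∂distLaw p := by
    rw [integral_congr_ae ((ae_distLaw p).mono (hsplit K)), integral_add (integrable_const _)
      (hi _ ⟨by have := ht K; positivity, inv_le_one_of_one_le₀ (ht K)⟩)]
    simp
  have h2 : ∑ i : Fin K, modelRate1 p (t K) (D i ω)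
      = K * Real.logb 2 (t K) + ∑ i : Fin K, φ (t K)⁻¹ (D i ω) := by
    rw [Finset.sum_congr rfl fun (i : Fin K) _ => hsplit K (D i ω) (hmem (i : ℕ)), Finset.sum_add_distrib]
    simp
  rw [h1, h2]
  field_simp
  ring

/-! ### Source-to-relay rates -/

lemma one_le_natCast_sub {M : ℕ → ℕ} (hM : ∀ K, K < M K) (K : ℕ) : 1 ≤ (M K : ℝ) - K := by
  have : (K : ℝ) + 1 ≤ M K := by exact_mod_cast hM K
  linarith

lemma tendsto_two_mul_estRatio_sub_one (p : Params) :
    Tendsto (fun K => 2 * (estRatio p K - 1)) atTop (𝓝 0) := by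
  have := ((tendsto_estRatio p).sub_const 1).const_mul 2
  simpa using this

lemma tendsto_avg_rate1 (hD : ∀ i, Measurable (D i)) (hlaw : ∀ i, P.map (D i) = distLaw p)
    (hind : Pairwise fun i j => IndepFun (D i) (D j) P) {M : ℕ → ℕ} (hM : ∀ K, K < M K) :
    ∀ᵐ ω ∂P, Tendsto (fun K : ℕ => (∑ k : Fin K, rate1 p (M K) (fun j : Fin K => D j ω) k) / K
      - limRate1 p K (M K)) atTop (𝓝 0) := by
  filter_upwards [tendsto_avg_modelRate1 hD hlaw hind (one_le_natCast_sub hM),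
    ae_forall_mem hD hlaw] with ω hω hmem
  have hθ := (tendsto_two_mul_estRatio_sub_one p).add (tendsto_two_mul_estRatio_sub_one p)
  rw [add_zero] at hθ
  have h2 : Tendsto (fun K : ℕ => ((∑ k : Fin K, rate1 p (M K) (fun j : Fin K => D j ω) k) / K
      - limRate1 p K (M K)) - ((∑ i : Fin K, modelRate1 p ((M K : ℝ) - K) (D i ω)) / K
      - ∫ l, modelRate1 p ((M K : ℝ) - K) l ∂distLaw p)) atTop (𝓝 0) := by
    refine squeeze_zero_norm' ?_ hθ
    filter_upwards [eventually_gt_atTop 0] with K hK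
    have hK' : (0 : ℝ) < K := by exact_mod_cast hK
    have h1 := (abs_limRate1_sub_le (p := p) hK (hM K)).2
    have h2 : |(∑ k : Fin K, rate1 p (M K) (fun j : Fin K => D j ω) k) / K
        - (∑ i : Fin K, modelRate1 p ((M K : ℝ) - K) (D i ω)) / K|
        ≤ 2 * (estRatio p K - 1) := by
      rw [← sub_div, ← Finset.sum_sub_distrib, abs_div, abs_of_pos hK', div_le_iff₀ hK']
      refine (Finset.abs_sum_le_sum_abs _ _).trans ?_
      refine (Finset.sum_le_sum fun k _ => abs_rate1_sub_le (p := p) (hM K)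
        (d := fun j : Fin K => D j ω) (fun j => hmem j) k).trans ?_
      rw [Finset.sum_const, Finset.card_univ, Fintype.card_fin, nsmul_eq_mul, mul_comm]
    rw [Real.norm_eq_abs]
    rw [abs_le] at h1 h2 ⊢
    constructor <;> linarith [h1.1, h1.2, h2.1, h2.2]
  have h3 := h2.add hω
  rw [add_zero] at h3
  exact h3.congr fun K => by ring

lemma integral_comp_distLaw {i : ℕ} (hD : ∀ i, Measurable (D i))
    (hlaw : ∀ i, P.map (D i) = distLaw p) {g : ℝ → ℝ} (hg : Measurable g)
    (hi : Integrable g (distLaw p)) :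
    Integrable (fun ω => g (D i ω)) P ∧ ∫ ω, g (D i ω) ∂P = ∫ l, g l ∂distLaw p := by
  constructor
  · rw [← hlaw i] at hi
    exact hi.comp_measurable (hD i)
  · rw [← hlaw i, integral_map (hD i).aemeasurable hg.aestronglyMeasurable]

lemma measurable_snr1_sum (hD : ∀ i, Measurable (D i)) (K M : ℕ) (k : Fin K) :
    Measurable fun ω => Real.logb 2 (1 + snr1 p K M
      (∑ j : Fin K, errVar p K (pathLoss p (D j ω))) (D k ω)) := by
  have h1 : ∀ i, Measurable fun ω => estVar p K (pathLoss p (D i ω)) := fun i =>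
    (measurable_estVar p K).comp (hD i)
  have h2 : ∀ i, Measurable fun ω => errVar p K (pathLoss p (D i ω)) := fun i =>
    (measurable_errVar p K).comp (hD i)
  unfold snr1 Real.logb
  fun_prop

/-- The constant 4 is twice the comparison with `modelRate1`: once for the rate and once for
`limRate1`. -/
lemma mean_rate1 [IsProbabilityMeasure P] (hD : ∀ i, Measurable (D i))
    (hlaw : ∀ i, P.map (D i) = distLaw p) {K M : ℕ} (hKM : K < M) (k : Fin K) :
    Integrable (fun ω => rate1 p M (fun j : Fin K => D j ω) k) P ∧
    |∫ ω, rate1 p M (fun j : Fin K => D j ω) k ∂P - limRate1 p K M|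
      ≤ 4 * (estRatio p K - 1) := by
  have hmem := ae_forall_mem hD hlaw
  have ht : (0 : ℝ) ≤ (M : ℝ) - K := by rw [sub_nonneg]; exact_mod_cast hKM.le
  obtain ⟨hi, he⟩ := integral_comp_distLaw (i := k) hD hlaw (measurable_modelRate1 (p := p) _)
    (integrable_modelRate1 ht)
  -- Measurability in the locations is read off the closed form, which agrees with the rate almost
  -- surely.
  have hae : (fun ω => rate1 p M (fun j : Fin K => D j ω) k) =ᵐ[P] fun ω =>
      Real.logb 2 (1 + snr1 p K M (∑ j : Fin K, errVar p K (pathLoss p (D j ω))) (D k ω)) := by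
    filter_upwards [hmem] with ω hω
    exact rate1_eq hKM (d := fun j : Fin K => D j ω) (fun j => hω j) k
  have hasm : AEStronglyMeasurable (fun ω => rate1 p M (fun j : Fin K => D j ω) k) P :=
    (measurable_snr1_sum hD K M k).aestronglyMeasurable.congr hae.symm
  have hb : ∀ᵐ ω ∂P, ‖rate1 p M (fun j : Fin K => D j ω) k
      - modelRate1 p ((M : ℝ) - K) (D k ω)‖ ≤ 2 * (estRatio p K - 1) := by
    filter_upwards [hmem] with ω hω
    exact abs_rate1_sub_le hKM (d := fun j : Fin K => D j ω) (fun j => hω j) k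
  have hdi : Integrable (fun ω => rate1 p M (fun j : Fin K => D j ω) k
      - modelRate1 p ((M : ℝ) - K) (D k ω)) P := Integrable.of_bound (hasm.sub hi.1) _ hb
  have hri : Integrable (fun ω => rate1 p M (fun j : Fin K => D j ω) k) P :=
    (hdi.add hi).congr (ae_of_all _ fun ω => sub_add_cancel _ _)
  refine ⟨hri, ?_⟩
  have h1 := norm_integral_le_of_norm_le_const hb
  rw [integral_sub hri hi, he, probReal_univ, mul_one, Real.norm_eq_abs] at h1
  have h2 := (abs_limRate1_sub_le (p := p) k.pos hKM).2
  rw [abs_le] at h1 h2 ⊢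
  constructor <;> linarith [h1.1, h1.2, h2.1, h2.2]

/-! ### Relay-to-destination rates -/

lemma tendsto_normRatio (hD : ∀ i, Measurable (D i)) (hlaw : ∀ i, P.map (D i) = distLaw p)
    (hind : Pairwise fun i j => IndepFun (D i) (D j) P) :
    ∀ᵐ ω ∂P, Tendsto (fun K : ℕ => normRatio p (fun j : Fin K => D j ω)) atTop (𝓝 1) := by
  have hm := meanInv_pos p
  filter_upwards [strong_law_distLaw hD hlaw hind (g := fun l => (pathLoss p l)⁻¹)
    (measurable_pathLoss p).inv (integrable_inv_pathLoss p)] with ω hω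
  change Tendsto _ _ (𝓝 (meanInv p)) at hω
  have h1 := hω.div_const (meanInv p)
  have h2 := hω.inv₀ hm.ne' |>.const_mul (meanInv p)
  rw [div_self hm.ne'] at h1
  rw [mul_inv_cancel₀ hm.ne'] at h2
  have h3 := ((h1.sub_const 1).abs.const_add 1).add (h2.sub_const 1).abs
  simp only [sub_self, abs_zero, add_zero] at h3
  refine h3.congr' ?_
  filter_upwards [eventually_gt_atTop 0] with K hK
  have hK' : (K : ℝ) ≠ 0 := by exact_mod_cast hK.ne'
  rw [normRatio, div_div, inv_div, mul_div_assoc', mul_comm (meanInv p)]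

lemma measurable_normRatio (hD : ∀ i, Measurable (D i)) (K : ℕ) :
    Measurable fun ω => normRatio p (fun j : Fin K => D j ω) := by
  have h1 : ∀ i, Measurable fun ω => pathLoss p (D i ω) := fun i =>
    (measurable_pathLoss p).comp (hD i)
  have h2 : Measurable fun ω => ∑ j : Fin K, (pathLoss p (D j ω))⁻¹ :=
    Finset.measurable_sum _ fun j _ => (h1 j).inv
  unfold normRatio
  exact (measurable_const.add ((h2.div_const _).sub_const 1).abs).add
    ((h2.const_div _).sub_const 1).abs

lemma integrable_normRatio [IsProbabilityMeasure P] (hD : ∀ i, Measurable (D i))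
    (hlaw : ∀ i, P.map (D i) = distLaw p) (K : ℕ) :
    Integrable (fun ω => normRatio p (fun j : Fin K => D j ω)) P := by
  refine Integrable.of_bound (measurable_normRatio hD K).aestronglyMeasurable
    (3 + (pathLoss p p.Rmax)⁻¹ / meanInv p + meanInv p * pathLoss p p.Rmin) ?_
  filter_upwards [ae_forall_mem hD hlaw] with ω hω
  rw [Real.norm_of_nonneg (by linarith [one_le_normRatio (p := p) (fun j : Fin K => D j ω)])]
  exact normRatio_le fun j => hω j

lemma tendsto_integral_normRatio [IsProbabilityMeasure P] (hD : ∀ i, Measurable (D i))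
    (hlaw : ∀ i, P.map (D i) = distLaw p)
    (hind : Pairwise fun i j => IndepFun (D i) (D j) P) :
    Tendsto (fun K : ℕ => ∫ ω, normRatio p (fun j : Fin K => D j ω) ∂P) atTop (𝓝 1) := by
  have h := tendsto_integral_of_dominated_convergence (μ := P)
    (F := fun (K : ℕ) ω => normRatio p (fun j : Fin K => D j ω)) (f := fun _ => (1 : ℝ))
    (fun _ => 3 + (pathLoss p p.Rmax)⁻¹ / meanInv p + meanInv p * pathLoss p p.Rmin)
    (fun K => (measurable_normRatio hD K).aestronglyMeasurable) (integrable_const _)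
    (fun K => by
      filter_upwards [ae_forall_mem hD hlaw] with ω hω
      rw [Real.norm_of_nonneg
        (by linarith [one_le_normRatio (p := p) (fun j : Fin K => D j ω)])]
      exact normRatio_le fun j => hω j)
    (tendsto_normRatio hD hlaw hind)
  simpa using h

lemma abs_sum_rate2_sub_le {K M : ℕ} (hKM : K < M) {d : Fin K → ℝ}
    (hd : ∀ k, d k ∈ Set.Icc p.Rmin p.Rmax) :
    |∑ k, rate2 p M d k - K * limRate2 p K M| ≤ K * absErr p K (normRatio p d) ∧
    |∑ k, rate2 p M d k - K * limRate2 p K M|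
      ≤ relErr p K (normRatio p d) * (K * limRate2 p K M) := by
  have h0 : ∑ k, rate2 p M d k - K * limRate2 p K M
      = ∑ k, (rate2 p M d k - limRate2 p K M) := by
    rw [Finset.sum_sub_distrib]; simp
  rw [h0]
  constructor
  · refine (Finset.abs_sum_le_sum_abs _ _).trans ?_
    refine (Finset.sum_le_sum fun k _ => (abs_rate2_sub_le hKM hd k).1).trans ?_
    simp
  · refine (Finset.abs_sum_le_sum_abs _ _).trans ?_
    refine (Finset.sum_le_sum fun k _ => (abs_rate2_sub_le hKM hd k).2).trans ?_
    simp only [Finset.sum_const, Finset.card_univ, Fintype.card_fin, nsmul_eq_mul]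
    exact (mul_left_comm _ _ _).le

lemma tendsto_avg_rate2 (hD : ∀ i, Measurable (D i)) (hlaw : ∀ i, P.map (D i) = distLaw p)
    (hind : Pairwise fun i j => IndepFun (D i) (D j) P) {M : ℕ → ℕ} (hM : ∀ K, K < M K) :
    ∀ᵐ ω ∂P, Tendsto (fun K : ℕ => (∑ k : Fin K, rate2 p (M K) (fun j : Fin K => D j ω) k) / K
      - limRate2 p K (M K)) atTop (𝓝 0) := by
  filter_upwards [tendsto_normRatio hD hlaw hind, ae_forall_mem hD hlaw] with ω hω hmem
  refine squeeze_zero_norm' ?_ (tendsto_absErr (p := p) hω)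
  filter_upwards [eventually_gt_atTop 0] with K hK
  have hK' : (0 : ℝ) < K := by exact_mod_cast hK
  have h := (abs_sum_rate2_sub_le (p := p) (hM K) (d := fun j : Fin K => D j ω)
    (fun j => hmem j)).1
  have e : (∑ k : Fin K, rate2 p (M K) (fun j : Fin K => D j ω) k) / K - limRate2 p K (M K)
      = (∑ k : Fin K, rate2 p (M K) (fun j : Fin K => D j ω) k - K * limRate2 p K (M K)) / K := by
    field_simp
  rw [e, Real.norm_eq_abs, abs_div, abs_of_pos hK', div_le_iff₀ hK', mul_comm (absErr _ _ _)]
  exact h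

lemma measurable_snr2_sum (hD : ∀ i, Measurable (D i)) (K M : ℕ) (k : Fin K) :
    Measurable fun ω => Real.logb 2 (1 + snr2 p K M
      (∑ j : Fin K, (estVar p K (pathLoss p (D j ω)))⁻¹) (D k ω)) := by
  have h1 : ∀ i, Measurable fun ω => estVar p K (pathLoss p (D i ω)) := fun i =>
    (measurable_estVar p K).comp (hD i)
  have h2 : ∀ i, Measurable fun ω => errVar p K (pathLoss p (D i ω)) := fun i =>
    (measurable_errVar p K).comp (hD i)
  unfold snr2 Real.logb
  fun_prop

lemma mean_rate2 [IsProbabilityMeasure P] (hD : ∀ i, Measurable (D i))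
    (hlaw : ∀ i, P.map (D i) = distLaw p) {K M : ℕ} (hKM : K < M) (k : Fin K) :
    Integrable (fun ω => rate2 p M (fun j : Fin K => D j ω) k) P ∧
    |∫ ω, rate2 p M (fun j : Fin K => D j ω) k ∂P - limRate2 p K M|
      ≤ absErr p K (∫ ω, normRatio p (fun j : Fin K => D j ω) ∂P) ∧
    |∫ ω, rate2 p M (fun j : Fin K => D j ω) k ∂P - limRate2 p K M|
      ≤ relErr p K (∫ ω, normRatio p (fun j : Fin K => D j ω) ∂P) * limRate2 p K M := by
  have hmem := ae_forall_mem hD hlaw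
  have hae : (fun ω => rate2 p M (fun j : Fin K => D j ω) k) =ᵐ[P] fun ω =>
      Real.logb 2 (1 + snr2 p K M (∑ j : Fin K, (estVar p K (pathLoss p (D j ω)))⁻¹) (D k ω)) := by
    filter_upwards [hmem] with ω hω
    exact rate2_eq hKM (d := fun j : Fin K => D j ω) (fun j => hω j) k
  have hasm : AEStronglyMeasurable (fun ω => rate2 p M (fun j : Fin K => D j ω) k) P :=
    (measurable_snr2_sum hD K M k).aestronglyMeasurable.congr hae.symm
  have hn := integrable_normRatio hD hlaw (p := p) (P := P) K
  have hb : ∀ᵐ ω ∂P, |rate2 p M (fun j : Fin K => D j ω) k - limRate2 p K M|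
        ≤ absErr p K (normRatio p fun j : Fin K => D j ω) ∧
      |rate2 p M (fun j : Fin K => D j ω) k - limRate2 p K M|
        ≤ relErr p K (normRatio p fun j : Fin K => D j ω) * limRate2 p K M := by
    filter_upwards [hmem] with ω hω
    exact abs_rate2_sub_le hKM (d := fun j : Fin K => D j ω) (fun j => hω j) k
  have hia : Integrable (fun ω => absErr p K (normRatio p fun j : Fin K => D j ω)) P := by
    unfold absErr
    exact (((((hn.const_mul _).mul_const _).sub (integrable_const 1)).const_mul 2).add
      (integrable_const _))
  have hir : Integrable (fun ω => relErr p K (normRatio p fun j : Fin K => D j ω)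
      * limRate2 p K M) P := by
    unfold relErr
    exact (((((hn.const_mul _).mul_const _).sub (integrable_const 1)).add
      (integrable_const _)).mul_const _).mul_const _
  -- Both error bounds are affine in the normalization ratio, so its expectation passes inside.
  have hea : ∫ ω, absErr p K (normRatio p fun j : Fin K => D j ω) ∂P
      = absErr p K (∫ ω, normRatio p (fun j : Fin K => D j ω) ∂P) := by
    have h1 : ∀ r, absErr p K r = 2 * (estRatio p K * noiseRatio p K) * r
        + (-2 + 2 * (estRatio p K * noiseRatio p K - 1)) := fun r => by unfold absErr; ring
    simp_rw [h1]
    rw [integral_add (hn.const_mul _) (integrable_const _), integral_const_mul]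
    simp
  have her : ∫ ω, relErr p K (normRatio p fun j : Fin K => D j ω) * limRate2 p K M ∂P
      = relErr p K (∫ ω, normRatio p (fun j : Fin K => D j ω) ∂P) * limRate2 p K M := by
    rw [integral_mul_const]
    congr 1
    have h1 : ∀ r, relErr p K r = (estRatio p K * noiseRatio p K) ^ 2 * r
        + (estRatio p K * noiseRatio p K - 2) * (estRatio p K * noiseRatio p K) := fun r => by
      unfold relErr; ring
    simp_rw [h1]
    rw [integral_add (hn.const_mul _) (integrable_const _), integral_const_mul]
    simp
  have hdi : Integrable (fun ω => rate2 p M (fun j : Fin K => D j ω) k - limRate2 p K M) P :=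
    hia.mono' (hasm.sub aestronglyMeasurable_const) (hb.mono fun ω h => h.1)
  have hri : Integrable (fun ω => rate2 p M (fun j : Fin K => D j ω) k) P :=
    (hdi.add (integrable_const (limRate2 p K M))).congr
      (ae_of_all _ fun ω => sub_add_cancel _ _)
  have hsub : ∫ ω, rate2 p M (fun j : Fin K => D j ω) k ∂P - limRate2 p K M
      = ∫ ω, (rate2 p M (fun j : Fin K => D j ω) k - limRate2 p K M) ∂P := by
    rw [integral_sub hri (integrable_const _)]; simp
  rw [hsub, ← hea, ← her]
  exact ⟨hri, norm_integral_le_of_norm_le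
      (f := fun ω => rate2 p M (fun j : Fin K => D j ω) k - limRate2 p K M) hia
      (hb.mono fun ω h => h.1),
    norm_integral_le_of_norm_le
      (f := fun ω => rate2 p M (fun j : Fin K => D j ω) k - limRate2 p K M) hir
      (hb.mono fun ω h => h.2)⟩

end

/-! ### Energy efficiency -/

lemma isEquivalent_of_eventually_abs_sub_le {u v δ : ℕ → ℝ} (hδ : Tendsto δ atTop (𝓝 0))
    (h : ∀ᶠ K in atTop, |u K - v K| ≤ δ K * |v K|) : u ~[atTop] v := by
  rw [IsEquivalent, isLittleO_iff]
  intro c hc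
  filter_upwards [h, hδ.eventually (gt_mem_nhds hc)] with K h1 h2
  exact h1.trans (mul_le_mul_of_nonneg_right h2.le (abs_nonneg _))

/-- Prefactor and power are shared, so a relative error of the sum rate passes to the efficiency
unchanged. Absolute values are needed because the prefactor is negative when T < 2K. -/
lemma abs_effOfRate_sub_le {p : Params} {K M : ℕ} {T Q S S' δ : ℝ} (hS' : 0 ≤ S')
    (h : |S - S'| ≤ δ * S') :
    |effOfRate p K M T Q S - effOfRate p K M T Q S'| ≤ δ * |effOfRate p K M T Q S'| := by
  unfold effOfRate
  generalize (1 - 2 * (K : ℝ) / T) * (p.B / 2) = c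
  generalize totalPower p K M T Q = d
  rw [← sub_div, ← mul_sub, abs_div, abs_mul, abs_div, abs_mul c S', abs_of_nonneg hS',
    ← mul_div_assoc]
  refine div_le_div_of_nonneg_right ?_ (abs_nonneg d)
  calc |c| * |S - S'| ≤ |c| * (δ * S') := by gcongr
    _ = _ := by ring

end RelayIoT

/-! ### The main theorem. -/

theorem theorem2 (p : RelayIoT.Params)
    (M : ℕ → ℕ) (hM : ∀ K, K < M K)
    (T : ℕ → ℝ) (hT : ∀ K, 0 < T K)
    {Ω : Type*} [MeasurableSpace Ω] (P : Measure Ω) [IsProbabilityMeasure P]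
    (X : ℕ ⊕ ℕ → Ω → ℂ) (hX : ∀ i, Measurable (X i)) (hind : iIndepFun X P)
    (hunif : ∀ i, pdf.IsUniform (X i) (RelayIoT.coverage p) P volume)
    (dS dD : ∀ K : ℕ, Ω → Fin K → ℝ)
    (hdS : ∀ K ω k, dS K ω k = ‖X (Sum.inl k) ω‖)
    (hdD : ∀ K ω k, dD K ω k = ‖X (Sum.inr k) ω‖) :
    -- the energy efficiency is almost surely asymptotic to the deterministic expression
    (∀ᵐ ω ∂P,
      (fun K => RelayIoT.energyEff p (M K) (T K) (dS K ω) (dD K ω))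
        ~[atTop] (fun K => RelayIoT.limEff p K (M K) (T K))) ∧
    (∀ᵐ ω ∂P, Tendsto
      (fun K => RelayIoT.energyEff p (M K) (T K) (dS K ω) (dD K ω)
        - RelayIoT.limEff p K (M K) (T K)) atTop (𝓝 0)) ∧
    -- the same with the rates of each hop averaged over the device locations
    (fun K => RelayIoT.effOfRate p K (M K) (T K) p.PR
        (∑ k, min (∫ ω, RelayIoT.rate1 p (M K) (dS K ω) k ∂P)
          (∫ ω, RelayIoT.rate2 p (M K) (dD K ω) k ∂P)))
      ~[atTop] (fun K => RelayIoT.limEff p K (M K) (T K)) ∧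
    -- the rates of both hops, averaged over the pairs
    (∀ᵐ ω ∂P, Tendsto
      (fun K : ℕ => (∑ k, RelayIoT.rate1 p (M K) (dS K ω) k) / K
        - RelayIoT.limRate1 p K (M K)) atTop (𝓝 0)) ∧
    (∀ᵐ ω ∂P, Tendsto
      (fun K : ℕ => (∑ k, RelayIoT.rate2 p (M K) (dD K ω) k) / K
        - RelayIoT.limRate2 p K (M K)) atTop (𝓝 0)) ∧
    -- the rates of both hops, averaged over the device locations
    (∀ ε > 0, ∀ᶠ K in atTop, ∀ k : Fin K,
      Integrable (fun ω => RelayIoT.rate1 p (M K) (dS K ω) k) P ∧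
      |∫ ω, RelayIoT.rate1 p (M K) (dS K ω) k ∂P - RelayIoT.limRate1 p K (M K)| < ε) ∧
    (∀ ε > 0, ∀ᶠ K in atTop, ∀ k : Fin K,
      Integrable (fun ω => RelayIoT.rate2 p (M K) (dD K ω) k) P ∧
      |∫ ω, RelayIoT.rate2 p (M K) (dD K ω) k ∂P - RelayIoT.limRate2 p K (M K)| < ε) ∧
    -- the closed forms are the expectations of the interference and power normalization sums
    (∀ K : ℕ, 0 < K →
      RelayIoT.A1 p K = K * (∫ l in p.Rmin..p.Rmax,
        RelayIoT.errVar p K (RelayIoT.pathLoss p l) * RelayIoT.distDensity p l) ∧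
      RelayIoT.A2 p K = K * (∫ l in p.Rmin..p.Rmax,
        (RelayIoT.estVar p K (RelayIoT.pathLoss p l))⁻¹ * RelayIoT.distDensity p l)) := by
  open RelayIoT in
  obtain rfl : dS = fun K ω (k : Fin K) => ‖X (Sum.inl k) ω‖ := by
    ext K ω k; exact hdS K ω k
  obtain rfl : dD = fun K ω (k : Fin K) => ‖X (Sum.inr k) ω‖ := by
    ext K ω k; exact hdD K ω k
  have hmS : ∀ i : ℕ, Measurable fun ω => ‖X (Sum.inl i) ω‖ := fun i => (hX _).norm
  have hmD : ∀ i : ℕ, Measurable fun ω => ‖X (Sum.inr i) ω‖ := fun i => (hX _).norm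
  have hlS : ∀ i : ℕ, P.map (fun ω => ‖X (Sum.inl i) ω‖) = distLaw p := fun i =>
    map_norm_of_isUniform p (hX _) (hunif _)
  have hlD : ∀ i : ℕ, P.map (fun ω => ‖X (Sum.inr i) ω‖) = distLaw p := fun i =>
    map_norm_of_isUniform p (hX _) (hunif _)
  have hiS : Pairwise fun i j : ℕ =>
      IndepFun (fun ω => ‖X (Sum.inl i) ω‖) (fun ω => ‖X (Sum.inl j) ω‖) P := fun i j hij =>
    (hind.indepFun fun h => hij (Sum.inl_injective h)).comp measurable_norm measurable_norm
  have hiD : Pairwise fun i j : ℕ =>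
      IndepFun (fun ω => ‖X (Sum.inr i) ω‖) (fun ω => ‖X (Sum.inr j) ω‖) P := fun i j hij =>
    (hind.indepFun fun h => hij (Sum.inr_injective h)).comp measurable_norm measurable_norm
  -- A vanishing relative error, with δ depending on ω through the normalization ratio, gives both
  -- almost sure claims on the efficiency.
  have heff : ∀ᵐ ω ∂P, ∃ δ : ℕ → ℝ, Tendsto δ atTop (𝓝 0) ∧ ∀ᶠ K in atTop,
      |energyEff p (M K) (T K) (fun k : Fin K => ‖X (Sum.inl k) ω‖)
        (fun k : Fin K => ‖X (Sum.inr k) ω‖) - limEff p K (M K) (T K)|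
        ≤ δ K * |limEff p K (M K) (T K)| := by
    filter_upwards [tendsto_normRatio hmD hlD hiD, ae_forall_mem hmS hlS,
      ae_forall_mem hmD hlD] with ω hω hS hD
    refine ⟨_, tendsto_relErr (p := p) hω, ?_⟩
    filter_upwards [eventually_rate2_le_rate1 p, eventually_gt_atTop 0] with K hle hK
    obtain ⟨h1, h2⟩ := hle (M K) (hM K)
    have hdS' : ∀ k : Fin K, ‖X (Sum.inl k) ω‖ ∈ Set.Icc p.Rmin p.Rmax := fun k => hS k
    have hdD' : ∀ k : Fin K, ‖X (Sum.inr k) ω‖ ∈ Set.Icc p.Rmin p.Rmax := fun k => hD k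
    rw [energyEff, limEff, min_eq_right h2, relayPower_equalPower p hK
      (fun k => pathLoss_pos p (pos_of_mem p (hdD' k))) (hM K),
      Finset.sum_congr rfl fun k _ => min_eq_right (h1 _ _ hdS' hdD' k)]
    exact abs_effOfRate_sub_le
      (mul_nonneg K.cast_nonneg (limRate2_close (p := p) hK (hM K)).2.2.2.1)
      (abs_sum_rate2_sub_le (hM K) hdD').2
  refine ⟨?_, ?_, ?_, tendsto_avg_rate1 hmS hlS hiS hM, tendsto_avg_rate2 hmD hlD hiD hM,
    ?_, ?_, fun K hK => ⟨A1_eq p hK, A2_eq p hK⟩⟩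
  · filter_upwards [heff] with ω hω
    obtain ⟨δ, h1, h2⟩ := hω
    exact isEquivalent_of_eventually_abs_sub_le h1 h2
  · obtain ⟨C, hC⟩ := limEff_bounded p
    filter_upwards [heff] with ω hω
    obtain ⟨δ, h1, h2⟩ := hω
    have h3 := h1.abs.mul_const C
    rw [abs_zero, zero_mul] at h3
    refine squeeze_zero_norm' ?_ h3
    filter_upwards [h2, hC] with K h4 h5
    refine h4.trans ?_
    calc δ K * |limEff p K (M K) (T K)| ≤ |δ K| * |limEff p K (M K) (T K)| := by
          gcongr; exact le_abs_self _
      _ ≤ _ := by gcongr; exact h5 _ (hM K) _ (hT K)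
  · refine isEquivalent_of_eventually_abs_sub_le
      -- The same relative error as before, with the normalization ratio replaced by its
      -- expectation.
      (tendsto_relErr (p := p) (tendsto_integral_normRatio hmD hlD hiD)) ?_
    filter_upwards [eventually_rate2_le_rate1 p, eventually_gt_atTop 0] with K hle hK
    obtain ⟨h1, h2⟩ := hle (M K) (hM K)
    have h3 : ∀ k : Fin K, min
        (∫ ω, rate1 p (M K) (fun j : Fin K => ‖X (Sum.inl j) ω‖) k ∂P)
        (∫ ω, rate2 p (M K) (fun j : Fin K => ‖X (Sum.inr j) ω‖) k ∂P)
        = ∫ ω, rate2 p (M K) (fun j : Fin K => ‖X (Sum.inr j) ω‖) k ∂P := fun k => by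
      -- The almost sure order of the two hops passes to expectations, so the second hop is again
      -- the minimum.
      refine min_eq_right (integral_mono_ae (mean_rate2 hmD hlD (hM K) k).1
        (mean_rate1 hmS hlS (hM K) k).1 ?_)
      filter_upwards [ae_forall_mem hmS hlS, ae_forall_mem hmD hlD] with ω hS hD
      exact h1 _ _ (fun j => hS j) (fun j => hD j) k
    rw [limEff, min_eq_right h2, Finset.sum_congr rfl fun k _ => h3 k]
    refine abs_effOfRate_sub_le
      (mul_nonneg K.cast_nonneg (limRate2_close (p := p) hK (hM K)).2.2.2.1) ?_
    have h0 : ∑ k : Fin K, ∫ ω, rate2 p (M K) (fun j : Fin K => ‖X (Sum.inr j) ω‖) k ∂P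
        - K * limRate2 p K (M K)
        = ∑ k : Fin K, (∫ ω, rate2 p (M K) (fun j : Fin K => ‖X (Sum.inr j) ω‖) k ∂P
          - limRate2 p K (M K)) := by
      rw [Finset.sum_sub_distrib]; simp
    rw [h0]
    refine (Finset.abs_sum_le_sum_abs _ _).trans ?_
    refine (Finset.sum_le_sum fun k _ => (mean_rate2 hmD hlD (hM K) k).2.2).trans ?_
    simp only [Finset.sum_const, Finset.card_univ, Fintype.card_fin, nsmul_eq_mul]
    exact (mul_left_comm _ _ _).le
  · intro ε hε
    have h := (tendsto_two_mul_estRatio_sub_one p).eventually (gt_mem_nhds (half_pos hε))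
    filter_upwards [h] with K hK k
    obtain ⟨h1, h2⟩ := mean_rate1 hmS hlS (hM K) k
    exact ⟨h1, h2.trans_lt (by linarith)⟩
  · intro ε hε
    have h := (tendsto_absErr (p := p) (tendsto_integral_normRatio hmD hlD hiD)).eventually
      (gt_mem_nhds hε)
    filter_upwards [h] with K hK k
    obtain ⟨h1, h2, -⟩ := mean_rate2 hmD hlD (hM K) k
    exact ⟨h1, h2.trans_lt hK⟩
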